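/- Let $X$ be a $\sigma$-finite measure space and $\mathcal H=L^2(X)$ (complex-valued). Let $H_0$ be a nonnegative self-adjoint operator, $H$ a self-adjoint operator, and $Y,Z$ densely defined closed operators on $\mathcal H$. Assume that $H=H_0+Y^*Z$ in the form sense, i.e. \[D(H)\cup D(H_0)\subset D(Y)\cap D(Z)\quad\text{and}\quad \langle Hu,v\rangle=\langle u,H_0v\rangle+\langle Zu,Yv\rangle\quad\text{for all }u\in D(H),\ v\in D(H_0).\] Let $\theta\in\mathbb R$ and, if $\theta\neq0$, assume that $H_0$ is injective, so that $H_0^{\theta}$ and $H_0^{-\theta}$ are defined by the functional calculus. Assume that $YH_0^{\theta}$ is $H_0$-smooth: writing $A$ for the closure of the operator $YH_0^\theta$ with domain $\{u\in D(H_0^\theta): H_0^\theta u\in D(Y)\}$, there is a constant $C$ such that for every $u\in\mathcal H$ one has $e^{-itH_0}u\in D(A)$ for almost every $t\in\mathbb R$ and \[\|Ae^{-itH_0}u\|_{L^2_t\mathcal H}\le C\|u\|_{\mathcal H}.\] Assume also that there is a constant $C$ such that for every $u\in D(H_0^{-\theta})$ one has $e^{-itH}H_0^{-\theta}u\in D(Z)$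 for almost every $t\in\mathbb R$ and \[\|Ze^{-itH}H_0^{-\theta}u\|_{L^2_t\mathcal H}\le C\|u\|_{\mathcal H}.\] Let $q,r\in[2,\infty]$ and $\alpha\in(1,\infty)$. Call a finite or countably infinite family $\{f_n\}\subset D(H_0^\theta)$ an orthonormal system in $D(H_0^\theta)$ if $\langle H_0^\theta f_m,H_0^\theta f_n\rangle=\delta_{mn}$. Suppose there is a constant $C$ such that \[\Big\|\sum_{n}\nu_n|e^{-itH_0}f_n|^2\Big\|_{L^{q/2}_tL^{r/2}_x}\le C\|\{\nu_n\}\|_{\ell^\alpha}\] for all orthonormal systems $\{f_n\}$ in $D(H_0^\theta)$ and all complex sequences $\{\nu_n\}\in\ell^\alpha$, where the series converges absolutely for almost every $(t,x)\in\mathbb R\times X$. Then there is a constant $C'$ such that \[\Big\|\sum_{n}\nu_n|e^{-itH}f_n|^2\Big\|_{L^{q/2}_tL^{r/2}_x}\le C'\|\{\nu_n\}\|_{\ell^\alpha}\] for all orthonormal systems $\{f_n\}$ in $D(H_0^\theta)$ and all $\{\nu_n\}\in\ell^\alpha$, with the same $q,r,\alpha$, the series again converging absolutely for almost every $(t,x)$.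 -/

import Mathlib

open MeasureTheory
open scoped ENNReal NNReal

noncomputable section

namespace OrthStrichartz

section Operators

variable {E : Type*} [NormedAddCommGroup E] [InnerProductSpace ℂ E] [CompleteSpace E]

/-- `U` is the strongly continuous one-parameter unitary group with generator `-iA`:
`u ∈ D(A)` with `A u = v` if and only if `t ↦ U t u` has derivative `-i v` at `0`. -/
structure IsUnitaryGroupOf (U : ℝ → E →L[ℂ] E) (A : E →ₗ.[ℂ] E) : Prop where
  zero : U 0 = 1
  add : ∀ s t : ℝ, U (s + t) = U s * U t
  unitary : ∀ t : ℝ, U t ∈ unitary (E →L[ℂ] E)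
  continuous : ∀ u : E, Continuous fun t : ℝ => U t u
  generator : ∀ u v : E,
    (u, v) ∈ A.graph ↔ HasDerivAt (fun t : ℝ => U t u) (-(Complex.I • v)) 0

open Classical in
/-- The unitary group `e^{-itA}` of a self-adjoint operator `A`: by Stone's theorem there is
exactly one unitary group with generator `-iA`. (The value `0` is never taken when `A` is
self-adjoint.) -/
def propagator (A : E →ₗ.[ℂ] E) : ℝ → E →L[ℂ] E :=
  if h : ∃ U : ℝ → E →L[ℂ] E, IsUnitaryGroupOf U A then h.choose else fun _ => 0

/-- `B` is the everywhere defined bounded inverse `(1 + A)⁻¹`. -/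
def IsResolvent (A : E →ₗ.[ℂ] E) (B : E →L[ℂ] E) : Prop :=
  (∀ u : E, (B u, u - B u) ∈ A.graph) ∧ ∀ u : A.domain, B (u + A u) = u

open Classical in
/-- The bounded operator `(1 + A)⁻¹` of a nonnegative self-adjoint operator `A`. (The value `0`
is never taken when `A` is nonnegative self-adjoint, unless `E` is trivial.) -/
def resolventOne (A : E →ₗ.[ℂ] E) : E →L[ℂ] E :=
  if h : ∃ B : E →L[ℂ] E, IsResolvent A B then h.choose else 0

/-- The power `A ^ s`, `s ∈ ℝ`, of a nonnegative self-adjoint operator `A`, injective when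
`s < 0`, in the sense of the functional calculus of `A`. With `B = (1 + A)⁻¹`, so that
`0 ≤ B ≤ 1` and `λ = (1 - b) / b` when `b = (1 + λ)⁻¹`, one has `λ ^ s = q b / p b` for
`p b = b ^ s⁺ (1 - b) ^ s⁻` and `q b = b ^ s⁻ (1 - b) ^ s⁺`, where `s = s⁺ - s⁻`. Thus `A ^ s` is
the closed operator with graph `{(p(B) w, q(B) w) | w ∈ E}`, where `p(B)`, `q(B)` are given by
the continuous functional calculus of the bounded self-adjoint operator `B`. Its domain is
`{u | ∫ λ ^ (2 s) d⟨E(λ) u, u⟩ < ∞}`, with `E` the spectral measure of `A`. -/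
def power (A : E →ₗ.[ℂ] E) (s : ℝ) : E →ₗ.[ℂ] E :=
  (LinearMap.range
    (((cfc (fun b : ℝ => b ^ max s 0 * (1 - b) ^ max (-s) 0) (resolventOne A) :
          E →L[ℂ] E) : E →ₗ[ℂ] E).prod
      ((cfc (fun b : ℝ => b ^ max (-s) 0 * (1 - b) ^ max s 0) (resolventOne A) :
          E →L[ℂ] E) : E →ₗ[ℂ] E))).toLinearPMap

/-- The product `S T` on its natural domain `{u ∈ D(T) | T u ∈ D(S)}`. -/
def product (S T : E →ₗ.[ℂ] E) : E →ₗ.[ℂ] E where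
  domain := (S.domain.comap T.toFun).map T.domain.subtype
  toFun :=
    { toFun := fun u =>
        S ⟨T ⟨u, by obtain ⟨w, -, hw⟩ := u.2; exact hw ▸ w.2⟩, by
          obtain ⟨_, w, hw, rfl⟩ := u; exact hw⟩
      map_add' := by
        intro u v
        rw [← LinearPMap.map_add]
        congr 1
        apply Subtype.ext
        simp only [Submodule.coe_add, ← LinearPMap.map_add]
        rfl
      map_smul' := by
        intro c u
        rw [RingHom.id_apply, ← LinearPMap.map_smul]
        congr 1
        apply Subtype.ext
        simp only [Submodule.coe_smul, ← LinearPMap.map_smul]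
        rfl }

/-- `w t ∈ D(A)` for almost every `t ∈ ℝ`, and `‖A (w t)‖_{L²_t E} ≤ M`. -/
def TimeL2Bound (A : E →ₗ.[ℂ] E) (w : ℝ → E) (M : ℝ≥0∞) : Prop :=
  ∃ G : ℝ → E, MemLp G 2 volume ∧ (∀ᵐ t, (w t, G t) ∈ A.graph) ∧ eLpNorm G 2 volume ≤ M

/-- `A` is `H`-smooth in the sense of Kato: `‖A e^{-itH} u‖_{L²_t E} ≤ C ‖u‖` for all `u ∈ E`. -/
def IsKatoSmooth (A H : E →ₗ.[ℂ] E) : Prop :=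
  ∃ C : ℝ≥0, ∀ u : E, TimeL2Bound A (fun t => propagator H t u) (C * ‖u‖ₑ)

end Operators

section Estimate

variable {X : Type*} [MeasurableSpace X]

/-- The mixed norm `‖F‖_{L^p_t L^q_x}` of a function on `ℝ × X`. -/
def mixedNorm (p q : ℝ≥0∞) (μ : Measure X) (F : ℝ → X → ℂ) : ℝ≥0∞ :=
  eLpNorm (fun t : ℝ => eLpNorm (F t) q μ) p volume

/-- The orthonormal Strichartz estimate
`‖∑ₙ νₙ |e^{-itH} fₙ|²‖_{L^p_t L^q_x} ≤ C ‖ν‖_{ℓ^α}` for all finite or countably infinite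
systems `f` in `D(T)` that are orthonormal for the inner product `⟨T f, T g⟩`, and all
`ν ∈ ℓ^α`; the series converges (absolutely) almost everywhere. -/
def OrthonormalStrichartz (μ : Measure X) (H T : Lp ℂ 2 μ →ₗ.[ℂ] Lp ℂ 2 μ)
    (p q α : ℝ≥0∞) : Prop :=
  ∃ C : ℝ≥0, ∀ (ι : Type) [Countable ι] (f : ι → T.domain),
    Orthonormal ℂ (fun n => T (f n)) → ∀ ν : lp (fun _ : ι => ℂ) α,
      (∀ᵐ t : ℝ, ∀ᵐ x ∂μ, Summable fun n =>
        ν n * ((‖(propagator H t (f n) : Lp ℂ 2 μ) x‖ ^ 2 : ℝ) : ℂ)) ∧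
      mixedNorm p q μ (fun t x => ∑' n,
        ν n * ((‖(propagator H t (f n) : Lp ℂ 2 μ) x‖ ^ 2 : ℝ) : ℂ))
        ≤ C * ENNReal.ofReal ‖ν‖

end Estimate

end OrthStrichartz

end

/-! For f in D(H₀^θ) put h = H₀^θ f and d(t) = e^{itH₀}e^{-itH}f. Duhamel's formula,
`sub_mem_graph_power`, says that d(b) - d(a) lies in D(H₀^θ) and that H₀^θ maps it to -i𝒯*(1_{(a,b]}
S h). Here 𝒯u(t) is the closure of Y H₀^θ applied to e^{-itH₀}u, and S h(t) = Z e^{-itH}H₀^{-θ}h;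
the two smoothness hypotheses say that 𝒯 and S are bounded into L²(ℝ; 𝓗). Hence, for t ≥ 0,
e^{-itH}f = e^{-itH₀}H₀^{-θ}(h - i𝒯*(1_{(0,t]} S h)), and similarly for t < 0.

By duality the free estimate bounds the Schatten norm of exponent 2α' of √W e^{-itH₀}H₀^{-θ}, where
W is a weight testing the mixed norm. Such a bound survives composition with bounded operators, so
it handles the term h, and it would handle the integral term if the cutoff did not depend on t. The
cutoff s ≤ t is a triangular truncation in time, and the proof is a Christ-Kiselev argument in
Schatten classes: triangular truncation is bounded there because 2 < 2α' < ∞.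

For exponents 2^(k+1) the truncation bound is an algebraic fact on finite matrices: a truncation can
be placed in a nilpotent block matrix, whose Schatten norm is controlled by that of its Hermitian
part (`schattenNorm_le_of_trace_pow_eq_zero`). Marcinkiewicz interpolation with the Hilbert-Schmidt
case gives every exponent 2s with s > 1 (`exists_sum_rpow_triangularPart_le`), and
`exists_timeOrdered_bound` restates the result for time-ordered sums of vectors.

To reach finite matrices, the mixed norm is approximated by integrals against one dual weight in
time and finitely many in space, for finitely many functions on a bounded interval
(`exists_finite_lt_lintegral`). A Riemann sum then freezes d(t) and the choice of spatial weight on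
each interval of a partition (`lintegral_le_of_riemannSum_le`), while the free evolution keeps its
continuous time variable.

The remaining work is operator theory: Stone's theorem and the resolvent show that `propagator` and
`resolventOne` do not take their default values, and H₀^θ is handled through bounded functions of (1
+ H₀)⁻¹. -/

namespace OrthStrichartz

open Matrix Finset
open scoped ComplexOrder

noncomputable section

/-! ### Schatten norms of dyadic exponent and nilpotent matrices -/

section Schatten

variable {n : Type*} [Fintype n]

/-- The Schatten norm of exponent `2 ^ (k + 1)` of a complex matrix. -/
def schattenNorm : ℕ → Matrix n n ℂ → ℝ
  | 0, X => √(trace (Xᴴ * X)).re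
  | k + 1, X => √(schattenNorm k (Xᴴ * X))

theorem schattenNorm_nonneg (k : ℕ) (X : Matrix n n ℂ) : 0 ≤ schattenNorm k X := by
  cases k <;> exact Real.sqrt_nonneg _

theorem trace_conjTranspose_mul_self_re (X : Matrix n n ℂ) :
    (trace (Xᴴ * X)).re = ∑ i, ∑ j, ‖X j i‖ ^ 2 := by
  simp only [trace, diag_apply, mul_apply, conjTranspose_apply, Complex.re_sum]
  refine sum_congr rfl fun i _ => sum_congr rfl fun j _ => ?_
  rw [RCLike.star_def, ← Complex.normSq_eq_conj_mul_self, Complex.ofReal_re,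
    Complex.normSq_eq_norm_sq]

theorem schattenNorm_neg (k : ℕ) (X : Matrix n n ℂ) :
    schattenNorm k (-X) = schattenNorm k X := by
  cases k <;> simp [schattenNorm]

theorem norm_trace_mul_le (X Y : Matrix n n ℂ) :
    ‖trace (X * Y)‖ ≤ schattenNorm 0 X * schattenNorm 0 Y := by
  have h1 : ‖trace (X * Y)‖ ≤ ∑ i, ∑ j, ‖X i j‖ * ‖Y j i‖ := by
    rw [trace]
    refine (norm_sum_le _ _).trans (sum_le_sum fun i _ => ?_)
    rw [diag_apply, mul_apply]
    refine (norm_sum_le _ _).trans (sum_le_sum fun j _ => ?_)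
    rw [norm_mul]
  refine h1.trans ?_
  simp only [schattenNorm, trace_conjTranspose_mul_self_re]
  rw [sum_comm (f := fun i j => ‖X j i‖ ^ 2)]
  rw [← sum_product', ← sum_product', ← sum_product']
  exact Real.sum_mul_le_sqrt_mul_sqrt _ _ _

variable [DecidableEq n]

/-- Unrolls the recursion: each step passes from X to the self-adjoint XᴴX, whose own Gram matrix is
its square, so the powers of two accumulate. -/
theorem schattenNorm_pow (k : ℕ) (X : Matrix n n ℂ) :
    schattenNorm k X ^ 2 ^ (k + 1) = (trace ((Xᴴ * X) ^ 2 ^ k)).re := by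
  induction k generalizing X with
  | zero =>
    simp only [schattenNorm, zero_add, pow_one, pow_zero]
    rw [Real.sq_sqrt]
    rw [trace_conjTranspose_mul_self_re]
    positivity
  | succ k ih =>
    rw [schattenNorm, pow_succ 2 (k + 1), mul_comm, pow_mul,
      Real.sq_sqrt (schattenNorm_nonneg _ _), ih]
    rw [conjTranspose_mul, conjTranspose_conjTranspose, ← pow_two, ← pow_mul, pow_succ 2 k,
      mul_comm 2]

theorem trace_mul_pow_comm {n' : Type*} [Fintype n'] [DecidableEq n'] (X : Matrix n n' ℂ)
    (Y : Matrix n' n ℂ) (m : ℕ) (hm : m ≠ 0) : trace ((X * Y) ^ m) = trace ((Y * X) ^ m) := by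
  have h : ∀ m : ℕ, (X * Y) ^ m * X = X * (Y * X) ^ m := fun m => by
    induction m with
    | zero => simp
    | succ m ih =>
      rw [pow_succ, pow_succ, ← Matrix.mul_assoc X, ← ih]
      simp only [Matrix.mul_assoc]
  obtain ⟨m, rfl⟩ := Nat.exists_eq_succ_of_ne_zero hm
  rw [pow_succ, ← Matrix.mul_assoc, h, trace_mul_comm, ← Matrix.mul_assoc, ← pow_succ']

theorem schattenNorm_conjTranspose (k : ℕ) (X : Matrix n n ℂ) :
    schattenNorm k Xᴴ = schattenNorm k X := by
  refine (pow_left_inj₀ (schattenNorm_nonneg _ _) (schattenNorm_nonneg _ _)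
    (pow_ne_zero (k + 1) two_ne_zero)).1 ?_
  rw [schattenNorm_pow, schattenNorm_pow, conjTranspose_conjTranspose,
    trace_mul_pow_comm _ _ _ (by positivity)]

theorem exists_pairs {M : Type*} [Monoid M] (m : ℕ) (l : List M) (h : l.length = 2 * m) :
    ∃ l' : List (M × M), l'.length = m ∧ l = l'.flatMap fun p => [p.1, p.2] := by
  induction m generalizing l with
  | zero => exact ⟨[], rfl, by simpa using h⟩
  | succ m ih =>
    match l, h with
    | a :: b :: l, h =>
      obtain ⟨l', h1, rfl⟩ := ih l (by simp at h; omega)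
      exact ⟨(a, b) :: l', by simp [h1], by simp⟩
    | [a], h => simp at h; omega
    | [], h => simp at h

/-- Hölder's inequality by induction on the dyadic exponent. The trace bound at level k, applied to
the alternating word in XᴴX and YYᴴ, gives the product bound from level k + 1 to level k; pairing
neighbouring letters and using that product bound gives the trace bound at level k + 1. The base
case is Cauchy-Schwarz. -/
theorem norm_trace_list_prod_le (k : ℕ) :
    (∀ l : List (Matrix n n ℂ), l.length = 2 ^ (k + 1) →
      ‖trace l.prod‖ ≤ (l.map (schattenNorm k)).prod) ∧
    ∀ X Y : Matrix n n ℂ,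
      schattenNorm k (X * Y) ≤ schattenNorm (k + 1) X * schattenNorm (k + 1) Y := by
  have key : ∀ k : ℕ, (∀ l : List (Matrix n n ℂ), l.length = 2 ^ (k + 1) →
      ‖trace l.prod‖ ≤ (l.map (schattenNorm k)).prod) →
      ∀ X Y : Matrix n n ℂ,
        schattenNorm k (X * Y) ≤ schattenNorm (k + 1) X * schattenNorm (k + 1) Y := by
    intro k hk X Y
    refine (pow_le_pow_iff_left₀ (schattenNorm_nonneg _ _) (mul_nonneg (schattenNorm_nonneg _ _)
      (schattenNorm_nonneg _ _)) (pow_ne_zero (k + 1) two_ne_zero)).1 ?_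
    have h1 : trace (((X * Y)ᴴ * (X * Y)) ^ 2 ^ k) =
        trace ((List.replicate (2 ^ k) [Xᴴ * X, Y * Yᴴ]).flatten).prod := by
      rw [conjTranspose_mul, mul_assoc, trace_mul_pow_comm _ _ _ (by positivity), List.prod_flatten,
        List.map_replicate, List.prod_replicate]
      simp [mul_assoc]
    rw [schattenNorm_pow, h1]
    refine (Complex.re_le_norm _).trans ((hk _ ?_).trans (le_of_eq ?_))
    · simp [pow_succ]
    · have hX : schattenNorm (k + 1) X ^ 2 = schattenNorm k (Xᴴ * X) :=
        Real.sq_sqrt (schattenNorm_nonneg _ _)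
      have hY : schattenNorm (k + 1) Y ^ 2 = schattenNorm k (Y * Yᴴ) := by
        rw [← schattenNorm_conjTranspose (k + 1) Y, schattenNorm,
          Real.sq_sqrt (schattenNorm_nonneg _ _), conjTranspose_conjTranspose]
      rw [List.map_flatten, List.prod_flatten, List.map_replicate, List.map_replicate,
        List.prod_replicate, pow_succ 2 k, mul_comm (2 ^ k) 2, pow_mul, mul_pow, hX, hY]
      simp
  have main : ∀ k : ℕ, ∀ l : List (Matrix n n ℂ), l.length = 2 ^ (k + 1) →
      ‖trace l.prod‖ ≤ (l.map (schattenNorm k)).prod := by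
    intro k
    induction k with
    | zero =>
      intro l hl
      match l, hl with
      | [a, b], _ => simpa using norm_trace_mul_le a b
    | succ k ih =>
      intro l hl
      obtain ⟨l', h1, rfl⟩ := exists_pairs (2 ^ (k + 1)) l (by rw [hl, pow_succ, mul_comm])
      have h2 : (l'.flatMap fun p => [p.1, p.2]).prod = (l'.map fun p => p.1 * p.2).prod := by
        rw [List.flatMap, List.prod_flatten, List.map_map]
        congr 2
        funext p
        simp
      rw [h2]
      refine (ih _ (by simpa using h1)).trans ?_
      rw [List.map_flatMap, List.flatMap, List.prod_flatten, List.map_map, List.map_map]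
      refine List.prod_map_le_prod_map₀ _ _ (fun p _ => schattenNorm_nonneg _ _) fun p _ => ?_
      simpa using key k ih p.1 p.2
  exact ⟨main k, key k (main k)⟩

theorem pow_sub_pow_eq_sum {R : Type*} [Ring R] (a b : R) (m : ℕ) :
    a ^ m - b ^ m = ∑ i ∈ range m, a ^ i * (a - b) * b ^ (m - 1 - i) := by
  induction m with
  | zero => simp
  | succ m ih =>
    rw [sum_range_succ]
    have h : ∑ i ∈ range m, a ^ i * (a - b) * b ^ (m + 1 - 1 - i) = (a ^ m - b ^ m) * b := by
      rw [ih, sum_mul]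
      refine sum_congr rfl fun i hi => ?_
      rw [mem_range] at hi
      rw [mul_assoc _ _ b, ← pow_succ]
      congr 2
      omega
    rw [h]
    simp only [add_tsub_cancel_right, tsub_self, pow_zero, mul_one, pow_succ]
    noncomm_ring

/-- With A = V + Vᴴ one has VᴴV = AV - V². Put m = 2^k. Telescoping (VᴴV)^m - (-V²)^m gives m words
of length 2m, each with one letter A and all others equal to V, -V or Vᴴ, and the subtracted power
has trace zero. Hölder yields ‖V‖^{2m} ≤ m ‖A‖ ‖V‖^{2m-1}. -/
theorem schattenNorm_le_of_trace_pow_eq_zero (k : ℕ) (V : Matrix n n ℂ)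
    (hV : trace (V ^ 2 ^ (k + 1)) = 0) :
    schattenNorm k V ≤ 2 ^ k * schattenNorm k (V + Vᴴ) := by
  set m := 2 ^ k with hm
  set A := V + Vᴴ
  have hm' : 2 ^ (k + 1) = 2 * m := by rw [pow_succ, mul_comm]
  have hm0 : 0 < m := by positivity
  have h1 : trace ((Vᴴ * V) ^ m) =
      ∑ i ∈ range m, trace ((Vᴴ * V) ^ i * (A * V) * (-(V * V)) ^ (m - 1 - i)) := by
    rw [← trace_sum]
    have h2 : Vᴴ * V - -(V * V) = A * V := by simp only [A]; noncomm_ring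
    rw [← h2, ← pow_sub_pow_eq_sum, trace_sub, neg_pow, ← pow_two, ← pow_mul, ← hm']
    have h3 : ((-1 : Matrix n n ℂ) ^ m) * V ^ 2 ^ (k + 1) =
        ((-1 : ℂ) ^ m) • V ^ 2 ^ (k + 1) := by
      rcases neg_one_pow_eq_or (Matrix n n ℂ) m with h | h <;>
      rcases Nat.even_or_odd m with h' | h' <;> simp [h'.neg_one_pow]
    rw [h3, trace_smul, hV, smul_zero, sub_zero]
  have h4 : ∀ i ∈ range m, ‖trace ((Vᴴ * V) ^ i * (A * V) * (-(V * V)) ^ (m - 1 - i))‖ ≤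
      schattenNorm k A * schattenNorm k V ^ (2 * m - 1) := by
    intro i hi
    rw [mem_range] at hi
    have h5 : (Vᴴ * V) ^ i * (A * V) * (-(V * V)) ^ (m - 1 - i) =
        ((List.replicate i [Vᴴ, V]).flatten ++ ([A, V] ++
          (List.replicate (m - 1 - i) [-V, V]).flatten)).prod := by
      simp [List.prod_flatten, mul_assoc]
    rw [h5]
    refine ((norm_trace_list_prod_le k).1 _ ?_).trans (le_of_eq ?_)
    · simp [pow_succ]; omega
    · simp only [List.map_append, List.prod_append, List.map_flatten, List.prod_flatten,
        List.map_replicate, List.prod_replicate, List.map_cons, List.map_nil, List.prod_cons,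
        List.prod_nil, mul_one, schattenNorm_conjTranspose, schattenNorm_neg]
      rw [← pow_two, ← pow_mul, ← pow_mul]
      have : 2 * m - 1 = 2 * i + (1 + 2 * (m - 1 - i)) := by omega
      rw [this, pow_add, pow_add]
      ring
  have h6 : schattenNorm k V ^ (2 * m) ≤
      m * (schattenNorm k A * schattenNorm k V ^ (2 * m - 1)) := by
    have h0 := schattenNorm_pow k V
    rw [hm'] at h0
    rw [h0, h1, Complex.re_sum]
    calc _ ≤ ∑ i ∈ range m, schattenNorm k A * schattenNorm k V ^ (2 * m - 1) :=
          sum_le_sum fun i hi => (Complex.re_le_norm _).trans (h4 i hi)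
      _ = _ := by rw [sum_const, card_range, nsmul_eq_mul]
  rcases (schattenNorm_nonneg k V).eq_or_lt with h0 | h0
  · rw [← h0]
    exact mul_nonneg (by positivity) (schattenNorm_nonneg _ _)
  · have h7 : schattenNorm k V ^ (2 * m) = schattenNorm k V ^ (2 * m - 1) * schattenNorm k V := by
      rw [← pow_succ]; congr 1; omega
    rw [h7] at h6
    have h8 : 0 < schattenNorm k V ^ (2 * m - 1) := by positivity
    have h9 : schattenNorm k V ≤ m * schattenNorm k A := by
      refine le_of_mul_le_mul_left ?_ h8
      linarith
    simpa [hm] using h9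

/-- A strictly lower triangular matrix has no diagonal in any of its powers. -/
theorem trace_pow_eq_zero_of_strictLower (lev : n → ℕ) (V : Matrix n n ℂ)
    (hV : ∀ i j, lev i ≤ lev j → V i j = 0) (m : ℕ) (hm : m ≠ 0) : trace (V ^ m) = 0 := by
  have h : ∀ m : ℕ, ∀ i j, lev i ≤ lev j → (V ^ (m + 1)) i j = 0 := by
    intro m
    induction m with
    | zero => simpa using hV
    | succ m ih =>
      intro i j hij
      rw [pow_succ, mul_apply]
      refine sum_eq_zero fun x _ => ?_
      rcases le_total (lev i) (lev x) with hx | hx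
      · rw [ih i x hx, zero_mul]
      · rw [hV x j (hx.trans hij), mul_zero]
  obtain ⟨m, rfl⟩ := Nat.exists_eq_succ_of_ne_zero hm
  exact sum_eq_zero fun i _ => h m i i le_rfl

end Schatten

/-! ### Triangular truncation for dyadic exponents -/

section Truncation

variable {κ ι : Type*}

/-- The strictly lower triangular part of a matrix whose rows and columns carry levels. -/
def triangularPart (b : κ → ℕ) (c : ι → ℕ) (K : Matrix κ ι ℂ) : Matrix κ ι ℂ :=
  Matrix.of fun x i => if c i < b x then K x i else 0

theorem triangularPart_add (b : κ → ℕ) (c : ι → ℕ) (K L : Matrix κ ι ℂ) :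
    triangularPart b c (K + L) = triangularPart b c K + triangularPart b c L := by
  ext x i
  simp only [triangularPart, of_apply, Matrix.add_apply]
  split_ifs <;> simp

variable [Fintype κ] [Fintype ι]

theorem trace_fromBlocks_diag (P : Matrix κ κ ℂ) (Q : Matrix ι ι ℂ) :
    trace (fromBlocks P 0 0 Q) = trace P + trace Q := by
  simp [trace]

variable [DecidableEq ι]

theorem trace_gram_pow_nonneg (K : Matrix κ ι ℂ) (m : ℕ) :
    0 ≤ (trace ((Kᴴ * K) ^ m)).re :=
  (Complex.nonneg_iff.1 ((posSemidef_conjTranspose_mul_self K).pow m).trace_nonneg).1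

variable [DecidableEq κ]

/-- Apply the nilpotent bound to the off-diagonal block matrix V with blocks L and (K - L)ᴴ. Its
Hermitian part V + Vᴴ has blocks K and Kᴴ, so no trace of the truncation remains there. The factor 2
comes from the two equal diagonal blocks of the Gram matrix of V + Vᴴ. -/
theorem trace_triangularPart_pow_le (b : κ → ℕ) (c : ι → ℕ) (K : Matrix κ ι ℂ) (k : ℕ) :
    (trace (((triangularPart b c K)ᴴ * triangularPart b c K) ^ 2 ^ k)).re ≤
      2 * (2 ^ k : ℝ) ^ 2 ^ (k + 1) * (trace ((Kᴴ * K) ^ 2 ^ k)).re := by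
  set L := triangularPart b c K with hL
  set V : Matrix (κ ⊕ ι) (κ ⊕ ι) ℂ := fromBlocks 0 L (K - L)ᴴ 0 with hV
  have hpow : ∀ (P : Matrix κ κ ℂ) (Q : Matrix ι ι ℂ) (m : ℕ),
      (fromBlocks P 0 0 Q) ^ m = fromBlocks (P ^ m) 0 0 (Q ^ m) := by
    intro P Q m
    induction m with
    | zero => simp
    | succ m ih => rw [pow_succ, ih, fromBlocks_multiply]; simp [pow_succ]
  have hA : V + Vᴴ = fromBlocks 0 K Kᴴ 0 := by
    rw [hV, fromBlocks_conjTranspose, fromBlocks_add]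
    simp
  have htr : trace (V ^ 2 ^ (k + 1)) = 0 := by
    -- The doubled levels, odd for columns, turn both c < b and its negation b ≤ c into strict
    -- inequalities, so both blocks of V strictly lower the level.
    refine trace_pow_eq_zero_of_strictLower (Sum.elim (fun x => 2 * b x) fun i => 2 * c i + 1) V
      ?_ _ (by positivity)
    rintro (x | i) (y | j) h
    · rfl
    · simp only [Sum.elim_inl, Sum.elim_inr] at h
      simp only [hV, hL, fromBlocks_apply₁₂, triangularPart, of_apply]
      rw [if_neg (by omega)]
    · simp only [Sum.elim_inl, Sum.elim_inr] at h
      simp only [hV, hL, fromBlocks_apply₂₁, triangularPart, conjTranspose_apply, Matrix.sub_apply,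
        of_apply]
      rw [if_pos (by omega), sub_self, star_zero]
    · rfl
  have h1 := pow_le_pow_left₀ (schattenNorm_nonneg k V)
    (schattenNorm_le_of_trace_pow_eq_zero k V htr) (2 ^ (k + 1))
  rw [mul_pow, schattenNorm_pow, schattenNorm_pow, hA] at h1
  have h2 : Vᴴ * V = fromBlocks ((K - L) * (K - L)ᴴ) 0 0 (Lᴴ * L) := by
    rw [hV, fromBlocks_conjTranspose, fromBlocks_multiply]
    simp
  have h3 : (fromBlocks 0 K Kᴴ 0)ᴴ * fromBlocks 0 K Kᴴ 0 =
      fromBlocks (K * Kᴴ) 0 0 (Kᴴ * K) := by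
    rw [fromBlocks_conjTranspose, fromBlocks_multiply]
    simp
  rw [h2, h3, hpow, hpow, trace_fromBlocks_diag, trace_fromBlocks_diag] at h1
  have h4 : trace ((K * Kᴴ) ^ 2 ^ k) = trace ((Kᴴ * K) ^ 2 ^ k) :=
    trace_mul_pow_comm K Kᴴ _ (by positivity)
  have h5 : 0 ≤ (trace (((K - L) * (K - L)ᴴ) ^ 2 ^ k)).re := by
    simpa using trace_gram_pow_nonneg (K - L)ᴴ (2 ^ k)
  rw [h4, Complex.add_re, Complex.add_re] at h1
  linarith

end Truncation

end

end OrthStrichartz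

namespace OrthStrichartz

open Matrix Finset
open scoped ComplexOrder

noncomputable section

/-! ### Jensen's inequality and real interpolation for finite sums -/

section Marcinkiewicz

/-- Jensen for a doubly substochastic matrix: the row in each j gives convexity of the power, and
the sum over j is then absorbed by the other marginal. -/
theorem sum_rpow_sum_mul_le {n ι : Type*} [Fintype n] [Fintype ι] {s : ℝ} (hs : 1 ≤ s)
    (w : n → ι → ℝ) (hw : ∀ j i, 0 ≤ w j i) (hcol : ∀ j, ∑ i, w j i ≤ 1)
    (hrow : ∀ i, ∑ j, w j i ≤ 1) (l : ι → ℝ) (hl : ∀ i, 0 ≤ l i) :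
    ∑ j, (∑ i, w j i * l i) ^ s ≤ ∑ i, l i ^ s := by
  have h1 : ∀ j, (∑ i, w j i * l i) ^ s ≤ ∑ i, w j i * l i ^ s := by
    intro j
    have hs0 : 0 < s := by linarith
    have h0 : 0 ≤ ∑ i, w j i * l i ^ s :=
      sum_nonneg fun i _ => mul_nonneg (hw j i) (Real.rpow_nonneg (hl i) _)
    have h := Real.inner_le_weight_mul_Lp_of_nonneg univ hs (w j) l (hw j) hl
    have h2 : (∑ i, w j i) ^ (1 - s⁻¹) ≤ 1 :=
      Real.rpow_le_one (sum_nonneg fun i _ => hw j i) (hcol j)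
        (sub_nonneg.2 (inv_le_one_of_one_le₀ hs))
    have h3 : ∑ i, w j i * l i ≤ (∑ i, w j i * l i ^ s) ^ s⁻¹ :=
      h.trans (mul_le_of_le_one_left (Real.rpow_nonneg h0 _) h2)
    refine (Real.rpow_le_rpow (sum_nonneg fun i _ => mul_nonneg (hw j i) (hl i)) h3
      hs0.le).trans (le_of_eq ?_)
    rw [← Real.rpow_mul h0, inv_mul_cancel₀ hs0.ne', Real.rpow_one]
  calc _ ≤ ∑ j, ∑ i, w j i * l i ^ s := sum_le_sum fun j _ => h1 j
    _ = ∑ i, (∑ j, w j i) * l i ^ s := by rw [sum_comm]; simp_rw [sum_mul]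
    _ ≤ _ := sum_le_sum fun i _ =>
        mul_le_of_le_one_left (Real.rpow_nonneg (hl i) _) (hrow i)

theorem integral_indicator_Ioc_rpow {a x : ℝ} (ha : -1 < a) (hx : 0 ≤ x) :
    Integrable ((Set.Ioc 0 x).indicator fun t : ℝ => t ^ a) ∧
      ∫ t, (Set.Ioc 0 x).indicator (fun t : ℝ => t ^ a) t = x ^ (a + 1) / (a + 1) := by
  constructor
  · rw [integrable_indicator_iff measurableSet_Ioc]
    exact (intervalIntegrable_iff_integrableOn_Ioc_of_le hx).1
      (intervalIntegral.intervalIntegrable_rpow' ha)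
  · rw [integral_indicator measurableSet_Ioc, ← intervalIntegral.integral_of_le hx,
      integral_rpow (Or.inl ha), Real.zero_rpow (by linarith), sub_zero]

theorem integral_indicator_Ioi_rpow {a x : ℝ} (ha : a < -1) (hx : 0 < x) :
    Integrable ((Set.Ioi x).indicator fun t : ℝ => t ^ a) ∧
      ∫ t, (Set.Ioi x).indicator (fun t : ℝ => t ^ a) t = -x ^ (a + 1) / (a + 1) := by
  constructor
  · rw [integrable_indicator_iff measurableSet_Ioi]
    exact integrableOn_Ioi_rpow_of_lt ha hx
  · rw [integral_indicator measurableSet_Ioi, integral_Ioi_rpow_of_lt ha hx]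

/-- Marcinkiewicz interpolation between the exponents `1` and `m` for finite sequences. -/
theorem sum_rpow_le_of_splitting {n ι : Type*} [Fintype n] [Fintype ι] {s : ℝ} {m : ℕ}
    (hs : 1 < s) (hm : s < m) {A : ℝ} (x : n → ℝ) (hx : ∀ j, 0 ≤ x j)
    (l : ι → ℝ) (hl : ∀ i, 0 ≤ l i)
    (h : ∀ t : ℝ, 0 < t → ∃ y z : n → ℝ, (∀ j, 0 ≤ y j) ∧ (∀ j, 0 ≤ z j) ∧
      (∀ j, x j ≤ 2 * (y j + z j)) ∧ ∑ j, y j ≤ 2 * ∑ i, (if t ≤ l i then l i else 0) ∧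
      ∑ j, z j ^ m ≤ A * ∑ i, (if t ≤ l i then 0 else l i ^ m)) :
    ∑ j, x j ^ s ≤ s * (8 / (s - 1) + A * 4 ^ m / (m - s)) * ∑ i, l i ^ s := by
  have hs0 : 0 < s := by linarith
  have hm0 : m ≠ 0 := by rintro rfl; norm_num at hm; linarith
  set f : n → ℝ → ℝ := fun j => (Set.Ioc 0 (x j)).indicator fun t : ℝ => t ^ (s - 1)
  set g : ι → ℝ → ℝ := fun i => (Set.Ioc 0 (l i)).indicator fun t : ℝ => t ^ (s - 2)
  -- The case l i = 0 is set to zero because t^(s-1-m) is not integrable at the origin; that index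
  -- contributes nothing anyway.
  set k : ι → ℝ → ℝ := fun i => if l i = 0 then 0 else
    (Set.Ioi (l i)).indicator fun t : ℝ => t ^ (s - 1 - m)
  have hf : ∀ j, Integrable (f j) ∧ ∫ t, f j t = x j ^ s / s := fun j => by
    simpa using integral_indicator_Ioc_rpow (a := s - 1) (by linarith) (hx j)
  have hg : ∀ i, Integrable (g i) ∧ ∫ t, g i t = l i ^ (s - 1) / (s - 1) := fun i => by
    have := integral_indicator_Ioc_rpow (a := s - 2) (by linarith) (hl i)
    rwa [show s - 2 + 1 = s - 1 by ring] at this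
  have hk : ∀ i, Integrable (k i) ∧ l i ^ m * ∫ t, k i t = l i ^ s / (m - s) := fun i => by
    rcases (hl i).eq_or_lt with h0 | h0
    · simp only [k, ← h0, if_true]
      exact ⟨integrable_zero _ _ _, by simp [Real.zero_rpow hs0.ne']⟩
    · simp only [k, if_neg h0.ne']
      obtain ⟨h1, h2⟩ := integral_indicator_Ioi_rpow (a := s - 1 - m) (by linarith) h0
      refine ⟨h1, ?_⟩
      rw [h2, show s - 1 - m + 1 = -(m - s) by ring, neg_div_neg_eq, ← mul_div_assoc,
        ← Real.rpow_natCast, ← Real.rpow_add h0]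
      congr 2
      ring
  -- Layer-cake argument: the integrals of f, g and k over t are the s-th powers up to constants, so
  -- a pointwise bound in t suffices.
  have key : ∀ t : ℝ, ∑ j, f j t ≤ ∑ i, 8 * l i * g i t + ∑ i, A * 4 ^ m * l i ^ m * k i t := by
    intro t
    rcases le_or_gt t 0 with ht | ht
    · have h1 : ∀ j, f j t = 0 := fun j => Set.indicator_of_notMem (by simp [ht]) _
      have h2 : ∀ i, g i t = 0 := fun i => Set.indicator_of_notMem (by simp [ht]) _
      have h3 : ∀ i, k i t = 0 := fun i => by
        simp only [k]
        split_ifs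
        · rfl
        · exact Set.indicator_of_notMem (by simpa using ht.trans (hl i)) _
      simp [h1, h2, h3]
    · obtain ⟨y, z, hy, hz, hxyz, hY, hZ⟩ := h t ht
      -- If t ≤ x j ≤ 2(y j + z j), then y j or z j is at least t/4; this Chebyshev step is the
      -- origin of the factors 4 and 4^m.
      have e1 : ∀ j, f j t ≤ t ^ (s - 1) * (4 / t * y j + (4 / t) ^ m * z j ^ m) := by
        intro j
        have h0 : 0 ≤ 4 / t * y j + (4 / t) ^ m * z j ^ m := by
          have := hy j; have := hz j; positivity
        by_cases hj : t ≤ x j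
        · simp only [f]
          rw [Set.indicator_of_mem (Set.mem_Ioc.2 ⟨ht, hj⟩)]
          refine le_mul_of_one_le_right (by positivity) ?_
          have h5 : 1 ≤ 4 / t * y j ∨ 1 ≤ 4 / t * z j := by
            by_contra! hcon
            obtain ⟨ha, hb⟩ := hcon
            rw [div_mul_eq_mul_div, div_lt_one ht] at ha hb
            linarith [hxyz j]
          have h6 : 0 ≤ 4 / t * y j := by have := hy j; positivity
          have h7 : 0 ≤ 4 / t * z j := by have := hz j; positivity
          rw [← mul_pow]
          rcases h5 with h5 | h5
          · have : 0 ≤ (4 / t * z j) ^ m := by positivity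
            linarith
          · have : 1 ≤ (4 / t * z j) ^ m := one_le_pow₀ h5
            linarith
        · simp only [f]
          rw [Set.indicator_of_notMem (by simp [hj])]
          positivity
      have e2 : t ^ (s - 1) * (4 / t) = 4 * t ^ (s - 2) := by
        rw [show s - 1 = s - 2 + 1 by ring, Real.rpow_add_one ht.ne']
        field_simp
      have e3 : t ^ (s - 1) * (4 / t) ^ m = 4 ^ m * t ^ (s - 1 - m) := by
        rw [Real.rpow_sub_natCast ht.ne', div_pow]
        field_simp
      calc ∑ j, f j t ≤ ∑ j, t ^ (s - 1) * (4 / t * y j + (4 / t) ^ m * z j ^ m) :=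
            sum_le_sum fun j _ => e1 j
        _ = t ^ (s - 1) * (4 / t) * ∑ j, y j + t ^ (s - 1) * (4 / t) ^ m * ∑ j, z j ^ m := by
            rw [← mul_sum, sum_add_distrib, ← mul_sum, ← mul_sum]; ring
        _ ≤ t ^ (s - 1) * (4 / t) * (2 * ∑ i, (if t ≤ l i then l i else 0)) +
              t ^ (s - 1) * (4 / t) ^ m * (A * ∑ i, (if t ≤ l i then 0 else l i ^ m)) := by
            gcongr
        _ = _ := by
            rw [e2, e3, mul_sum, mul_sum, mul_sum, mul_sum]
            congr 1
            · refine sum_congr rfl fun i _ => ?_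
              simp only [g]
              split_ifs with hi
              · rw [Set.indicator_of_mem (Set.mem_Ioc.2 ⟨ht, hi⟩)]; ring
              · rw [Set.indicator_of_notMem (by simp [hi])]; ring
            · refine sum_congr rfl fun i _ => ?_
              simp only [k]
              split_ifs with hi h0 h0
              · simp
              · rw [Set.indicator_of_notMem (by simpa using hi)]; ring
              · simp [h0, hm0]
              · rw [Set.indicator_of_mem (by simpa using hi)]; ring
  have hint := integral_mono (μ := volume) (integrable_finsetSum univ fun j _ => (hf j).1)
    ((integrable_finsetSum univ fun i _ => (hg i).1.const_mul (8 * l i)).add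
      (integrable_finsetSum univ fun i _ => (hk i).1.const_mul (A * 4 ^ m * l i ^ m)))
    (fun t => by simpa using key t)
  simp only [Pi.add_apply] at hint
  rw [integral_add (integrable_finsetSum univ fun i _ => (hg i).1.const_mul (8 * l i))
    (integrable_finsetSum univ fun i _ => (hk i).1.const_mul (A * 4 ^ m * l i ^ m)),
    integral_finsetSum _ fun j _ => (hf j).1,
    integral_finsetSum _ fun i _ => (hg i).1.const_mul (8 * l i),
    integral_finsetSum _ fun i _ => (hk i).1.const_mul (A * 4 ^ m * l i ^ m)] at hint
  simp only [integral_const_mul, (hf _).2, (hg _).2, mul_assoc, (hk _).2] at hint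
  have e4 : ∀ i, l i * (l i ^ (s - 1) / (s - 1)) = l i ^ s / (s - 1) := fun i => by
    rcases (hl i).eq_or_lt with h0 | h0
    · simp [← h0, Real.zero_rpow hs0.ne']
    · rw [← mul_div_assoc, mul_comm, ← Real.rpow_add_one h0.ne', sub_add_cancel]
  simp only [e4] at hint
  rw [← sum_div, ← mul_sum, ← mul_sum, ← mul_sum, ← sum_div, ← sum_div, div_le_iff₀ hs0] at hint
  refine hint.trans (le_of_eq ?_)
  ring

end Marcinkiewicz

/-! ### Diagonalisation of Gram matrices and Bessel families -/

section Spectral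

variable {κ ι n : Type*} [Fintype κ] [Fintype ι]

theorem sum_norm_sq_eq_re (M : Matrix κ n ℂ) (j : n) :
    ∑ x, ‖M x j‖ ^ 2 = ((Mᴴ * M) j j).re := by
  rw [mul_apply, Complex.re_sum]
  refine sum_congr rfl fun x _ => ?_
  rw [conjTranspose_apply, RCLike.star_def, ← Complex.normSq_eq_conj_mul_self, Complex.ofReal_re,
    Complex.normSq_eq_norm_sq]

theorem sum_norm_sq_eq_of_diagonalization [DecidableEq ι] {K : Matrix κ ι ℂ} {U : Matrix ι ι ℂ} {l : ι → ℝ}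
    (h : Kᴴ * K = U * diagonal (fun i => (l i : ℂ)) * Uᴴ) (W : Matrix ι n ℂ) (j : n) :
    ∑ x, ‖(K * W) x j‖ ^ 2 = ∑ i, ‖(Uᴴ * W) i j‖ ^ 2 * l i := by
  rw [sum_norm_sq_eq_re, conjTranspose_mul, Matrix.mul_assoc, ← Matrix.mul_assoc Kᴴ, h]
  have h1 : Wᴴ * (U * diagonal (fun i => (l i : ℂ)) * Uᴴ * W) =
      (Uᴴ * W)ᴴ * (diagonal (fun i => (l i : ℂ)) * (Uᴴ * W)) := by
    rw [conjTranspose_mul, conjTranspose_conjTranspose]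
    simp only [Matrix.mul_assoc]
  rw [h1, mul_apply, Complex.re_sum]
  refine sum_congr rfl fun x _ => ?_
  rw [diagonal_mul, conjTranspose_apply, RCLike.star_def, mul_left_comm,
    ← Complex.normSq_eq_conj_mul_self, ← Complex.ofReal_mul, Complex.ofReal_re,
    Complex.normSq_eq_norm_sq, mul_comm]

variable [Fintype n]

/-- The columns of `W` form a Bessel sequence with constant `1`. -/
def IsBesselMatrix (W : Matrix ι n ℂ) : Prop :=
  ∀ x : ι → ℂ, ∑ j, ‖∑ i, star (x i) * W i j‖ ^ 2 ≤ ∑ i, ‖x i‖ ^ 2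

theorem IsBesselMatrix.col_le {W : Matrix ι n ℂ} (hW : IsBesselMatrix W) (j : n) :
    ∑ i, ‖W i j‖ ^ 2 ≤ 1 := by
  have h1 : ‖∑ i, star (W i j) * W i j‖ ^ 2 ≤ ∑ i, ‖W i j‖ ^ 2 :=
    (single_le_sum (f := fun j' => ‖∑ i, star (W i j) * W i j'‖ ^ 2)
      (fun _ _ => by positivity) (mem_univ j)).trans (hW fun i => W i j)
  have h2 : ∑ i, star (W i j) * W i j = ((∑ i, ‖W i j‖ ^ 2 : ℝ) : ℂ) := by
    rw [Complex.ofReal_sum]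
    refine sum_congr rfl fun i _ => ?_
    rw [RCLike.star_def, ← Complex.normSq_eq_conj_mul_self, Complex.normSq_eq_norm_sq]
  rw [h2, Complex.norm_real, Real.norm_of_nonneg (by positivity), pow_two] at h1
  by_contra! h3
  nlinarith

variable [DecidableEq ι]

theorem trace_pow_of_diagonalization {G U : Matrix ι ι ℂ} (hU : Uᴴ * U = 1) {l : ι → ℝ}
    (h : G = U * diagonal (fun i => (l i : ℂ)) * Uᴴ) (m : ℕ) (hm : m ≠ 0) :
    (trace (G ^ m)).re = ∑ i, l i ^ m := by
  rw [h, Matrix.mul_assoc, trace_mul_pow_comm _ _ _ hm, Matrix.mul_assoc, hU, Matrix.mul_one,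
    diagonal_pow, trace_diagonal, Complex.re_sum]
  refine sum_congr rfl fun i _ => ?_
  rw [Pi.pow_apply, ← Complex.ofReal_pow, Complex.ofReal_re]

theorem exists_diagonalization (K : Matrix κ ι ℂ) :
    ∃ (U : Matrix ι ι ℂ) (l : ι → ℝ), Uᴴ * U = 1 ∧ U * Uᴴ = 1 ∧ (∀ i, 0 ≤ l i) ∧
      Kᴴ * K = U * diagonal (fun i => (l i : ℂ)) * Uᴴ := by
  have hG := posSemidef_conjTranspose_mul_self K
  refine ⟨hG.isHermitian.eigenvectorUnitary, hG.isHermitian.eigenvalues,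
    Unitary.coe_star_mul_self _, Unitary.coe_mul_star_self _, hG.eigenvalues_nonneg, ?_⟩
  conv_lhs => rw [hG.isHermitian.spectral_theorem]
  rw [Unitary.conjStarAlgAut_apply]
  rfl

theorem IsBesselMatrix.unitary_mul {W : Matrix ι n ℂ} (hW : IsBesselMatrix W)
    {U : Matrix ι ι ℂ} (hU : Uᴴ * U = 1) (hU' : U * Uᴴ = 1) :
    (∀ j, ∑ i, ‖(Uᴴ * W) i j‖ ^ 2 ≤ 1) ∧ ∀ i, ∑ j, ‖(Uᴴ * W) i j‖ ^ 2 ≤ 1 := by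
  constructor
  · intro j
    rw [sum_norm_sq_eq_re, conjTranspose_mul, conjTranspose_conjTranspose, Matrix.mul_assoc,
      ← Matrix.mul_assoc U, hU', Matrix.one_mul, ← sum_norm_sq_eq_re]
    exact hW.col_le j
  · intro i
    refine (hW fun a => U a i).trans (le_of_eq ?_)
    rw [sum_norm_sq_eq_re, hU, one_apply_eq, Complex.one_re]

/-- In an eigenbasis of LᴴL the column norms are averages of the eigenvalues with weights |UᴴW|².
The Bessel property makes these weights doubly substochastic, so Jensen applies. -/
theorem sum_pow_le_trace_pow {W : Matrix ι n ℂ} (hW : IsBesselMatrix W) (L : Matrix κ ι ℂ)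
    (m : ℕ) (hm : m ≠ 0) :
    ∑ j, (∑ x, ‖(L * W) x j‖ ^ 2) ^ m ≤ (trace ((Lᴴ * L) ^ m)).re := by
  obtain ⟨U, l, hU, hU', hl, h⟩ := exists_diagonalization L
  rw [trace_pow_of_diagonalization hU h m hm]
  obtain ⟨h1, h2⟩ := hW.unitary_mul hU hU'
  have := sum_rpow_sum_mul_le (s := m) (by exact_mod_cast Nat.one_le_iff_ne_zero.2 hm)
    (fun j i => ‖(Uᴴ * W) i j‖ ^ 2) (fun _ _ => by positivity) h1 h2 l hl
  simpa only [sum_norm_sq_eq_of_diagonalization h, Real.rpow_natCast] using this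

end Spectral

/-- Triangular truncation is bounded in the Schatten classes of exponent `2 s`, `1 < s`. -/
theorem exists_sum_rpow_triangularPart_le {s : ℝ} (hs : 1 < s) : ∃ C : ℝ, 0 ≤ C ∧
    ∀ (κ ι n : Type) [Fintype κ] [Fintype ι] [Fintype n] [DecidableEq κ] [DecidableEq ι]
      (b : κ → ℕ) (c : ι → ℕ) (K : Matrix κ ι ℂ) (W : Matrix ι n ℂ) (U : Matrix ι ι ℂ)
      (l : ι → ℝ), IsBesselMatrix W → Uᴴ * U = 1 → (∀ i, 0 ≤ l i) →
      Kᴴ * K = U * diagonal (fun i => (l i : ℂ)) * Uᴴ →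
      ∑ j, (∑ x, ‖(triangularPart b c K * W) x j‖ ^ 2) ^ s ≤ C * ∑ i, l i ^ s := by
  -- The upper endpoint of the interpolation is any dyadic exponent beyond s.
  obtain ⟨k, hk⟩ := pow_unbounded_of_one_lt s (one_lt_two (α := ℝ))
  have hk1 : s < ((2 ^ k : ℕ) : ℝ) := by exact_mod_cast hk
  set A : ℝ := 2 * (2 ^ k : ℝ) ^ 2 ^ (k + 1) with hA
  have hA1 : 0 ≤ A := by positivity
  have hm0 : 2 ^ k ≠ 0 := by positivity
  refine ⟨s * (8 / (s - 1) + A * 4 ^ (2 ^ k) / ((2 ^ k : ℕ) - s)), ?_, ?_⟩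
  · have h1 : 0 < s - 1 := by linarith
    have h2 : 0 < ((2 ^ k : ℕ) : ℝ) - s := by linarith
    positivity
  intro κ ι n _ _ _ _ _ b c K W U l hW hU hl hKU
  have hU' : U * Uᴴ = 1 := mul_eq_one_comm.1 hU
  -- the part of `K` on a set of eigenvectors
  let P : (ι → ℝ) → Matrix ι ι ℂ := fun e => U * diagonal (fun i => (e i : ℂ)) * Uᴴ
  have hPH : ∀ e, (P e)ᴴ = P e := fun e => by
    simp only [P, conjTranspose_mul, conjTranspose_conjTranspose, diagonal_conjTranspose,
      Matrix.mul_assoc]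
    congr 3
    funext i
    simp
  have hPmul : ∀ e e', P e * P e' = P fun i => e i * e' i := fun e e' => by
    simp only [P, Complex.ofReal_mul, ← diagonal_mul_diagonal]
    calc _ = U * diagonal (fun i => (e i : ℂ)) * (Uᴴ * U) * diagonal (fun i => (e' i : ℂ)) * Uᴴ := by
          simp only [Matrix.mul_assoc]
      _ = _ := by rw [hU, Matrix.mul_one, ← Matrix.mul_assoc]
  have hG : ∀ e, (K * P e)ᴴ * (K * P e) = P fun i => e i * l i * e i := fun e => by
    rw [conjTranspose_mul, hPH, Matrix.mul_assoc, ← Matrix.mul_assoc Kᴴ, hKU,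
      ← Matrix.mul_assoc]
    change P e * P l * P e = _
    rw [hPmul, hPmul]
  -- The dyadic truncation bound for a spectral piece of K: right multiplication by P e replaces
  -- each eigenvalue l i of KᴴK by e i² l i.
  have hbound : ∀ e k, ∑ j, (∑ x, ‖(triangularPart b c (K * P e) * W) x j‖ ^ 2) ^ 2 ^ k ≤
      2 * (2 ^ k : ℝ) ^ 2 ^ (k + 1) * ∑ i, (e i * l i * e i) ^ 2 ^ k := by
    intro e k
    have h0 : 2 ^ k ≠ 0 := by positivity
    refine (sum_pow_le_trace_pow hW _ _ h0).trans
      ((trace_triangularPart_pow_le b c (K * P e) k).trans (le_of_eq ?_))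
    rw [hG, trace_pow_of_diagonalization hU rfl _ h0]
  refine sum_rpow_le_of_splitting hs hk1 _ (fun j => sum_nonneg fun x _ => by positivity) l hl
    fun t _ => ?_
  let e₁ : ι → ℝ := fun i => if t ≤ l i then 1 else 0
  let e₂ : ι → ℝ := fun i => if t ≤ l i then 0 else 1
  have hsplit : K = K * P e₁ + K * P e₂ := by
    rw [← Matrix.mul_add]
    simp only [P]
    rw [← Matrix.add_mul, ← Matrix.mul_add, diagonal_add]
    have : (diagonal fun i => (e₁ i : ℂ) + (e₂ i : ℂ)) = 1 := by
      rw [← diagonal_one]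
      congr 1
      funext i
      simp only [e₁, e₂]
      split_ifs <;> simp
    rw [this, Matrix.mul_one, hU', Matrix.mul_one]
  refine ⟨fun j => ∑ x, ‖(triangularPart b c (K * P e₁) * W) x j‖ ^ 2,
    fun j => ∑ x, ‖(triangularPart b c (K * P e₂) * W) x j‖ ^ 2,
    fun j => by positivity, fun j => by positivity, fun j => ?_, ?_, ?_⟩
  · rw [hsplit, triangularPart_add, Matrix.add_mul, ← hsplit, ← sum_add_distrib, mul_sum]
    refine sum_le_sum fun x _ => ?_
    rw [Matrix.add_apply]
    refine (pow_le_pow_left₀ (norm_nonneg _) (norm_add_le _ _) 2).trans ?_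
    nlinarith [sq_nonneg (‖(triangularPart b c (K * P e₁) * W) x j‖ -
      ‖(triangularPart b c (K * P e₂) * W) x j‖)]
  -- Level 0 is the Hilbert-Schmidt endpoint, used on the large eigenvalues; there the truncation
  -- constant is exactly 2.
  · have h := hbound e₁ 0
    simp only [pow_zero, pow_one, one_pow, mul_one] at h
    refine h.trans (le_of_eq ?_)
    congr 1
    refine sum_congr rfl fun i _ => ?_
    simp only [e₁]
    split_ifs <;> simp
  · refine (hbound e₂ k).trans (le_of_eq ?_)
    congr 1
    refine sum_congr rfl fun i _ => ?_
    simp only [e₂]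
    split_ifs <;> simp

end

end OrthStrichartz

namespace OrthStrichartz

open Matrix Finset

noncomputable section

/-! ### Duality of finite sequence spaces -/

section Duality

variable {n : Type*} [Fintype n] {a s : ℝ}

/-- The extremal test sequence is w = x^(s-1), whose a-th power is x^s. -/
theorem sum_rpow_le_of_forall_sum_mul_le (has : a.HolderConjugate s) {D : ℝ} (hD : 0 ≤ D)
    (x : n → ℝ) (hx : ∀ j, 0 ≤ x j)
    (h : ∀ w : n → ℝ, (∀ j, 0 ≤ w j) → ∑ j, w j * x j ≤ D * (∑ j, w j ^ a) ^ (1 / a)) :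
    ∑ j, x j ^ s ≤ D ^ s := by
  have hs1 : 1 < s := has.symm.lt
  have ha0 : 0 < a := has.pos
  set S := ∑ j, x j ^ s with hS
  have hS0 : 0 ≤ S := sum_nonneg fun j _ => Real.rpow_nonneg (hx j) _
  have h1 := h (fun j => x j ^ (s - 1)) fun j => Real.rpow_nonneg (hx j) _
  have h2 : ∀ j, x j ^ (s - 1) * x j = x j ^ s := fun j => by
    rcases (hx j).eq_or_lt with h0 | h0
    · simp [← h0, Real.zero_rpow (by linarith : s ≠ 0)]
    · rw [← Real.rpow_add_one h0.ne', sub_add_cancel]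
  have h3 : ∀ j, (x j ^ (s - 1)) ^ a = x j ^ s := fun j => by
    rw [← Real.rpow_mul (hx j)]
    congr 1
    linarith [has.mul_eq_add]
  simp only [h2, h3, ← hS] at h1
  rcases hS0.eq_or_lt with h0 | h0
  · rw [← h0]; exact Real.rpow_nonneg hD _
  · have h4 : S ^ (1 / s) ≤ D := by
      have h5 : S = S ^ (1 / s) * S ^ (1 / a) := by
        rw [← Real.rpow_add h0, add_comm, one_div, one_div, has.inv_add_inv_eq_one, Real.rpow_one]
      rw [h5] at h1
      refine le_of_mul_le_mul_right (h1.trans_eq ?_) (Real.rpow_pos_of_pos h0 (1 / a))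
      rw [← h5]
    have h6 := Real.rpow_le_rpow (Real.rpow_nonneg hS0 _) h4 (by linarith : 0 ≤ s)
    rwa [← Real.rpow_mul hS0, one_div_mul_cancel (by linarith), Real.rpow_one] at h6

theorem sum_mul_le_of_sum_rpow_le (has : a.HolderConjugate s) {D C : ℝ} (hD : 0 ≤ D) (hC : 0 ≤ C)
    (x : n → ℝ) (hx : ∀ j, 0 ≤ x j) (h : ∑ j, x j ^ s ≤ C * D ^ s) (w : n → ℝ)
    (hw : ∀ j, 0 ≤ w j) :
    ∑ j, w j * x j ≤ C ^ (1 / s) * D * (∑ j, w j ^ a) ^ (1 / a) := by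
  have hs0 : 0 < s := has.symm.pos
  refine (Real.inner_le_Lp_mul_Lq_of_nonneg univ has (fun j _ => hw j) fun j _ => hx j).trans ?_
  rw [mul_comm]
  refine mul_le_mul_of_nonneg_right ?_
    (Real.rpow_nonneg (sum_nonneg fun j _ => Real.rpow_nonneg (hw j) _) _)
  refine (Real.rpow_le_rpow (sum_nonneg fun j _ => Real.rpow_nonneg (hx j) _) h
    (by positivity)).trans (le_of_eq ?_)
  rw [Real.mul_rpow hC (Real.rpow_nonneg hD _), ← Real.rpow_mul hD, mul_one_div_cancel hs0.ne',
    Real.rpow_one]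

end Duality

/-! ### Orthonormal and Bessel families -/

section Bessel

theorem _root_.Orthonormal.comp_isometry_matrix {E : Type*} [NormedAddCommGroup E]
    [InnerProductSpace ℂ E] {n ι : Type*} [Fintype ι] [DecidableEq n] {e : ι → E}
    (he : Orthonormal ℂ e) (U : Matrix ι n ℂ) (hU : Uᴴ * U = 1) :
    Orthonormal ℂ fun j => ∑ i, U i j • e i := by
  rw [orthonormal_iff_ite]
  intro j j'
  rw [he.inner_sum]
  have := congrFun (congrFun hU j) j'
  rw [mul_apply, one_apply] at this
  simpa [conjTranspose_apply] using this

variable {E F : Type*} [NormedAddCommGroup E] [InnerProductSpace ℂ E]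
  [NormedAddCommGroup F] [InnerProductSpace ℂ F] {n : Type*} [Fintype n]

/-- The finite family `v` satisfies `‖∑ zⱼ vⱼ‖ ≤ c ‖z‖`. -/
def IsBessel (c : ℝ) (v : n → E) : Prop :=
  ∀ z : n → ℂ, ‖∑ j, z j • v j‖ ^ 2 ≤ c ^ 2 * ∑ j, ‖z j‖ ^ 2

theorem IsBessel.map {c : ℝ} {v : n → E} (hv : IsBessel c v) (τ : E →ₗ[ℂ] F) {M : ℝ}
    (hτ : ∀ x, ‖τ x‖ ≤ M * ‖x‖) : IsBessel (M * c) fun j => τ (v j) := by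
  intro z
  have h1 : ∑ j, z j • τ (v j) = τ (∑ j, z j • v j) := by simp
  rw [h1, mul_pow, mul_assoc]
  calc _ ≤ (M * ‖∑ j, z j • v j‖) ^ 2 := pow_le_pow_left₀ (norm_nonneg _) (hτ _) 2
    _ = M ^ 2 * ‖∑ j, z j • v j‖ ^ 2 := mul_pow _ _ _
    _ ≤ _ := mul_le_mul_of_nonneg_left (hv z) (sq_nonneg _)

theorem IsBessel.smul {c : ℝ} {v : n → E} (hv : IsBessel c v) (a : ℝ) :
    IsBessel (a * c) fun j => (a : ℂ) • v j := by
  intro z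
  have h1 : ∑ j, z j • (a : ℂ) • v j = (a : ℂ) • ∑ j, z j • v j := by
    rw [smul_sum]
    exact sum_congr rfl fun j _ => smul_comm _ _ _
  rw [h1, norm_smul, mul_pow, mul_pow, mul_assoc, Complex.norm_real, Real.norm_eq_abs, sq_abs]
  exact mul_le_mul_of_nonneg_left (hv z) (sq_nonneg _)

theorem _root_.Orthonormal.isBessel {v : n → E} (hv : Orthonormal ℂ v) : IsBessel 1 v := by
  intro z
  rw [one_pow, one_mul, ← inner_self_eq_norm_sq (𝕜 := ℂ), hv.inner_sum]
  refine le_of_eq ?_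
  rw [map_sum]
  refine sum_congr rfl fun j _ => ?_
  rw [RCLike.conj_mul]
  norm_cast

/-- A synthesis map of norm at most 1 has an adjoint of norm at most 1. Concretely, Cauchy-Schwarz
against the synthesised vector gives S² ≤ ‖x‖² S. -/
theorem IsBessel.sum_inner_le {v : n → E} (hv : IsBessel 1 v) (x : E) :
    ∑ j, ‖inner ℂ x (v j)‖ ^ 2 ≤ ‖x‖ ^ 2 := by
  set S := ∑ j, ‖inner ℂ x (v j)‖ ^ 2 with hS
  have hS0 : 0 ≤ S := by positivity
  have h1 := hv fun j => inner ℂ (v j) x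
  rw [one_pow, one_mul] at h1
  have h2 : ∑ j, ‖inner ℂ (v j) x‖ ^ 2 = S := sum_congr rfl fun j _ => by rw [norm_inner_symm]
  rw [h2] at h1
  have h3 : inner ℂ x (∑ j, inner ℂ (v j) x • v j) = ((S : ℝ) : ℂ) := by
    rw [inner_sum, hS, Complex.ofReal_sum]
    refine sum_congr rfl fun j _ => ?_
    rw [inner_smul_right, ← inner_conj_symm x (v j), RCLike.mul_conj, RCLike.norm_conj]
    norm_cast
  have h4 : S ≤ ‖x‖ * ‖∑ j, inner ℂ (v j) x • v j‖ := by
    have := norm_inner_le_norm (𝕜 := ℂ) x (∑ j, inner ℂ (v j) x • v j)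
    rwa [h3, Complex.norm_real, Real.norm_of_nonneg hS0] at this
  by_contra! h5
  have h6 : S ^ 2 ≤ ‖x‖ ^ 2 * S := by
    calc S ^ 2 ≤ (‖x‖ * ‖∑ j, inner ℂ (v j) x • v j‖) ^ 2 := pow_le_pow_left₀ hS0 h4 2
      _ = ‖x‖ ^ 2 * ‖∑ j, inner ℂ (v j) x • v j‖ ^ 2 := mul_pow _ _ _
      _ ≤ _ := mul_le_mul_of_nonneg_left h1 (sq_nonneg _)
  nlinarith [sq_nonneg ‖x‖]

theorem IsBessel.isBesselMatrix {ι : Type*} [Fintype ι] {e : ι → E} (he : Orthonormal ℂ e)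
    (W : Matrix ι n ℂ) (hv : IsBessel 1 fun j => ∑ i, W i j • e i) : IsBesselMatrix W := by
  intro x
  have h := hv.sum_inner_le (∑ i, x i • e i)
  simp only [he.inner_sum] at h
  refine h.trans (le_of_eq ?_)
  rw [← inner_self_eq_norm_sq (𝕜 := ℂ), he.inner_sum, map_sum]
  refine sum_congr rfl fun i _ => ?_
  rw [RCLike.conj_mul]
  norm_cast

end Bessel

/-! ### Finite coordinates for vectors and operators -/

section Rows

variable {F : Type*} [NormedAddCommGroup F] [InnerProductSpace ℂ F] {ι : Type*} [Fintype ι]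

/-- Finitely many vectors of F are replaced by coordinates in an orthonormal basis of their span, so
an F-valued map on a finite family becomes a finite matrix with the same norms. -/
theorem exists_rows (y : ι → F) : ∃ (d : ℕ) (R : Fin d → ι → ℂ),
    ∀ z : ι → ℂ, ∑ x, ‖∑ i, R x i * z i‖ ^ 2 = ‖∑ i, z i • y i‖ ^ 2 := by
  set V := Submodule.span ℂ (Set.range y)
  have : FiniteDimensional ℂ V := FiniteDimensional.span_of_finite ℂ (Set.finite_range y)
  have hy : ∀ i, y i ∈ V := fun i => Submodule.subset_span ⟨i, rfl⟩
  let e := stdOrthonormalBasis ℂ V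
  refine ⟨_, fun x i => inner ℂ (e x) (⟨y i, hy i⟩ : V), fun z => ?_⟩
  have h1 : ∀ x, ∑ i, inner ℂ (e x) (⟨y i, hy i⟩ : V) * z i =
      inner ℂ (e x) (∑ i, z i • (⟨y i, hy i⟩ : V)) := fun x => by
    rw [inner_sum]
    exact sum_congr rfl fun i _ => by rw [inner_smul_right, mul_comm]
  simp only [h1]
  rw [e.sum_sq_norm_inner_right]
  have h2 : ((∑ i, z i • (⟨y i, hy i⟩ : V) : V) : F) = ∑ i, z i • y i := by simp
  rw [← h2]
  rfl

theorem exists_orthonormal_coordinates (v : ι → F) : ∃ (d : ℕ) (e : Fin d → F),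
    Orthonormal ℂ e ∧ (∀ x, e x ∈ Submodule.span ℂ (Set.range v)) ∧
      ∀ i, v i = ∑ x, inner ℂ (e x) (v i) • e x := by
  set V := Submodule.span ℂ (Set.range v)
  have : FiniteDimensional ℂ V := FiniteDimensional.span_of_finite ℂ (Set.finite_range v)
  let e := stdOrthonormalBasis ℂ V
  refine ⟨_, fun x => (e x : F), e.orthonormal.comp_linearIsometry V.subtypeₗᵢ,
    fun x => (e x).2, fun i => ?_⟩
  have h := congrArg (Subtype.val) (e.sum_repr' ⟨v i, Submodule.subset_span ⟨i, rfl⟩⟩)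
  simp only [Submodule.coe_sum, Submodule.coe_smul, Submodule.coe_inner] at h
  exact h.symm

end Rows

/-! ### Schatten bounds for quadratic forms and time-ordered sums -/

section Forms

variable {E F : Type*} [NormedAddCommGroup E] [InnerProductSpace ℂ E]
  [NormedAddCommGroup F] [InnerProductSpace ℂ F] {N : ℕ}

/-- The form `u ↦ ∑ₖ ‖Bₖ u‖²` lies in the dual Schatten class with norm at most `D`:
`∑ⱼ wⱼ ∑ₖ ‖Bₖ uⱼ‖² ≤ D ‖w‖_{ℓ^a}` for finite orthonormal families `u`. -/
def SchattenBound (B : Fin N → E →ₗ[ℂ] F) (a D : ℝ) : Prop :=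
  ∀ (J : Type) [Fintype J] (u : J → E), Orthonormal ℂ u → ∀ w : J → ℝ, (∀ j, 0 ≤ w j) →
    ∑ j, w j * ∑ k, ‖B k (u j)‖ ^ 2 ≤ D * (∑ j, w j ^ a) ^ (1 / a)

/-- Stacking the coordinate rows of all B k gives one matrix K. Its Gram eigenvalues are the values
of the form at the orthonormal family rotated by U, so the hypothesis tests them against every
nonnegative w, and duality turns this into an ℓ^s bound. -/
theorem exists_matrix_of_orthonormal {ι : Type} [Fintype ι] [DecidableEq ι]
    (B : Fin N → E →ₗ[ℂ] F) (e : ι → E) (he : Orthonormal ℂ e) {a s D : ℝ}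
    (has : a.HolderConjugate s) (hD : 0 ≤ D) (hB : SchattenBound B a D) :
    ∃ (d : Fin N → ℕ) (K : Matrix (Σ k, Fin (d k)) ι ℂ) (U : Matrix ι ι ℂ) (l : ι → ℝ),
      (∀ k (z : ι → ℂ), ∑ x, ‖∑ i, K ⟨k, x⟩ i * z i‖ ^ 2 = ‖B k (∑ i, z i • e i)‖ ^ 2) ∧
      Uᴴ * U = 1 ∧ U * Uᴴ = 1 ∧ (∀ i, 0 ≤ l i) ∧
      Kᴴ * K = U * diagonal (fun i => (l i : ℂ)) * Uᴴ ∧ ∑ i, l i ^ s ≤ D ^ s := by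
  choose d R hR using fun k => exists_rows fun i => B k (e i)
  let K : Matrix (Σ k, Fin (d k)) ι ℂ := Matrix.of fun p i => R p.1 p.2 i
  obtain ⟨U, l, hU, hU', hl, hK⟩ := exists_diagonalization K
  have h1 : ∀ k (z : ι → ℂ), ∑ x, ‖∑ i, K ⟨k, x⟩ i * z i‖ ^ 2 = ‖B k (∑ i, z i • e i)‖ ^ 2 :=
    fun k z => by
      simp only [K, of_apply, hR, map_sum, map_smul]
  refine ⟨d, K, U, l, h1, hU, hU', hl, hK, ?_⟩
  refine sum_rpow_le_of_forall_sum_mul_le has hD l hl fun w hw => ?_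
  -- Take W = U in the column formula: since UᴴU = 1, only the eigenvalue l j remains.
  have h2 : ∀ j, l j = ∑ k, ‖B k (∑ i, U i j • e i)‖ ^ 2 := fun j => by
    have h3 := sum_norm_sq_eq_of_diagonalization hK U j
    rw [hU] at h3
    have h4 : ∑ i, ‖(1 : Matrix ι ι ℂ) i j‖ ^ 2 * l i = l j := by
      rw [sum_eq_single j]
      · simp
      · intro i _ hij
        simp [one_apply_ne hij]
      · simp
    rw [← h4, ← h3, Fintype.sum_sigma]
    simp only [← h1, mul_apply]
  simp only [h2]
  exact hB ι _ (he.comp_isometry_matrix U hU) w hw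

/-- Passes from orthonormal to Bessel families: in an eigenbasis of the form a Bessel family only
averages the eigenvalues substochastically. -/
theorem SchattenBound.sum_rpow_le {B : Fin N → E →ₗ[ℂ] F} {a s D : ℝ}
    (has : a.HolderConjugate s) (hD : 0 ≤ D) (hB : SchattenBound B a D) {n : Type*} [Fintype n]
    (v : n → E) (hv : IsBessel 1 v) : ∑ j, (∑ k, ‖B k (v j)‖ ^ 2) ^ s ≤ D ^ s := by
  obtain ⟨m, e, he, -, hve⟩ := exists_orthonormal_coordinates v
  obtain ⟨d, K, U, l, hK, hU, hU', hl, hKU, hls⟩ := exists_matrix_of_orthonormal B e he has hD hB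
  let W : Matrix (Fin m) n ℂ := Matrix.of fun x j => inner ℂ (e x) (v j)
  have hve' : ∀ j, ∑ i, W i j • e i = v j := fun j => (hve j).symm
  have hW : IsBesselMatrix W := IsBessel.isBesselMatrix he W (by simpa only [hve'] using hv)
  obtain ⟨h1, h2⟩ := hW.unitary_mul hU hU'
  refine (le_of_eq (sum_congr rfl fun j _ => ?_)).trans ((sum_rpow_sum_mul_le has.symm.lt.le
    (fun j i => ‖(Uᴴ * W) i j‖ ^ 2) (fun _ _ => by positivity) h1 h2 l hl).trans hls)
  rw [← sum_norm_sq_eq_of_diagonalization hKU, Fintype.sum_sigma]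
  congr 1
  refine sum_congr rfl fun k _ => ?_
  simp only [mul_apply]
  rw [hK, hve']

/-- The ideal property of Schatten classes: images of orthonormal families under an operator of norm
c are Bessel with constant c. -/
theorem SchattenBound.comp {B : Fin N → E →ₗ[ℂ] F} {a s D : ℝ}
    (has : a.HolderConjugate s) (hD : 0 ≤ D) (hB : SchattenBound B a D)
    {n : Type*} [Fintype n] {c : ℝ} (hc : 0 < c) (v : n → E) (hv : IsBessel c v)
    (w : n → ℝ) (hw : ∀ j, 0 ≤ w j) :
    ∑ j, w j * ∑ k, ‖B k (v j)‖ ^ 2 ≤ c ^ 2 * D * (∑ j, w j ^ a) ^ (1 / a) := by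
  have hv' := hv.smul c⁻¹
  rw [inv_mul_cancel₀ hc.ne'] at hv'
  have h1 := hB.sum_rpow_le has hD _ hv'
  have h2 := sum_mul_le_of_sum_rpow_le has hD zero_le_one _
    (fun j => sum_nonneg fun k _ => by positivity) (h1.trans_eq (one_mul _).symm) w hw
  rw [Real.one_rpow, one_mul] at h2
  have h3 : ∀ j, ∑ k, ‖B k (v j)‖ ^ 2 =
      c ^ 2 * ∑ k, ‖B k (((c⁻¹ : ℝ) : ℂ) • v j)‖ ^ 2 := fun j => by
    rw [mul_sum]
    refine sum_congr rfl fun k _ => ?_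
    rw [map_smul, norm_smul, Complex.norm_real, Real.norm_of_nonneg (by positivity), mul_pow,
      ← mul_assoc, ← mul_pow, mul_inv_cancel₀ hc.ne', one_pow, one_mul]
  calc _ = c ^ 2 * ∑ j, w j * ∑ k, ‖B k (((c⁻¹ : ℝ) : ℂ) • v j)‖ ^ 2 := by
        rw [mul_sum]
        refine sum_congr rfl fun j _ => ?_
        rw [h3]
        ring
    _ ≤ c ^ 2 * (D * (∑ j, w j ^ a) ^ (1 / a)) := mul_le_mul_of_nonneg_left h2 (sq_nonneg _)
    _ = _ := by ring

end Forms

universe u v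

/-- The bound for time ordered sums: the `k`-th form only sees the pieces with index `< k`. -/
theorem exists_timeOrdered_bound {a s : ℝ} (has : a.HolderConjugate s) : ∃ C : ℝ, 0 ≤ C ∧
    ∀ (E : Type u) (F : Type v) [NormedAddCommGroup E] [InnerProductSpace ℂ E] [NormedAddCommGroup F]
      [InnerProductSpace ℂ F] (N : ℕ) (B : Fin N → E →ₗ[ℂ] F) (D : ℝ), 0 ≤ D →
      SchattenBound B a D → ∀ (n : Type) [Fintype n] (v : Fin N → n → E),
      (∀ i i' j j', i ≠ i' → inner ℂ (v i j) (v i' j') = 0) →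
      (IsBessel 1 fun j => ∑ i, v i j) → ∀ w : n → ℝ, (∀ j, 0 ≤ w j) →
      ∑ j, w j * ∑ k, ‖B k (∑ i with i < k, v i j)‖ ^ 2 ≤
        C * D * (∑ j, w j ^ a) ^ (1 / a) := by
  obtain ⟨C, hC, h⟩ := exists_sum_rpow_triangularPart_le has.symm.lt
  refine ⟨C ^ (1 / s), by positivity, ?_⟩
  intro E F _ _ _ _ N B D hD hB n _ v hv hv1 w hw
  refine sum_mul_le_of_sum_rpow_le has hD hC _ (fun j => sum_nonneg fun k _ => by positivity)
    ?_ w hw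
  choose m e he hespan hve using fun i => exists_orthonormal_coordinates (v i)
  -- Bases of the spans of the separate pieces together form one orthonormal family, by mutual
  -- orthogonality of the pieces, so every column of the matrix carries a time index.
  let f : (Σ i, Fin (m i)) → E := fun p => e p.1 p.2
  have hf : Orthonormal ℂ f := by
    rw [orthonormal_iff_ite]
    rintro ⟨i, x⟩ ⟨i', x'⟩
    by_cases hii : i = i'
    · subst hii
      have := orthonormal_iff_ite.1 (he i) x x'
      simpa [f] using this
    · rw [if_neg (by simp [hii])]
      have h1 : Submodule.span ℂ (Set.range (v i)) ⟂ Submodule.span ℂ (Set.range (v i')) := by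
        rw [Submodule.isOrtho_span]
        rintro _ ⟨j, rfl⟩ _ ⟨j', rfl⟩
        exact hv i i' j j' hii
      exact h1.inner_eq (hespan i x) (hespan i' x')
  obtain ⟨d, K, U, l, hK, hU, -, hl, hKU, hls⟩ := exists_matrix_of_orthonormal B f hf has hD hB
  let W : Matrix (Σ i, Fin (m i)) n ℂ := Matrix.of fun p j => inner ℂ (f p) (v p.1 j)
  have hWv : ∀ i j, ∑ x, W ⟨i, x⟩ j • f ⟨i, x⟩ = v i j := fun i j => (hve i j).symm
  have hW : IsBesselMatrix W := by
    refine IsBessel.isBesselMatrix hf W ?_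
    simpa only [Fintype.sum_sigma, hWv] using hv1
  -- Rows and columns both have their time index as level, so the strict triangular part keeps
  -- exactly the pieces with i < k.
  have key := h _ _ _ (fun p => (p.1 : ℕ)) (fun p => (p.1 : ℕ)) K W U l hW hU hl hKU
  refine (le_of_eq (sum_congr rfl fun j _ => ?_)).trans
    (key.trans (mul_le_mul_of_nonneg_left hls hC))
  rw [Fintype.sum_sigma]
  congr 1
  refine sum_congr rfl fun k _ => ?_
  have h2 := hK k fun p => if (p.1 : ℕ) < k then W p j else 0
  have h3 : ∑ p, (if (p.1 : ℕ) < k then W p j else 0) • f p = ∑ i with i < k, v i j := by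
    rw [Fintype.sum_sigma, sum_filter]
    refine sum_congr rfl fun i _ => ?_
    simp only [Fin.val_fin_lt]
    split_ifs
    · exact hWv i j
    · simp
  rw [h3] at h2
  rw [← h2]
  refine sum_congr rfl fun x _ => ?_
  rw [mul_apply]
  congr 2
  refine sum_congr rfl fun p _ => ?_
  simp only [triangularPart, of_apply]
  split_ifs <;> simp

end

end OrthStrichartz

namespace OrthStrichartz

noncomputable section

/-! ### Inverses of shifts of a self-adjoint operator -/

section SelfAdjoint

variable {E : Type*} [NormedAddCommGroup E] [InnerProductSpace ℂ E] [CompleteSpace E]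
  {A : E →ₗ.[ℂ] E}

theorem _root_.IsSelfAdjoint.inner_graph (hA : IsSelfAdjoint A) {u v x y : E}
    (h : (u, v) ∈ A.graph) (h' : (x, y) ∈ A.graph) : inner ℂ v x = inner ℂ u y := by
  obtain ⟨u, rfl, rfl⟩ := (LinearPMap.mem_graph_iff A).1 h
  obtain ⟨x, rfl, rfl⟩ := (LinearPMap.mem_graph_iff A).1 h'
  have h1 := LinearPMap.adjoint_isFormalAdjoint hA.dense_domain
  rw [LinearPMap.isSelfAdjoint_def.1 hA] at h1
  exact h1 u x

theorem _root_.IsSelfAdjoint.mem_graph_of_inner (hA : IsSelfAdjoint A) {u v : E}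
    (h : ∀ x : A.domain, inner ℂ v (x : E) = inner ℂ u (A x)) : (u, v) ∈ A.graph := by
  have h1 : u ∈ A.adjoint.domain := LinearPMap.mem_adjoint_domain_of_exists u ⟨v, h⟩
  have h2 := LinearPMap.adjoint_apply_eq hA.dense_domain ⟨u, h1⟩ h
  have h3 : (u, v) ∈ A.adjoint.graph := (LinearPMap.mem_graph_iff _).2 ⟨⟨u, h1⟩, rfl, h2⟩
  rwa [LinearPMap.isSelfAdjoint_def.1 hA] at h3

/-- The lower bound makes A + c injective with closed range on the complete graph of A; a vector
orthogonal to the range lies in the kernel of A + c̄ by self-adjointness, hence vanishes. -/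
theorem _root_.IsSelfAdjoint.exists_inverse (hA : IsSelfAdjoint A) (c : ℂ) (K : ℝ≥0)
    (hK : ∀ u v : E, (u, v) ∈ A.graph → ‖u‖ ≤ K * ‖v + c • u‖)
    (hker : ∀ u : E, (u, -(starRingEnd ℂ c • u)) ∈ A.graph → u = 0) :
    ∃ R : E →L[ℂ] E, (∀ w, (R w, w - c • R w) ∈ A.graph) ∧
      ∀ u v : E, (u, v) ∈ A.graph → R (v + c • u) = u := by
  let g : A.graph →L[ℂ] E := (ContinuousLinearMap.snd ℂ E E + c • ContinuousLinearMap.fst ℂ E E).comp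
    A.graph.subtypeL
  have hg : ∀ p : A.graph, g p = p.1.2 + c • p.1.1 := fun p => rfl
  have : CompleteSpace A.graph := hA.isClosed.completeSpace_coe
  have hbound : ∀ p : A.graph, ‖p‖ ≤ ((K + (1 + ‖c‖₊ * K) : ℝ≥0) : ℝ) * ‖g p‖ := by
    rintro ⟨⟨u, v⟩, hp⟩
    have h1 := hK u v hp
    have h2 : ‖v‖ ≤ ‖v + c • u‖ + ‖c‖ * ‖u‖ := by
      have := norm_sub_le (v + c • u) (c • u)
      rwa [add_sub_cancel_right, norm_smul] at this
    have h3 : ‖c‖ * ‖u‖ ≤ ‖c‖ * (K * ‖v + c • u‖) := by gcongr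
    have h0 : 0 ≤ (K : ℝ) * ‖v + c • u‖ := by positivity
    have h0' : 0 ≤ ‖c‖ * ((K : ℝ) * ‖v + c • u‖) := by positivity
    have h4 : ‖(⟨(u, v), hp⟩ : A.graph)‖ = max ‖u‖ ‖v‖ := rfl
    rw [hg, h4]
    push_cast
    refine max_le ?_ ?_ <;> nlinarith [norm_nonneg (v + c • u)]
  have hanti := g.antilipschitz_of_bound hbound
  have hinj : Function.Injective g := hanti.injective
  have hclosed : IsClosed (Set.range g) := hanti.isClosed_range g.uniformContinuous
  have hrange : (g : A.graph →ₗ[ℂ] E).range = ⊤ := by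
    have hc : IsClosed ((g : A.graph →ₗ[ℂ] E).range : Set E) := hclosed
    have : CompleteSpace (g : A.graph →ₗ[ℂ] E).range := hc.completeSpace_coe
    rw [← Submodule.orthogonal_eq_bot_iff, Submodule.eq_bot_iff]
    intro u hu
    refine hker u (hA.mem_graph_of_inner fun x => ?_)
    have h1 : inner ℂ u (A x + c • (x : E)) = 0 := by
      rw [Submodule.mem_orthogonal'] at hu
      exact hu _ ⟨⟨_, A.mem_graph x⟩, rfl⟩
    rw [inner_add_right, inner_smul_right] at h1
    rw [inner_neg_left, inner_smul_left, Complex.conj_conj]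
    linear_combination -h1
  let e := ContinuousLinearEquiv.ofBijective g (LinearMap.ker_eq_bot.2 hinj) hrange
  refine ⟨((ContinuousLinearMap.fst ℂ E E).comp A.graph.subtypeL).comp
    (e.symm : E →L[ℂ] A.graph), fun w => ?_, fun u v huv => ?_⟩
  · have h1 : g (e.symm w) = w := e.apply_symm_apply w
    have h2 := (e.symm w).2
    have h3 : ((e.symm w).1.1, w - c • (e.symm w).1.1) = (e.symm w).1 := by
      exact Prod.ext rfl (sub_eq_iff_eq_add.2 (h1.symm.trans (hg _)))
    exact h3 ▸ h2
  · have h1 : e ⟨(u, v), huv⟩ = v + c • u := rfl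
    change ((e.symm (v + c • u)) : E × E).1 = u
    rw [← h1, e.symm_apply_apply]

theorem exists_isResolvent (hA : IsSelfAdjoint A)
    (hpos : ∀ u : A.domain, 0 ≤ (inner ℂ (A u) (u : E)).re) : ∃ B, IsResolvent A B := by
  have hb : ∀ u v : E, (u, v) ∈ A.graph → ‖u‖ ≤ (1 : ℝ≥0) * ‖v + (1 : ℂ) • u‖ := by
    intro u v huv
    obtain ⟨u, rfl, rfl⟩ := (LinearPMap.mem_graph_iff A).1 huv
    rw [one_smul, NNReal.coe_one, one_mul]
    have h1 : ‖(u : E)‖ * ‖(u : E)‖ ≤ ‖A u + u‖ * ‖(u : E)‖ := by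
      refine le_trans ?_ (re_inner_le_norm (𝕜 := ℂ) (A u + u) (u : E))
      rw [inner_add_left, map_add, inner_self_eq_norm_mul_norm]
      exact le_add_of_nonneg_left (hpos u)
    rcases (norm_nonneg (u : E)).eq_or_lt with h0 | h0
    · rw [← h0]; exact norm_nonneg _
    · exact le_of_mul_le_mul_right h1 h0
  obtain ⟨R, hR1, hR2⟩ := hA.exists_inverse 1 1 hb fun u hu => by
    have h1 := hb _ _ hu
    simpa using h1
  refine ⟨R, fun u => by simpa using hR1 u, fun u => ?_⟩
  have := hR2 u (A u) (A.mem_graph u)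
  rwa [one_smul, add_comm] at this

theorem isResolvent_resolventOne (hA : IsSelfAdjoint A)
    (hpos : ∀ u : A.domain, 0 ≤ (inner ℂ (A u) (u : E)).re) :
    IsResolvent A (resolventOne A) := by
  have h := exists_isResolvent hA hpos
  rw [resolventOne, dif_pos h]
  exact h.choose_spec

end SelfAdjoint

end

end OrthStrichartz

namespace OrthStrichartz

noncomputable section

/-! ### Stone's theorem: existence of the unitary group -/

section Stone

/-- `r ↦ r e^{-itλ}` in the variable `r = (λ + i)⁻¹`, for real `λ`. -/
def stoneFun (t : ℝ) (r : ℂ) : ℂ := r * Complex.exp (-(Complex.I * (t * (r⁻¹).re : ℝ)))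

theorem norm_exp_neg_I_mul (x : ℝ) : ‖Complex.exp (-(Complex.I * (x : ℝ)))‖ = 1 := by
  rw [← mul_neg, ← Complex.ofReal_neg, mul_comm, Complex.norm_exp_ofReal_mul_I]

theorem norm_stoneFun (t : ℝ) (r : ℂ) : ‖stoneFun t r‖ = ‖r‖ := by
  rw [stoneFun, norm_mul, norm_exp_neg_I_mul, mul_one]

/-- Only r = 0, the point λ = ∞, is delicate: there the oscillating phase is damped by the factor r.
This is why r e^{-itλ}, and not the phase itself, enters the continuous functional calculus. -/
theorem continuous_stoneFun (t : ℝ) : Continuous (stoneFun t) := by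
  rw [continuous_iff_continuousAt]
  intro r
  by_cases hr : r = 0
  · subst hr
    rw [ContinuousAt, show stoneFun t 0 = 0 by simp [stoneFun], tendsto_zero_iff_norm_tendsto_zero]
    simp only [norm_stoneFun]
    exact tendsto_norm_zero
  · unfold stoneFun
    refine continuousAt_id.mul (Complex.continuous_exp.continuousAt.comp ?_)
    refine (continuousAt_const.mul (Complex.continuous_ofReal.continuousAt.comp ?_)).neg
    exact continuousAt_const.mul (Complex.continuous_re.continuousAt.comp (continuousAt_inv₀ hr))

theorem abs_re_inv_mul_le (r : ℂ) : |(r⁻¹).re| * ‖r‖ ≤ 1 := by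
  by_cases hr : r = 0
  · simp [hr]
  · have h := mul_le_mul_of_nonneg_right (Complex.abs_re_le_norm r⁻¹) (norm_nonneg r)
    rwa [norm_inv, inv_mul_cancel₀ (norm_ne_zero_iff.2 hr)] at h

theorem norm_exp_neg_I_sub_one_le (x : ℝ) : ‖Complex.exp (-(Complex.I * (x : ℝ))) - 1‖ ≤ |x| := by
  have h := Real.norm_exp_I_mul_ofReal_sub_one_le (x := -x)
  simpa using h

theorem norm_exp_neg_I_sub_one_add_le (x : ℝ) :
    ‖Complex.exp (-(Complex.I * (x : ℝ))) - 1 + Complex.I * (x : ℝ)‖ ≤ 2 * |x| ^ 2 := by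
  rcases le_or_gt |x| 1 with h | h
  · have h1 := Complex.norm_exp_sub_one_sub_id_le (x := -(Complex.I * (x : ℝ))) (by simpa using h)
    simp only [norm_neg, norm_mul, Complex.norm_I, one_mul, Complex.norm_real,
      Real.norm_eq_abs, sub_neg_eq_add] at h1
    nlinarith [sq_nonneg |x|]
  · refine (norm_add_le _ _).trans ?_
    have h1 := norm_exp_neg_I_sub_one_le x
    rw [norm_mul, Complex.norm_I, one_mul, Complex.norm_real, Real.norm_eq_abs]
    nlinarith

theorem stoneFun_add (s t : ℝ) (r : ℂ) :
    r * stoneFun (s + t) r = stoneFun s r * stoneFun t r := by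
  simp only [stoneFun]
  rw [add_mul, Complex.ofReal_add, mul_add, neg_add, Complex.exp_add]
  ring

variable {E : Type*} [NormedAddCommGroup E] [InnerProductSpace ℂ E] [CompleteSpace E]

/-- The inverse of `A + i`. -/
theorem _root_.IsSelfAdjoint.exists_normal_inverse {A : E →ₗ.[ℂ] E} (hA : IsSelfAdjoint A) :
    ∃ R : E →L[ℂ] E, IsStarNormal R ∧ R - star R = (-(2 * Complex.I)) • (R * star R) ∧
      (∀ w, (R w, w - Complex.I • R w) ∈ A.graph) ∧
      ∀ u v : E, (u, v) ∈ A.graph → R (v + Complex.I • u) = u := by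
  have hb : ∀ c : ℂ, (c = Complex.I ∨ c = -Complex.I) → ∀ u v : E, (u, v) ∈ A.graph →
      ‖u‖ ≤ (1 : ℝ≥0) * ‖v + c • u‖ := by
    intro c hc u v huv
    rw [NNReal.coe_one, one_mul]
    have h1 : (inner ℂ v u).im = 0 := by
      have h2 := hA.inner_graph huv huv
      have h3 := congrArg Complex.im (inner_conj_symm (𝕜 := ℂ) u v)
      rw [← h2, Complex.conj_im] at h3
      linarith
    have h2 : ‖u‖ ^ 2 ≤ ‖v + c • u‖ ^ 2 := by
      rw [norm_add_sq (𝕜 := ℂ), norm_smul]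
      have hc1 : ‖c‖ = 1 := by rcases hc with rfl | rfl <;> simp
      have h3 : RCLike.re (inner ℂ v (c • u)) = 0 := by
        rw [inner_smul_right]
        rcases hc with rfl | rfl <;> simp [h1]
      rw [hc1, h3, one_mul]
      nlinarith [sq_nonneg ‖v‖]
    exact (pow_le_pow_iff_left₀ (norm_nonneg _) (norm_nonneg _) two_ne_zero).1 h2
  have hker : ∀ c : ℂ, (c = Complex.I ∨ c = -Complex.I) →
      ∀ u : E, (u, -(starRingEnd ℂ c • u)) ∈ A.graph → u = 0 := by
    intro c hc u hu
    have h1 := hb (starRingEnd ℂ c) (by rcases hc with rfl | rfl <;> simp) _ _ hu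
    simpa using h1
  obtain ⟨R, hR, hR'⟩ := hA.exists_inverse Complex.I 1 (hb _ (Or.inl rfl)) (hker _ (Or.inl rfl))
  obtain ⟨S, hS, hS'⟩ := hA.exists_inverse (-Complex.I) 1 (hb _ (Or.inr rfl))
    (hker _ (Or.inr rfl))
  have hadj : S = star R := by
    rw [ContinuousLinearMap.star_eq_adjoint, ContinuousLinearMap.eq_adjoint_iff]
    intro x y
    have h1 := hA.inner_graph (hS x) (hR y)
    rw [inner_sub_left, inner_sub_right, inner_smul_left, inner_smul_right] at h1
    simp only [map_neg, Complex.conj_I, neg_neg] at h1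
    linear_combination -h1
  have hRS : R - S = (-(2 * Complex.I)) • (R * S) := by
    ext u
    have h1 := hR' _ _ (hS u)
    have h2 : u - -Complex.I • S u + Complex.I • S u = u + (2 * Complex.I) • S u := by
      rw [mul_smul, two_smul]; simp; abel
    rw [h2, map_add, map_smul] at h1
    change R u - S u = (-(2 * Complex.I)) • R (S u)
    rw [neg_smul]
    rw [← sub_eq_zero] at h1 ⊢
    rw [← h1]
    abel
  have hSR : R - S = (-(2 * Complex.I)) • (S * R) := by
    ext u
    have h1 := hS' _ _ (hR u)
    have h2 : u - Complex.I • R u + -Complex.I • R u = u - (2 * Complex.I) • R u := by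
      rw [mul_smul, two_smul]; simp; abel
    rw [h2, map_sub, map_smul] at h1
    change R u - S u = (-(2 * Complex.I)) • S (R u)
    rw [neg_smul]
    rw [← sub_eq_zero] at h1 ⊢
    rw [← neg_eq_zero, ← h1]
    abel
  have hnormal : IsStarNormal R := by
    constructor
    rw [← hadj]
    have h1 : (2 * Complex.I) ≠ 0 := by simp
    have h2 := hRS.symm.trans hSR
    exact (smul_right_injective _ (neg_ne_zero.2 h1) h2).symm
  exact ⟨R, hnormal, by rw [← hadj]; exact hRS, hR, hR'⟩

/-- Existence part of Stone's theorem. -/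
theorem _root_.IsSelfAdjoint.exists_isUnitaryGroupOf {A : E →ₗ.[ℂ] E} (hA : IsSelfAdjoint A) :
    ∃ U : ℝ → E →L[ℂ] E, IsUnitaryGroupOf U A := by
  obtain ⟨R, hnormal, hRstar, hR, hR'⟩ := hA.exists_normal_inverse
  -- On the spectrum of R = (A + i)⁻¹ the identity R - R* = -2iRR* becomes the same relation for r.
  -- It says that 1/r = λ + i with λ real, or r²λ = r - ir².
  have hspec : ∀ r ∈ spectrum ℂ R, r * r * ((r⁻¹).re : ℂ) = r - Complex.I * (r * r) := by
    intro r hr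
    have h1 : cfc (fun r : ℂ => r - star r + (2 * Complex.I) • (r * star r)) R = 0 := by
      rw [cfc_add R (fun r : ℂ => r - star r) fun r => (2 * Complex.I) • (r * star r),
        cfc_sub (fun r : ℂ => r) (fun r : ℂ => star r) R, cfc_smul (2 * Complex.I) (fun r : ℂ => r * star r) R,
        cfc_mul (fun r : ℂ => r) (fun r : ℂ => star r) R, cfc_star_id R, cfc_id' ℂ R, hRstar,
        neg_smul, neg_add_cancel]
    have h2 := norm_apply_le_norm_cfc (fun r : ℂ => r - star r + (2 * Complex.I) • (r * star r)) R
      hr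
    rw [h1, norm_zero] at h2
    have h3 : r - star r + (2 * Complex.I) • (r * star r) = 0 := norm_le_zero_iff.1 h2
    rw [RCLike.star_def, smul_eq_mul] at h3
    by_cases h0 : r = 0
    · simp [h0]
    · have h4 : starRingEnd ℂ r ≠ 0 := by simpa using h0
      rw [Complex.re_eq_add_conj, map_inv₀]
      field_simp
      linear_combination h3
  set e : ℝ → E →L[ℂ] E := fun t => cfc (stoneFun t) R with he
  have hcont : ∀ t, ContinuousOn (stoneFun t) (spectrum ℂ R) := fun t =>
    (continuous_stoneFun t).continuousOn
  have hmul : ∀ s t, e s * e t = R * e (s + t) := fun s t => by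
    simp only [he]
    rw [← cfc_mul _ _ R (hcont s) (hcont t)]
    simp only [← stoneFun_add]
    rw [cfc_mul (fun r : ℂ => r) (stoneFun (s + t)) R continuousOn_id (hcont _), cfc_id' ℂ R]
  have he0 : e 0 = R := by
    simp only [he]
    have : stoneFun 0 = fun r => r := by funext r; simp [stoneFun]
    rw [this, cfc_id' ℂ R]
  have hnorm : ∀ t w, ‖e t w‖ = ‖R w‖ := by
    intro t w
    have h1 : star (e t) * e t = star R * R := by
      have h2 : (fun r : ℂ => star (stoneFun t r) * stoneFun t r) = fun r => star r * r := by
        funext r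
        rw [RCLike.star_def, RCLike.conj_mul, RCLike.conj_mul, norm_stoneFun]
      simp only [he]
      rw [← cfc_star, ← cfc_mul (fun r : ℂ => star (stoneFun t r)) (stoneFun t) R
        (continuous_star.comp_continuousOn (hcont t)) (hcont t), h2,
        cfc_mul (fun r : ℂ => star r) (fun r : ℂ => r) R, cfc_star_id R, cfc_id' ℂ R]
    have h3 : ∀ T : E →L[ℂ] E, ‖T w‖ ^ 2 = RCLike.re (inner ℂ w ((star T * T) w)) := fun T => by
      rw [← inner_self_eq_norm_sq (𝕜 := ℂ)]
      exact congrArg _ (ContinuousLinearMap.adjoint_inner_right T w (T w)).symm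
    refine (pow_left_inj₀ (norm_nonneg _) (norm_nonneg _) two_ne_zero).1 ?_
    rw [h3, h3, h1]
  have hrange : ∀ x : A.domain, ∃ w, R w = x := fun x => ⟨_, hR' _ _ (A.mem_graph x)⟩
  have hdense : DenseRange R := by
    refine hA.dense_domain.mono ?_
    intro x hx
    exact hrange ⟨x, hx⟩
  -- The relation U t (R w) = e t w fixes U t on the dense range of R; `hnorm` makes it isometric
  -- there, so it extends.
  let U : ℝ → E →L[ℂ] E := fun t => (e t : E →ₗ[ℂ] E).extendOfNorm (R : E →ₗ[ℂ] E)
  have hU : ∀ t w, U t (R w) = e t w := fun t w =>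
    LinearMap.extendOfNorm_eq hdense ⟨1, fun x => by
      rw [one_mul]; exact (hnorm t x).le⟩ w
  have hiso : ∀ t u, ‖U t u‖ = ‖u‖ := by
    intro t u
    refine hdense.induction_on (p := fun u => ‖U t u‖ = ‖u‖) u
      (isClosed_eq (U t).continuous.norm continuous_norm) fun w => ?_
    rw [hU, hnorm]
  have hadd : ∀ s t, U (s + t) = U s * U t := by
    intro s t
    refine ContinuousLinearMap.coeFn_injective (hdense.equalizer (U (s + t)).continuous
      (U s * U t).continuous ?_)
    funext w
    change U (s + t) (R w) = U s (U t (R w))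
    rw [hU, hU]
    refine hdense.induction_on (p := fun w => e (s + t) w = U s (e t w)) w
      (isClosed_eq (e (s + t)).continuous ((U s).continuous.comp (e t).continuous)) fun w => ?_
    have hc : ∀ s t w, e s (e t w) = R (e (s + t) w) := fun s t w =>
      congrArg (fun T : E →L[ℂ] E => T w) (hmul s t)
    have h1 := hc s t w
    have h2 := hc t 0 w
    have h3 := hc (s + t) 0 w
    rw [he0, add_zero] at h2 h3
    rw [h3, h2, hU, ← h1]
  have hzero : U 0 = 1 := by
    refine ContinuousLinearMap.coeFn_injective (hdense.equalizer (U 0).continuous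
      (1 : E →L[ℂ] E).continuous ?_)
    funext w
    change U 0 (R w) = R w
    rw [hU, he0]
  have hlip : ∀ t s w, ‖e t w - e s w‖ ≤ |t - s| * ‖w‖ := by
    intro t s w
    have h1 : ‖e t - e s‖ ≤ |t - s| := by
      simp only [he]
      rw [← cfc_sub _ _ R (hcont t) (hcont s)]
      refine norm_cfc_le (abs_nonneg _) fun r _ => ?_
      have h2 : stoneFun t r - stoneFun s r = r * Complex.exp (-(Complex.I * (s * (r⁻¹).re : ℝ))) *
          (Complex.exp (-(Complex.I * ((t - s) * (r⁻¹).re : ℝ))) - 1) := by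
        rw [mul_sub, mul_assoc, ← Complex.exp_add, mul_one, stoneFun, stoneFun]
        congr 3
        push_cast
        ring
      rw [h2, norm_mul, norm_mul, norm_exp_neg_I_mul, mul_one]
      have h3 := norm_exp_neg_I_sub_one_le ((t - s) * (r⁻¹).re)
      rw [abs_mul] at h3
      have h4 := abs_re_inv_mul_le r
      calc _ ≤ ‖r‖ * (|t - s| * |(r⁻¹).re|) := by gcongr
        _ = |t - s| * (|(r⁻¹).re| * ‖r‖) := by ring
        _ ≤ _ := mul_le_of_le_one_right (abs_nonneg _) h4
    exact ((e t - e s).le_opNorm w).trans (by gcongr)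
  -- The second factor R makes the quadratic Taylor remainder bounded, since |λ r|² ≤ 1.
  have hquad : ∀ t w, ‖e t (R w) - R (R w) +
      (t : ℂ) • Complex.I • (R w - Complex.I • R (R w))‖ ≤ 2 * |t| ^ 2 * ‖w‖ := by
    intro t w
    have h1 : ‖e t * R - R * R + ((t : ℂ) * Complex.I) • (R - Complex.I • (R * R))‖ ≤
        2 * |t| ^ 2 := by
      have h2 : e t * R - R * R + ((t : ℂ) * Complex.I) • (R - Complex.I • (R * R)) =
          cfc (fun r : ℂ => stoneFun t r * r - r * r +
            ((t : ℂ) * Complex.I) • (r - Complex.I • (r * r))) R := by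
        have c1 := hcont t
        have c0 : ContinuousOn (fun r : ℂ => r) (spectrum ℂ R) := continuousOn_id
        rw [cfc_add R (fun r : ℂ => stoneFun t r * r - r * r)
            (fun r : ℂ => ((t : ℂ) * Complex.I) • (r - Complex.I • (r * r)))
            ((c1.mul c0).sub (c0.mul c0)),
          cfc_sub (fun r : ℂ => stoneFun t r * r) (fun r : ℂ => r * r) R (c1.mul c0) (c0.mul c0),
          cfc_mul (stoneFun t) (fun r : ℂ => r) R c1 c0,
          cfc_mul (fun r : ℂ => r) (fun r : ℂ => r) R c0 c0,
          cfc_smul ((t : ℂ) * Complex.I) (fun r : ℂ => r - Complex.I • (r * r)) R,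
          cfc_sub (fun r : ℂ => r) (fun r : ℂ => Complex.I • (r * r)) R c0,
          cfc_smul Complex.I (fun r : ℂ => r * r) R (c0.mul c0),
          cfc_mul (fun r : ℂ => r) (fun r : ℂ => r) R c0 c0, cfc_id' ℂ R]
      rw [h2]
      refine norm_cfc_le (by positivity) fun r hr => ?_
      have h3 : stoneFun t r * r - r * r + ((t : ℂ) * Complex.I) • (r - Complex.I • (r * r)) =
          r * r * (Complex.exp (-(Complex.I * (t * (r⁻¹).re : ℝ))) - 1 +
            Complex.I * (t * (r⁻¹).re : ℝ)) := by
        rw [smul_eq_mul, smul_eq_mul, ← hspec r hr, stoneFun]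
        push_cast
        ring
      rw [h3, norm_mul, norm_mul]
      have h4 := norm_exp_neg_I_sub_one_add_le (t * (r⁻¹).re)
      rw [abs_mul] at h4
      have h5 := abs_re_inv_mul_le r
      calc _ ≤ ‖r‖ * ‖r‖ * (2 * (|t| * |(r⁻¹).re|) ^ 2) := by gcongr
        _ = 2 * |t| ^ 2 * (|(r⁻¹).re| * ‖r‖) ^ 2 := by ring
        _ ≤ _ := mul_le_of_le_one_right (by positivity) (pow_le_one₀ (by positivity) h5)
    have h6 := ((e t * R - R * R +
      ((t : ℂ) * Complex.I) • (R - Complex.I • (R * R))).le_opNorm w).trans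
      (mul_le_mul_of_nonneg_right h1 (norm_nonneg w))
    refine le_trans (le_of_eq ?_) h6
    congr 1
    rw [← mul_smul]
    rfl
  have hderiv : ∀ w, HasDerivAt (fun t => e t w) (-(Complex.I • (w - Complex.I • R w))) 0 := by
    intro w
    rw [hasDerivAt_iff_isLittleO, Asymptotics.isLittleO_iff]
    intro c hc
    let X : E →L[ℂ] E := Complex.I • (1 - Complex.I • R)
    have hX : ∀ w, X w = Complex.I • (w - Complex.I • R w) := fun w => rfl
    -- Split w = R w' + (w - R w'): the quadratic bound treats the first part, the Lipschitz bound
    -- the small second one. The two tolerances are chosen so that each contributes at most c|t|/2.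
    obtain ⟨w', hw'⟩ := hdense.exists_dist_lt w
      (show 0 < c / (2 * (1 + ‖X‖)) by positivity)
    rw [dist_eq_norm] at hw'
    have hδ : 0 < c / (4 * (1 + ‖w'‖)) := by positivity
    filter_upwards [Metric.ball_mem_nhds (0 : ℝ) hδ] with t ht
    rw [mem_ball_zero_iff, Real.norm_eq_abs] at ht
    have h1 : e t w - e 0 w - (t - 0) • -(Complex.I • (w - Complex.I • R w)) =
        (e t (w - R w') - e 0 (w - R w')) + (t : ℂ) • X (w - R w') +
        (e t (R w') - R (R w') + (t : ℂ) • Complex.I • (R w' - Complex.I • R (R w'))) := by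
      rw [← hX, ← hX, he0, sub_zero, smul_neg, map_sub, map_sub, map_sub, smul_sub, sub_neg_eq_add,
        Complex.coe_smul, Complex.coe_smul]
      abel
    rw [h1]
    refine (norm_add_le _ _).trans ?_
    have h2 := (norm_add_le (e t (w - R w') - e 0 (w - R w')) ((t : ℂ) • X (w - R w')))
    have h3 := hlip t 0 (w - R w')
    have h4 := X.le_opNorm (w - R w')
    have h5 := hquad t w'
    rw [norm_smul, Complex.norm_real, Real.norm_eq_abs] at h2
    rw [sub_zero] at h3
    have h6 : |t| * ‖w - R w'‖ + |t| * (‖X‖ * ‖w - R w'‖) ≤ |t| * (c / 2) := by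
      have : (1 + ‖X‖) * ‖w - R w'‖ ≤ c / 2 := by
        rw [lt_div_iff₀ (by positivity)] at hw'
        linarith
      calc _ = |t| * ((1 + ‖X‖) * ‖w - R w'‖) := by ring
        _ ≤ _ := by gcongr
    have h7 : 2 * |t| ^ 2 * ‖w'‖ ≤ |t| * (c / 2) := by
      rw [lt_div_iff₀ (by positivity)] at ht
      have : |t| * ‖w'‖ ≤ c / 4 := by nlinarith [abs_nonneg t]
      nlinarith [abs_nonneg t]
    rw [sub_zero, Real.norm_eq_abs]
    have h8 : |t| * ‖X (w - R w')‖ ≤ |t| * (‖X‖ * ‖w - R w'‖) := by gcongr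
    linarith
  have hunit : ∀ t, U t ∈ unitary (E →L[ℂ] E) := by
    intro t
    have h1 : star (U t) * U t = 1 :=
      (ContinuousLinearMap.norm_map_iff_adjoint_comp_self (U t)).1 (hiso t)
    have h2 : U t * U (-t) = 1 := by rw [← hadd, add_neg_cancel, hzero]
    have h3 : star (U t) = U (-t) := by
      rw [← mul_one (star (U t)), ← h2, ← mul_assoc, h1, one_mul]
    exact Unitary.mem_iff.2 ⟨h1, by rw [h3, h2]⟩
  refine ⟨U, hzero, hadd, hunit, ?_, ?_⟩
  · intro u
    rw [Metric.continuous_iff]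
    intro s ε hε
    obtain ⟨w, hw⟩ := hdense.exists_dist_lt u (show 0 < ε / 4 by positivity)
    rw [dist_eq_norm] at hw
    refine ⟨ε / (4 * (1 + ‖w‖)), by positivity, fun t ht => ?_⟩
    rw [Real.dist_eq, lt_div_iff₀ (by positivity)] at ht
    rw [dist_eq_norm]
    have h1 : U t u - U s u = U t (u - R w) - U s (u - R w) + (e t w - e s w) := by
      rw [map_sub, map_sub, hU, hU]
      abel
    rw [h1]
    have h2 := norm_add_le (U t (u - R w) - U s (u - R w)) (e t w - e s w)
    have h3 := norm_sub_le (U t (u - R w)) (U s (u - R w))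
    rw [hiso, hiso] at h3
    have h4 := hlip t s w
    have h5 : |t - s| * ‖w‖ ≤ ε / 4 := by nlinarith [abs_nonneg (t - s)]
    linarith
  · intro u v
    have hfwd : ∀ u v, (u, v) ∈ A.graph →
        HasDerivAt (fun t => U t u) (-(Complex.I • v)) 0 := by
      intro u v huv
      have h1 := hR' u v huv
      have h2 := hderiv (v + Complex.I • u)
      rw [h1, add_sub_cancel_right] at h2
      refine h2.congr_of_eventuallyEq (Filter.Eventually.of_forall fun t => ?_)
      change U t u = e t (v + Complex.I • u)
      rw [← hU, h1]
    -- Conversely, differentiating ⟨U t u, x⟩ = ⟨u, U(-t) x⟩ for x in D(A) shows that u lies in the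
    -- domain of the adjoint of A, which is A.
    refine ⟨hfwd u v, fun h => hA.mem_graph_of_inner fun x => ?_⟩
    have h1 : HasDerivAt (fun t => inner ℂ (U t u) (x : E)) (inner ℂ (-(Complex.I • v)) (x : E)) 0 := by
      simpa using h.inner ℂ (hasDerivAt_const (0 : ℝ) (x : E))
    have h2 : ∀ t, inner ℂ (U t u) (x : E) = inner ℂ u (U (-t) x) := fun t => by
      have h3 : U t (U (-t) x) = x := by
        have := congrArg (fun T : E →L[ℂ] E => T x) (hadd t (-t))
        rw [add_neg_cancel, hzero] at this
        exact this.symm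
      conv_lhs => rw [← h3]
      exact (ContinuousLinearMap.inner_map_map_iff_adjoint_comp_self (U t)).2
        (Unitary.star_mul_self_of_mem (hunit t)) _ _
    have h4 : HasDerivAt (fun t : ℝ => U (-t) x) (Complex.I • A x) 0 := by
      have h5 := hfwd _ _ (A.mem_graph x)
      have h6 := HasDerivAt.scomp (0 : ℝ) (h := fun t : ℝ => -t) (h' := -1)
        (by simpa using h5) (hasDerivAt_neg (0 : ℝ))
      simpa [Function.comp_def] using h6
    have h7 : HasDerivAt (fun t => inner ℂ (U t u) (x : E)) (inner ℂ u (Complex.I • A x)) 0 := by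
      simp only [h2]
      have h9 := (hasDerivAt_const (0 : ℝ) u).inner ℂ h4
      rwa [inner_zero_left, add_zero] at h9
    have h8 := h1.unique h7
    rw [inner_neg_left, inner_smul_left, inner_smul_right, Complex.conj_I, neg_mul, neg_neg] at h8
    exact mul_left_cancel₀ Complex.I_ne_zero h8

end Stone

end

end OrthStrichartz

namespace OrthStrichartz

noncomputable section

/-! ### Properties of the unitary group -/

section Group

variable {E : Type*} [NormedAddCommGroup E] [InnerProductSpace ℂ E] [CompleteSpace E]
  {A : E →ₗ.[ℂ] E} {U : ℝ → E →L[ℂ] E}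

theorem isUnitaryGroupOf_propagator (hA : IsSelfAdjoint A) :
    IsUnitaryGroupOf (propagator A) A := by
  have h := hA.exists_isUnitaryGroupOf
  rw [propagator, dif_pos h]
  exact h.choose_spec

namespace IsUnitaryGroupOf

theorem add_apply (hU : IsUnitaryGroupOf U A) (s t : ℝ) (u : E) : U (s + t) u = U s (U t u) := by
  rw [hU.add]; rfl

theorem zero_apply (hU : IsUnitaryGroupOf U A) (u : E) : U 0 u = u := by
  rw [hU.zero]; rfl

theorem apply_neg_apply (hU : IsUnitaryGroupOf U A) (t : ℝ) (u : E) : U t (U (-t) u) = u := by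
  rw [← hU.add_apply, add_neg_cancel, hU.zero_apply]

theorem inner_map_map (hU : IsUnitaryGroupOf U A) (t : ℝ) (u v : E) :
    inner ℂ (U t u) (U t v) = inner ℂ u v :=
  (ContinuousLinearMap.inner_map_map_iff_adjoint_comp_self (U t)).2
    (Unitary.star_mul_self_of_mem (hU.unitary t)) u v

theorem norm_map (hU : IsUnitaryGroupOf U A) (t : ℝ) (u : E) : ‖U t u‖ = ‖u‖ :=
  (ContinuousLinearMap.norm_map_iff_adjoint_comp_self (U t)).2
    (Unitary.star_mul_self_of_mem (hU.unitary t)) u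

theorem inner_neg_map (hU : IsUnitaryGroupOf U A) (t : ℝ) (u v : E) :
    inner ℂ (U (-t) u) v = inner ℂ u (U t v) := by
  rw [← hU.inner_map_map t, hU.apply_neg_apply]

theorem continuous_apply (hU : IsUnitaryGroupOf U A) {α : Type*} [TopologicalSpace α]
    {τ : α → ℝ} {f : α → E} (hτ : Continuous τ) (hf : Continuous f) :
    Continuous fun x => U (τ x) (f x) := by
  rw [continuous_iff_continuousAt]
  intro x
  rw [ContinuousAt, tendsto_iff_norm_sub_tendsto_zero]
  have h1 : Filter.Tendsto (fun y => ‖f y - f x‖ + ‖U (τ y) (f x) - U (τ x) (f x)‖) (nhds x)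
      (nhds 0) := by
    have h2 := tendsto_iff_norm_sub_tendsto_zero.1 (hf.tendsto x)
    have h3 := tendsto_iff_norm_sub_tendsto_zero.1 (((hU.continuous (f x)).comp hτ).tendsto x)
    simpa using h2.add h3
  refine squeeze_zero (fun _ => norm_nonneg _) (fun y => ?_) h1
  have h4 : U (τ y) (f y) - U (τ x) (f x) =
      U (τ y) (f y - f x) + (U (τ y) (f x) - U (τ x) (f x)) := by
    rw [map_sub]; abel
  rw [h4, ← hU.norm_map (τ y) (f y - f x)]
  exact norm_add_le _ _

theorem map_mem_graph (hU : IsUnitaryGroupOf U A) (t : ℝ) {u v : E} (h : (u, v) ∈ A.graph) :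
    (U t u, U t v) ∈ A.graph := by
  rw [hU.generator] at h ⊢
  have h2 : HasDerivAt (fun s => U t (U s u)) (U t (-(Complex.I • v))) 0 := by
    simpa [Function.comp_def] using
      ((U t).restrictScalars ℝ).hasFDerivAt.comp_hasDerivAt (0 : ℝ) h
  rw [map_neg, map_smul] at h2
  refine h2.congr_of_eventuallyEq (Filter.Eventually.of_forall fun s => ?_)
  change U s (U t u) = U t (U s u)
  rw [← hU.add_apply, ← hU.add_apply, add_comm]

theorem hasDerivAt (hU : IsUnitaryGroupOf U A) (t : ℝ) {u v : E} (h : (u, v) ∈ A.graph) :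
    HasDerivAt (fun s => U s u) (-(Complex.I • U t v)) t := by
  have h1 := (hU.generator _ _).1 (hU.map_mem_graph t h)
  have h2 : HasDerivAt (fun s => U (s - t) (U t u)) (-(Complex.I • U t v)) t :=
    HasDerivAt.comp_sub_const t t (by rwa [sub_self])
  refine h2.congr_of_eventuallyEq (Filter.Eventually.of_forall fun s => ?_)
  change U s u = U (s - t) (U t u)
  rw [← hU.add_apply, sub_add_cancel]

/-- Averaging an orbit over time puts it in the domain of the generator: U t only shifts the
interval of integration, so the derivative at 0 is the difference of the endpoint values. -/
theorem integral_mem_graph (hU : IsUnitaryGroupOf U A) (ε : ℝ) (u : E) :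
    (∫ s in (0 : ℝ)..ε, U s u, Complex.I • (U ε u - u)) ∈ A.graph := by
  have hc := hU.continuous u
  rw [hU.generator]
  have h1 : ∀ t, U t (∫ s in (0 : ℝ)..ε, U s u) =
      (∫ s in (0 : ℝ)..(t + ε), U s u) - ∫ s in (0 : ℝ)..t, U s u := by
    intro t
    rw [← ContinuousLinearMap.intervalIntegral_comp_comm _ (hc.intervalIntegrable _ _)]
    simp only [← hU.add_apply]
    rw [intervalIntegral.integral_comp_add_left (fun s => U s u), add_zero,
      intervalIntegral.integral_interval_sub_left (hc.intervalIntegrable _ _)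
        (hc.intervalIntegrable _ _)]
  simp only [h1]
  have h2 : HasDerivAt (fun t => ∫ s in (0 : ℝ)..(t + ε), U s u) (U ε u) 0 := by
    have := intervalIntegral.integral_hasDerivAt_right (hc.intervalIntegrable 0 (0 + ε))
      hc.stronglyMeasurable.stronglyMeasurableAtFilter hc.continuousAt
    have h3 := HasDerivAt.comp_add_const (0 : ℝ) ε this
    rwa [zero_add] at h3
  have h3 : HasDerivAt (fun t => ∫ s in (0 : ℝ)..t, U s u) (U 0 u) 0 :=
    intervalIntegral.integral_hasDerivAt_right (hc.intervalIntegrable 0 0)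
      hc.stronglyMeasurable.stronglyMeasurableAtFilter hc.continuousAt
  have h4 := h2.sub h3
  rw [hU.zero_apply] at h4
  rwa [smul_smul, Complex.I_mul_I, neg_one_smul, neg_neg]

theorem commute_resolvent (hU : IsUnitaryGroupOf U A) {B : E →L[ℂ] E} (hB : IsResolvent A B)
    (t : ℝ) : Commute B (U t) := by
  ext w
  change B (U t w) = U t (B w)
  have h1 := hU.map_mem_graph t (hB.1 w)
  obtain ⟨y, hy1, hy2⟩ := (LinearPMap.mem_graph_iff A).1 h1
  have h2 := hB.2 y
  simp only at hy1 hy2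
  rw [hy1, hy2, map_sub, add_sub_cancel] at h2
  exact h2

end IsUnitaryGroupOf

end Group

/-! ### Powers of a nonnegative operator through its resolvent -/

section Power

variable {E : Type*} [NormedAddCommGroup E] [InnerProductSpace ℂ E] [CompleteSpace E]
  {A : E →ₗ.[ℂ] E} {B : E →L[ℂ] E}

theorem IsResolvent.isSelfAdjoint (hB : IsResolvent A B) (hA : IsSelfAdjoint A) :
    IsSelfAdjoint B := by
  rw [ContinuousLinearMap.isSelfAdjoint_iff_isSymmetric]
  intro u v
  have h := hA.inner_graph (hB.1 u) (hB.1 v)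
  rw [inner_sub_left, inner_sub_right] at h
  change inner ℂ (B u) v = inner ℂ u (B v)
  linear_combination -h

/-- Since AB = 1 - B, positivity of A gives Re ⟨(1 - B)u, Bu⟩ ≥ 0, from which both B ≥ 0 and 1 - B ≥
0 follow. -/
theorem IsResolvent.spectrum_subset (hB : IsResolvent A B) (hA : IsSelfAdjoint A)
    (hpos : ∀ u : A.domain, 0 ≤ (inner ℂ (A u) (u : E)).re) :
    spectrum ℝ B ⊆ Set.Icc 0 1 := by
  have hsa := hB.isSelfAdjoint hA
  have hre : ∀ u, 0 ≤ (inner ℂ (u - B u) (B u)).re := by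
    intro u
    obtain ⟨y, hy1, hy2⟩ := (LinearPMap.mem_graph_iff A).1 (hB.1 u)
    have := hpos y
    simp only at hy1 hy2
    rwa [hy1, hy2] at this
  have h0 : 0 ≤ B := by
    rw [ContinuousLinearMap.nonneg_iff_isPositive, ContinuousLinearMap.isPositive_def']
    refine ⟨hsa, fun u => ?_⟩
    have h1 : inner ℂ (B u) u = inner ℂ u (B u) :=
      (ContinuousLinearMap.isSelfAdjoint_iff_isSymmetric.1 hsa) u u
    have h2 := hre u
    rw [inner_sub_left, Complex.sub_re, inner_self_eq_norm_sq_to_K] at h2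
    rw [ContinuousLinearMap.reApplyInnerSelf_apply, h1]
    have h3 : (((‖B u‖ : ℝ) : ℂ) ^ 2).re = ‖B u‖ ^ 2 := by norm_cast
    change 0 ≤ (inner ℂ u (B u)).re
    have h4 : 0 ≤ ‖B u‖ ^ 2 := by positivity
    change 0 ≤ _ - (((‖B u‖ : ℝ) : ℂ) ^ 2).re at h2
    linarith
  have h1 : 0 ≤ 1 - B := by
    rw [ContinuousLinearMap.nonneg_iff_isPositive, ContinuousLinearMap.isPositive_def']
    refine ⟨(IsSelfAdjoint.one _).sub hsa, fun u => ?_⟩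
    have h2 := hre u
    rw [ContinuousLinearMap.reApplyInnerSelf_apply]
    change 0 ≤ (inner ℂ (u - B u) u).re
    have h3 : inner ℂ (u - B u) u = inner ℂ (u - B u) (B u) + inner ℂ (u - B u) (u - B u) := by
      rw [← inner_add_right, add_sub_cancel]
    rw [h3, Complex.add_re]
    exact add_nonneg h2 (inner_self_nonneg (𝕜 := ℂ) (x := u - B u))
  intro x hx
  refine ⟨spectrum_nonneg_of_nonneg h0 hx, ?_⟩
  have h2 : B ≤ algebraMap ℝ (E →L[ℂ] E) 1 := by
    rw [map_one]
    exact sub_nonneg.1 h1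
  exact (le_algebraMap_iff_spectrum_le hsa).1 h2 x hx

/-- `b ↦ b ^ s⁺ (1 - b) ^ s⁻`. -/
def powerFun (s b : ℝ) : ℝ := b ^ max s 0 * (1 - b) ^ max (-s) 0

theorem continuous_powerFun (s : ℝ) : Continuous (powerFun s) :=
  (Real.continuous_rpow_const (le_max_right _ _)).mul
    ((Real.continuous_rpow_const (le_max_right _ _)).comp (continuous_const.sub continuous_id))

/-- The two functions defining the graph of A^s have no common zero on [0, 1], so p(B)² + q(B)² is
invertible. -/
theorem powerFun_sq_add_sq_pos {s b : ℝ} (hb : b ∈ Set.Icc (0 : ℝ) 1) :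
    0 < powerFun s b ^ 2 + powerFun (-s) b ^ 2 := by
  obtain ⟨h0, h1⟩ := hb
  have h : powerFun s b ≠ 0 ∨ powerFun (-s) b ≠ 0 := by
    have key : ∀ s : ℝ, 0 ≤ s → powerFun s b ≠ 0 ∨ powerFun (-s) b ≠ 0 := by
      intro s hs
      rw [powerFun, powerFun, neg_neg, max_eq_left hs, max_eq_right (neg_nonpos.2 hs),
        Real.rpow_zero, Real.rpow_zero, mul_one, one_mul]
      rcases h0.eq_or_lt with h | h
      · right
        rw [← h, sub_zero, Real.one_rpow]
        exact one_ne_zero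
      · exact Or.inl (Real.rpow_pos_of_pos h _).ne'
    rcases le_total 0 s with hs | hs
    · exact key s hs
    · have := key (-s) (neg_nonneg.2 hs)
      rw [neg_neg] at this
      exact this.symm
  rcases h with h | h <;> positivity

/-- A real power of f(B) is a factor of an integer power of f(B), which is injective by iteration.
-/
theorem injective_cfc_rpow (hsa : IsSelfAdjoint B) (f : ℝ → ℝ) (hf : Continuous f)
    (hf0 : ∀ x ∈ spectrum ℝ B, 0 ≤ f x) (hinj : ∀ u, cfc f B u = 0 → u = 0) {a : ℝ} (ha : 0 ≤ a)
    {u : E} (hu : cfc (fun b => f b ^ a) B u = 0) : u = 0 := by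
  obtain ⟨k, hk⟩ := exists_nat_ge a
  have h1 : cfc f B ^ (k + 1) = cfc (fun b => f b ^ ((k + 1 : ℕ) - a)) B *
      cfc (fun b => f b ^ a) B := by
    have hk' : 0 ≤ ((k + 1 : ℕ) : ℝ) - a := by push_cast; linarith
    rw [← cfc_mul (fun b => f b ^ ((k + 1 : ℕ) - a)) (fun b => f b ^ a) B
      ((Real.continuous_rpow_const hk').comp hf).continuousOn
      ((Real.continuous_rpow_const ha).comp hf).continuousOn, ← cfc_pow f (k + 1) B hf.continuousOn]
    refine cfc_congr fun b hb => ?_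
    rw [← Real.rpow_add_of_nonneg (hf0 b hb) hk' ha, sub_add_cancel, Real.rpow_natCast]
  have h2 : (cfc f B ^ (k + 1)) u = 0 := by
    rw [h1]
    change cfc (fun b => f b ^ ((k + 1 : ℕ) - a)) B (cfc (fun b => f b ^ a) B u) = 0
    rw [hu, map_zero]
  have h3 : ∀ n : ℕ, ∀ u, (cfc f B ^ n) u = 0 → u = 0 := by
    intro n
    induction n with
    | zero => intro u hu; simpa using hu
    | succ n ih =>
      intro u hu
      rw [pow_succ'] at hu
      exact ih u (hinj _ hu)
  exact h3 _ u h2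

/-- `p(B)` for `p b = b ^ s⁺ (1 - b) ^ s⁻` and `B = (1 + A)⁻¹`. -/
def powerOp (A : E →ₗ.[ℂ] E) (s : ℝ) : E →L[ℂ] E := cfc (powerFun s) (resolventOne A)

theorem powerOp_commute (A : E →ₗ.[ℂ] E) (s t : ℝ) : Commute (powerOp A s) (powerOp A t) :=
  cfc_commute_cfc _ _ _

theorem commute_powerOp (hA : IsSelfAdjoint A) (hB : IsResolvent A (resolventOne A))
    {W : E →L[ℂ] E} (hW : Commute (resolventOne A) W) (s : ℝ) : Commute (powerOp A s) W :=
  (hB.isSelfAdjoint hA).commute_cfc hW _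

/-- B is injective as an inverse, and 1 - B = AB is injective when A is; p(B) is a product of powers
of these two. For s = 0 it is the identity, which needs no injectivity of A. -/
theorem powerOp_injective (hA : IsSelfAdjoint A)
    (hpos : ∀ u : A.domain, 0 ≤ (inner ℂ (A u) (u : E)).re)
    {s : ℝ} (hker : s ≠ 0 → ∀ u : A.domain, A u = 0 → (u : E) = 0) {u : E}
    (hu : powerOp A s u = 0) : u = 0 := by
  have hB := isResolvent_resolventOne hA hpos
  have hsa := hB.isSelfAdjoint hA
  have hspec := hB.spectrum_subset hA hpos
  rcases eq_or_ne s 0 with rfl | hs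
  · have h1 : powerFun 0 = 1 := by
      funext b
      simp [powerFun]
    rw [powerOp, h1, cfc_one ℝ (resolventOne A) hsa] at hu
    exact hu
  have hB1 : ∀ u, resolventOne A u = 0 → u = 0 := by
    intro u hu
    have := hB.1 u
    rw [hu, sub_zero] at this
    exact LinearPMap.graph_fst_eq_zero_snd A this rfl
  have hB2 : ∀ u, u - resolventOne A u = 0 → u = 0 := by
    intro u hu
    have h1 := hB.1 u
    obtain ⟨y, hy1, hy2⟩ := (LinearPMap.mem_graph_iff A).1 h1
    simp only at hy1 hy2
    have h2 := hker hs y (hy2.trans hu)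
    exact hB1 u (hy1 ▸ h2)
  rw [powerOp] at hu
  have h1 : cfc (powerFun s) (resolventOne A) =
      cfc (fun b : ℝ => b ^ max s 0) (resolventOne A) *
      cfc (fun b : ℝ => (1 - b) ^ max (-s) 0) (resolventOne A) :=
    cfc_mul (fun b : ℝ => b ^ max s 0) (fun b : ℝ => (1 - b) ^ max (-s) 0) _
      (Real.continuous_rpow_const (le_max_right _ _)).continuousOn
      ((Real.continuous_rpow_const (le_max_right _ _)).comp
        (continuous_const.sub continuous_id)).continuousOn
  rw [h1] at hu
  have h2 := injective_cfc_rpow hsa (fun b => b) continuous_id (fun x hx => (hspec hx).1)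
    (by rw [cfc_id' ℝ (resolventOne A)]; exact hB1) (le_max_right _ _) hu
  refine injective_cfc_rpow hsa (fun b => 1 - b) (continuous_const.sub continuous_id)
    (fun x hx => sub_nonneg.2 (hspec hx).2) ?_ (le_max_right _ _) h2
  rw [cfc_sub (fun _ : ℝ => (1 : ℝ)) (fun b => b) (resolventOne A), cfc_id' ℝ (resolventOne A),
    cfc_const_one ℝ (resolventOne A)]
  exact hB2

theorem mem_power_graph_iff (hA : IsSelfAdjoint A)
    (hpos : ∀ u : A.domain, 0 ≤ (inner ℂ (A u) (u : E)).re)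
    {s : ℝ} (hker : s ≠ 0 → ∀ u : A.domain, A u = 0 → (u : E) = 0) {x y : E} :
    (x, y) ∈ (power A s).graph ↔ ∃ w, powerOp A s w = x ∧ powerOp A (-s) w = y := by
  have h1 : power A s = (LinearMap.range ((powerOp A s : E →ₗ[ℂ] E).prod
      (powerOp A (-s) : E →ₗ[ℂ] E))).toLinearPMap := by
    have h2 : powerFun (-s) = fun b : ℝ => b ^ max (-s) 0 * (1 - b) ^ max s 0 := by
      funext b
      rw [powerFun, neg_neg]
    rw [powerOp, powerOp, h2]
    rfl
  rw [h1, Submodule.toLinearPMap_graph_eq]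
  · rw [LinearMap.mem_range]
    exact exists_congr fun w => Prod.mk.injEq _ _ _ _ ▸ Iff.rfl
  · rintro ⟨x, y⟩ hxy hx
    obtain ⟨w, hw⟩ := hxy
    have hw1 : powerOp A s w = x := congrArg Prod.fst hw
    have hw2 : powerOp A (-s) w = y := congrArg Prod.snd hw
    have h2 : w = 0 := powerOp_injective hA hpos hker (hw1.trans hx)
    change y = 0
    rw [← hw2, h2, map_zero]

/-- Replacing s by -s exchanges p and q, so the graph is transposed and A^{-s} is the inverse of
A^s. -/
theorem mem_power_neg_graph_iff (hA : IsSelfAdjoint A)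
    (hpos : ∀ u : A.domain, 0 ≤ (inner ℂ (A u) (u : E)).re)
    {s : ℝ} (hker : s ≠ 0 → ∀ u : A.domain, A u = 0 → (u : E) = 0) {x y : E} :
    (x, y) ∈ (power A (-s)).graph ↔ (y, x) ∈ (power A s).graph := by
  rw [mem_power_graph_iff hA hpos (fun h => hker (neg_ne_zero.1 h)),
    mem_power_graph_iff hA hpos hker, neg_neg]
  simp only [and_comm]

/-- The graph of `A ^ s` is closed and determined by a commutation relation. -/
theorem mem_power_graph_of_eq (hA : IsSelfAdjoint A)
    (hpos : ∀ u : A.domain, 0 ≤ (inner ℂ (A u) (u : E)).re)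
    {s : ℝ} (hker : s ≠ 0 → ∀ u : A.domain, A u = 0 → (u : E) = 0) {x y : E}
    (h : powerOp A (-s) x = powerOp A s y) : (x, y) ∈ (power A s).graph := by
  rw [mem_power_graph_iff hA hpos hker]
  have hB := isResolvent_resolventOne hA hpos
  have hsa := hB.isSelfAdjoint hA
  have hspec := hB.spectrum_subset hA hpos
  set P := powerOp A s
  set Q := powerOp A (-s)
  have cP := (continuous_powerFun s).continuousOn (s := spectrum ℝ (resolventOne A))
  have cQ := (continuous_powerFun (-s)).continuousOn (s := spectrum ℝ (resolventOne A))
  -- With M = (P² + Q²)⁻¹ and Qx = Py, the vector w = M(Px + Qy) solves Pw = x and Qw = y.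
  let m : ℝ → ℝ := fun b => (powerFun s b ^ 2 + powerFun (-s) b ^ 2)⁻¹
  have cm : ContinuousOn m (spectrum ℝ (resolventOne A)) :=
    ((cP.pow 2).add (cQ.pow 2)).inv₀ fun b hb => (powerFun_sq_add_sq_pos (hspec hb)).ne'
  let M := cfc m (resolventOne A)
  have hM : M * (P * P + Q * Q) = 1 := by
    simp only [M, P, Q, powerOp]
    rw [← cfc_mul _ _ _ cP cP, ← cfc_mul _ _ _ cQ cQ, ← cfc_add _ (fun b => powerFun s b * powerFun s b)
        (fun b => powerFun (-s) b * powerFun (-s) b) (cP.mul cP) (cQ.mul cQ),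
      ← cfc_mul m (fun b => powerFun s b * powerFun s b + powerFun (-s) b * powerFun (-s) b) _ cm
        ((cP.mul cP).add (cQ.mul cQ)), ← cfc_const_one ℝ (resolventOne A)]
    refine cfc_congr fun b hb => ?_
    have := (powerFun_sq_add_sq_pos (s := s) (hspec hb)).ne'
    simp only [m]
    rw [← pow_two, ← pow_two, inv_mul_cancel₀ this]
  have hMP : ∀ z, P (M z) = M (P z) := fun z =>
    congrArg (fun T : E →L[ℂ] E => T z) (cfc_commute_cfc (powerFun s) m (resolventOne A)).eq
  have hMQ : ∀ z, Q (M z) = M (Q z) := fun z =>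
    congrArg (fun T : E →L[ℂ] E => T z) (cfc_commute_cfc (powerFun (-s)) m (resolventOne A)).eq
  have hPQ : ∀ z, P (Q z) = Q (P z) := fun z =>
    congrArg (fun T : E →L[ℂ] E => T z) (powerOp_commute A s (-s)).eq
  have hM' : ∀ z, M (P (P z) + Q (Q z)) = z := fun z =>
    congrArg (fun T : E →L[ℂ] E => T z) hM
  refine ⟨M (P x + Q y), ?_, ?_⟩
  · rw [hMP, map_add, hPQ y, ← h, hM']
  · rw [hMQ, map_add, ← hPQ x, h, hM']

end Power

end

end OrthStrichartz

namespace OrthStrichartz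

noncomputable section

/-! ### Time cutoffs on L²(ℝ; E) -/

section Cut

variable {E : Type*} [NormedAddCommGroup E] [InnerProductSpace ℂ E]

open Classical in
/-- Multiplication of functions in `L²(ℝ; E)` by the indicator function of `s`
(zero if `s` is not measurable). -/
def cut (s : Set ℝ) : Lp E 2 (volume : Measure ℝ) →ₗ[ℂ] Lp E 2 (volume : Measure ℝ) :=
  if hs : MeasurableSet s then
    { toFun := fun g => ((Lp.memLp g).indicator hs).toLp (s.indicator g)
      map_add' := fun g h => by
        rw [← MemLp.toLp_add, MemLp.toLp_eq_toLp_iff]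
        filter_upwards [Lp.coeFn_add g h] with t ht
        by_cases hts : t ∈ s
        · simpa only [Pi.add_apply, Set.indicator_of_mem hts] using ht
        · simp [hts]
      map_smul' := fun c g => by
        rw [RingHom.id_apply, ← MemLp.toLp_const_smul, MemLp.toLp_eq_toLp_iff]
        filter_upwards [Lp.coeFn_smul c g] with t ht
        by_cases hts : t ∈ s
        · simpa only [Pi.smul_apply, Set.indicator_of_mem hts] using ht
        · simp [hts] }
  else 0

theorem coeFn_cut {s : Set ℝ} (hs : MeasurableSet s) (g : Lp E 2 (volume : Measure ℝ)) :
    cut s g =ᵐ[volume] s.indicator g := by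
  rw [cut, dif_pos hs]
  exact ((Lp.memLp g).indicator hs).coeFn_toLp

theorem norm_cut_le {s : Set ℝ} (hs : MeasurableSet s) (g : Lp E 2 (volume : Measure ℝ)) :
    ‖cut s g‖ ≤ ‖g‖ := by
  refine Lp.norm_le_norm_of_ae_le ?_
  filter_upwards [coeFn_cut hs g] with t ht
  rw [ht]
  exact norm_indicator_le_norm_self _ _

theorem inner_cut_cut {s s' : Set ℝ} (hs : MeasurableSet s) (hs' : MeasurableSet s')
    (hd : Disjoint s s') (g h : Lp E 2 (volume : Measure ℝ)) :
    inner ℂ (cut s g) (cut s' h) = 0 := by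
  rw [L2.inner_def]
  refine integral_eq_zero_of_ae ?_
  filter_upwards [coeFn_cut hs g, coeFn_cut hs' h] with t ht ht'
  rw [ht, ht']
  by_cases hts : t ∈ s
  · have : t ∉ s' := Set.disjoint_left.1 hd hts
    simp [this]
  · simp [hts]

theorem inner_cut_left {s : Set ℝ} (hs : MeasurableSet s) (g h : Lp E 2 (volume : Measure ℝ)) :
    inner ℂ (cut s g) h = ∫ t in s, inner ℂ (g t) (h t) := by
  rw [L2.inner_def, ← integral_indicator hs]
  refine integral_congr_ae ?_
  filter_upwards [coeFn_cut hs g] with t ht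
  rw [ht]
  by_cases hts : t ∈ s <;> simp [hts]

theorem inner_cut_comm {s : Set ℝ} (hs : MeasurableSet s) (g h : Lp E 2 (volume : Measure ℝ)) :
    inner ℂ (cut s g) h = inner ℂ g (cut s h) := by
  rw [inner_cut_left hs, ← inner_conj_symm g, inner_cut_left hs, ← integral_conj]
  simp only [inner_conj_symm]

theorem cut_union {s s' : Set ℝ} (hs : MeasurableSet s) (hs' : MeasurableSet s')
    (hd : Disjoint s s') (g : Lp E 2 (volume : Measure ℝ)) :
    cut (s ∪ s') g = cut s g + cut s' g := by
  refine Lp.ext ?_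
  filter_upwards [coeFn_cut hs g, coeFn_cut hs' g, coeFn_cut (hs.union hs') g,
    Lp.coeFn_add (cut s g) (cut s' g)] with t h1 h2 h3 h4
  rw [h3, h4, Pi.add_apply, h1, h2, Set.indicator_union_of_disjoint hd]

theorem cut_empty (g : Lp E 2 (volume : Measure ℝ)) : cut ∅ g = 0 := by
  refine Lp.ext ?_
  filter_upwards [coeFn_cut MeasurableSet.empty g, Lp.coeFn_zero E 2 (volume : Measure ℝ)]
    with t h1 h2
  rw [h1, h2]; simp

end Cut

/-! ### From L²-in-time bounds to bounded operators -/

section TimeMap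

variable {E F : Type*} [NormedAddCommGroup E] [InnerProductSpace ℂ E]
  [NormedAddCommGroup F] [NormedSpace ℂ F]

theorem snd_eq_of_mem_graph {A : E →ₗ.[ℂ] E} {x y y' : E} (h : (x, y) ∈ A.graph)
    (h' : (x, y') ∈ A.graph) : y = y' := by
  have := A.graph.sub_mem h h'
  rw [Prod.mk_sub_mk, sub_self] at this
  exact sub_eq_zero.1 (LinearPMap.graph_fst_eq_zero_snd A this rfl)

/-- A bound `‖A (V u)‖_{L²_t E} ≤ C ‖u‖` defines a bounded operator `u ↦ A (V u)`. -/
theorem exists_timeMap {A : E →ₗ.[ℂ] E} (V : F →ₗ[ℂ] ℝ → E) (C : ℝ≥0)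
    (hV : ∀ u, TimeL2Bound A (V u) (C * ‖u‖ₑ)) :
    ∃ S : F →L[ℂ] Lp E 2 (volume : Measure ℝ), (∀ u, ‖S u‖ ≤ C * ‖u‖) ∧
      ∀ u, ∀ᵐ t, (V u t, S u t) ∈ A.graph := by
  choose G hG hGA hGC using hV
  have key : ∀ u, ∀ᵐ t, (V u t, (hG u).toLp (G u) t) ∈ A.graph := fun u => by
    filter_upwards [hGA u, (hG u).coeFn_toLp] with t h1 h2
    rwa [h2]
  have bound : ∀ u, ‖(hG u).toLp (G u)‖ ≤ C * ‖u‖ := fun u => by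
    rw [Lp.norm_toLp]
    refine ENNReal.toReal_le_of_le_ofReal (by positivity) ((hGC u).trans (le_of_eq ?_))
    rw [ENNReal.ofReal_mul (NNReal.coe_nonneg C), ofReal_norm, ENNReal.ofReal_coe_nnreal]
  let S : F →ₗ[ℂ] Lp E 2 (volume : Measure ℝ) :=
    { toFun := fun u => (hG u).toLp (G u)
      map_add' := fun u v => by
        refine Lp.ext ?_
        filter_upwards [key u, key v, key (u + v),
          Lp.coeFn_add ((hG u).toLp (G u)) ((hG v).toLp (G v))] with t h1 h2 h3 h4
        rw [h4]
        rw [map_add] at h3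
        exact snd_eq_of_mem_graph h3 (A.graph.add_mem h1 h2)
      map_smul' := fun c u => by
        refine Lp.ext ?_
        filter_upwards [key u, key (c • u), Lp.coeFn_smul c ((hG u).toLp (G u))] with t h1 h3 h4
        rw [RingHom.id_apply, h4]
        rw [map_smul] at h3
        exact snd_eq_of_mem_graph h3 (A.graph.smul_mem c h1) }
  exact ⟨S.mkContinuous C bound, bound, key⟩

end TimeMap

end

end OrthStrichartz

namespace OrthStrichartz

noncomputable section

/-! ### Duhamel's formula -/

section Duhamel

variable {E : Type*} [NormedAddCommGroup E] [InnerProductSpace ℂ E]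
  {H₀ H Y Z : E →ₗ.[ℂ] E} {U₀ U : ℝ → E →L[ℂ] E}

/-- The pairs `(f, g)` with `g t = A (U t f)` for almost every `t`. -/
def orbitGraph (U : ℝ → E →L[ℂ] E) (A : E →ₗ.[ℂ] E) :
    Submodule ℂ (E × Lp E 2 (volume : Measure ℝ)) where
  carrier := {x | ∀ᵐ t, (U t x.1, x.2 t) ∈ A.graph}
  zero_mem' := by
    filter_upwards [Lp.coeFn_zero E 2 (volume : Measure ℝ)] with t ht
    rw [Prod.snd_zero, ht, Prod.fst_zero, map_zero]
    exact A.graph.zero_mem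
  add_mem' := by
    intro x y hx hy
    filter_upwards [hx, hy, Lp.coeFn_add x.2 y.2] with t h1 h2 h3
    rw [Prod.snd_add, h3, Prod.fst_add, map_add]
    exact A.graph.add_mem h1 h2
  smul_mem' := by
    intro c x hx
    filter_upwards [hx, Lp.coeFn_smul c x.2] with t h1 h3
    rw [Prod.smul_snd, h3, Prod.smul_fst, map_smul]
    exact A.graph.smul_mem c h1

theorem mem_orbitGraph {A : E →ₗ.[ℂ] E} {x : E × Lp E 2 (volume : Measure ℝ)} :
    x ∈ orbitGraph U A ↔ ∀ᵐ t, (U t x.1, x.2 t) ∈ A.graph := Iff.rfl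

/-- L² convergence gives almost everywhere convergence along a subsequence, and A is closed at each
such time. -/
theorem isClosed_orbitGraph {A : E →ₗ.[ℂ] E} (hA : A.IsClosed) :
    IsClosed (orbitGraph U A : Set (E × Lp E 2 (volume : Measure ℝ))) := by
  refine IsSeqClosed.isClosed fun x y hx hxy => ?_
  have h1 : Filter.Tendsto (fun n => (x n).2) Filter.atTop (nhds y.2) :=
    (continuous_snd.tendsto y).comp hxy
  have h2 : Filter.Tendsto (fun n => (x n).1) Filter.atTop (nhds y.1) :=
    (continuous_fst.tendsto y).comp hxy
  obtain ⟨ns, hns, hlim⟩ := (tendstoInMeasure_of_tendsto_Lp h1).exists_seq_tendsto_ae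
  have h3 : ∀ᵐ t, ∀ n, (U t (x n).1, (x n).2 t) ∈ A.graph := ae_all_iff.2 hx
  refine mem_orbitGraph.2 ?_
  filter_upwards [hlim, h3] with t h4 h5
  refine IsClosed.mem_of_tendsto hA ((((U t).continuous.tendsto _).comp
    (h2.comp hns.tendsto_atTop)).prodMk_nhds h4) (Filter.Eventually.of_forall fun n => h5 _)

theorem mem_graph_product {S T : E →ₗ.[ℂ] E} {x y z : E} (h1 : (x, y) ∈ T.graph)
    (h2 : (y, z) ∈ S.graph) : (x, z) ∈ (product S T).graph := by
  obtain ⟨u, rfl, hu⟩ := (LinearPMap.mem_graph_iff T).1 h1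
  obtain ⟨v, hv, hv'⟩ := (LinearPMap.mem_graph_iff S).1 h2
  simp only at hu hv hv'
  subst hu hv'
  have hm : (u : E) ∈ (product S T).domain :=
    Submodule.mem_map.2 ⟨u, Submodule.mem_comap.2 (show T u ∈ S.domain from hv ▸ v.2), rfl⟩
  refine (LinearPMap.mem_graph_iff _).2 ⟨⟨u, hm⟩, rfl, ?_⟩
  change S _ = S v
  congr 1
  exact Subtype.ext hv.symm

variable [CompleteSpace E]

theorem translate_mem_orbitGraph {A : E →ₗ.[ℂ] E} (hU : IsUnitaryGroupOf U H) {f : E}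
    {g : Lp E 2 (volume : Measure ℝ)} (h : (f, g) ∈ orbitGraph U A) (σ : ℝ) :
    (U σ f, DomAddAct.mk σ +ᵥ g) ∈ orbitGraph U A := by
  rw [mem_orbitGraph] at h ⊢
  have h1 := (measurePreserving_add_left (volume : Measure ℝ) σ).quasiMeasurePreserving.ae h
  filter_upwards [h1, DomAddAct.vadd_Lp_ae_eq (DomAddAct.mk σ) g] with t h2 h3
  rw [h3, ← hU.add_apply, add_comm t σ]
  exact h2

/-- The orbit graph is closed and invariant under U σ paired with time translation, so it contains
the averages over σ in (0, ε). These averages have first component in D(H) and converge to (f, g).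
-/
theorem tendsto_average_orbit (hU : IsUnitaryGroupOf U H) {A : E →ₗ.[ℂ] E} (hA : A.IsClosed)
    {f : E} {g : Lp E 2 (volume : Measure ℝ)} (h : (f, g) ∈ orbitGraph U A) :
    ∃ x : ℝ → E × Lp E 2 (volume : Measure ℝ),
      Filter.Tendsto x (nhdsWithin 0 (Set.Ioi 0)) (nhds (f, g)) ∧
      ∀ ε, x ε ∈ orbitGraph U A ∧ (x ε).1 ∈ H.domain := by
  have : Fact ((2 : ℝ≥0∞) ≠ ⊤) := ⟨by simp⟩
  let F : ℝ → E × Lp E 2 (volume : Measure ℝ) := fun σ => (U σ f, DomAddAct.mk σ +ᵥ g)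
  have hF : Continuous F :=
    (hU.continuous f).prodMk (DomAddAct.continuous_mk.vadd continuous_const)
  have hF0 : F 0 = (f, g) := by
    simp only [F, hU.zero_apply, DomAddAct.mk_zero, zero_vadd]
  have : CompleteSpace (orbitGraph U A) := (isClosed_orbitGraph hA).completeSpace_coe
  let G : ℝ → orbitGraph U A := fun σ => ⟨F σ, translate_mem_orbitGraph hU h σ⟩
  have hG : Continuous G := hF.subtype_mk _
  refine ⟨fun ε => ε⁻¹ • ∫ σ in (0 : ℝ)..ε, F σ, ?_, fun ε => ⟨?_, ?_⟩⟩
  · have h1 : HasDerivAt (fun ε => ∫ σ in (0 : ℝ)..ε, F σ) (F 0) 0 :=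
      intervalIntegral.integral_hasDerivAt_right (hF.intervalIntegrable 0 0)
        hF.stronglyMeasurable.stronglyMeasurableAtFilter hF.continuousAt
    have h2 := h1.tendsto_slope_zero_right
    simpa [hF0] using h2
  · have h1 := ((orbitGraph U A).subtypeL).intervalIntegral_comp_comm
      (hG.intervalIntegrable (μ := volume) 0 ε)
    have h2 : ∫ σ in (0 : ℝ)..ε, F σ ∈ orbitGraph U A := by
      change ∫ σ in (0 : ℝ)..ε, F σ = _ at h1
      rw [h1]
      exact Subtype.coe_prop _
    exact ((orbitGraph U A).restrictScalars ℝ).smul_mem ε⁻¹ h2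
  · have h1 := (ContinuousLinearMap.fst ℝ E (Lp E 2 (volume : Measure ℝ))).intervalIntegral_comp_comm
      (hF.intervalIntegrable (μ := volume) 0 ε)
    have h2 : (∫ σ in (0 : ℝ)..ε, F σ).1 ∈ H.domain := by
      change ∫ σ in (0 : ℝ)..ε, U σ f = _ at h1
      have h3 := LinearPMap.mem_domain_of_mem_graph (hU.integral_mem_graph ε f)
      rw [h1] at h3
      exact h3
    exact (H.domain.restrictScalars ℝ).smul_mem ε⁻¹ h2

/-- The bilinear form of `H - H₀` on `D(H) × D(H₀)` is that of `Y* Z`. -/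
def FormPerturbation (H H₀ Y Z : E →ₗ.[ℂ] E) : Prop :=
  ∀ {u u' v v' z y : E}, (u, u') ∈ H.graph → (v, v') ∈ H₀.graph → (u, z) ∈ Z.graph →
    (v, y) ∈ Y.graph → inner ℂ u' v = inner ℂ u v' + inner ℂ z y

/-- The derivative of ⟨U t f, U₀ t w⟩ is i times the difference of the forms of H and H₀, that is,
i⟨Z U t f, Y U₀ t w⟩ for almost every t. -/
theorem duhamel_of_mem_domain (hform : FormPerturbation H H₀ Y Z) (hU : IsUnitaryGroupOf U H)
    (hU₀ : IsUnitaryGroupOf U₀ H₀) {f w : E} (hf : f ∈ H.domain) (hw : w ∈ H₀.domain)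
    {g k : Lp E 2 (volume : Measure ℝ)} (hg : (f, g) ∈ orbitGraph U Z)
    (hk : (w, k) ∈ orbitGraph U₀ Y) {a b : ℝ} (hab : a ≤ b) :
    inner ℂ (U b f) (U₀ b w) - inner ℂ (U a f) (U₀ a w) =
      Complex.I * inner ℂ (cut (Set.Ioc a b) g) k := by
  obtain ⟨f', hf'⟩ := LinearPMap.mem_domain_iff.1 hf
  obtain ⟨w', hw'⟩ := LinearPMap.mem_domain_iff.1 hw
  have hd : ∀ t ∈ Set.uIcc a b, HasDerivAt (fun t => inner ℂ (U t f) (U₀ t w))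
      (Complex.I * (inner ℂ (U t f') (U₀ t w) - inner ℂ (U t f) (U₀ t w'))) t := by
    intro t _
    refine ((hU.hasDerivAt t hf').inner ℂ (hU₀.hasDerivAt t hw')).congr_deriv ?_
    rw [inner_neg_left, inner_neg_right, inner_smul_left, inner_smul_right, Complex.conj_I]
    ring
  have hc : Continuous fun t => Complex.I *
      (inner ℂ (U t f') (U₀ t w) - inner ℂ (U t f) (U₀ t w')) :=
    continuous_const.mul (((hU.continuous f').inner (hU₀.continuous w)).sub
      ((hU.continuous f).inner (hU₀.continuous w')))
  rw [← intervalIntegral.integral_eq_sub_of_hasDerivAt hd (hc.intervalIntegrable _ _),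
    intervalIntegral.integral_of_le hab, inner_cut_left measurableSet_Ioc, integral_const_mul]
  congr 1
  refine integral_congr_ae (ae_restrict_of_ae ?_)
  filter_upwards [hg, hk] with t h1 h2
  rw [hform (hU.map_mem_graph t hf') (hU₀.map_mem_graph t hw') h1 h2, add_sub_cancel_left]

/-- Removes f ∈ D(H): both sides are continuous in the pair (f, g), which is a limit of time
averages with f in D(H). -/
theorem duhamel (hform : FormPerturbation H H₀ Y Z) (hU : IsUnitaryGroupOf U H)
    (hU₀ : IsUnitaryGroupOf U₀ H₀) (hZ : Z.IsClosed) {f w : E} (hw : w ∈ H₀.domain)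
    {g k : Lp E 2 (volume : Measure ℝ)} (hg : (f, g) ∈ orbitGraph U Z)
    (hk : (w, k) ∈ orbitGraph U₀ Y) {a b : ℝ} (hab : a ≤ b) :
    inner ℂ (U b f) (U₀ b w) - inner ℂ (U a f) (U₀ a w) =
      Complex.I * inner ℂ (cut (Set.Ioc a b) g) k := by
  obtain ⟨x, hx, hxG⟩ := tendsto_average_orbit hU hZ hg
  have hcl : IsClosed {x : E × Lp E 2 (volume : Measure ℝ) |
      inner ℂ (U b x.1) (U₀ b w) - inner ℂ (U a x.1) (U₀ a w) =
      Complex.I * inner ℂ x.2 (cut (Set.Ioc a b) k)} :=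
    isClosed_eq (by fun_prop) (by fun_prop)
  have h1 := hcl.mem_of_tendsto hx (Filter.Eventually.of_forall fun ε => by
    have := duhamel_of_mem_domain hform hU hU₀ (hxG ε).2 hw (hxG ε).1 hk hab
    rwa [inner_cut_comm measurableSet_Ioc] at this)
  rw [inner_cut_comm measurableSet_Ioc]
  exact h1

/-- Duhamel's formula for `d t = e^{itH₀} e^{-itH} f`: the increment `d b - d a` lies in the
domain of `H₀ ^ s`, which maps it to `-i 𝒯* (1_{(a,b]} g)`, where `g t = Z e^{-itH} f` and
`𝒯 u t = Y H₀ ^ s e^{-itH₀} u`. -/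
theorem sub_mem_graph_power (hH₀ : IsSelfAdjoint H₀)
    (hpos : ∀ u : H₀.domain, 0 ≤ (inner ℂ (H₀ u) (u : E)).re)
    {s : ℝ} (hker : s ≠ 0 → ∀ u : H₀.domain, H₀ u = 0 → (u : E) = 0)
    (hform : FormPerturbation H H₀ Y Z) (hdom : H₀.domain ≤ Y.domain)
    (hU : IsUnitaryGroupOf U H) (hU₀ : IsUnitaryGroupOf U₀ H₀) (hZ : Z.IsClosed)
    (𝒯 : E →L[ℂ] Lp E 2 (volume : Measure ℝ))
    (h𝒯 : ∀ u, (u, 𝒯 u) ∈ orbitGraph U₀ (product Y (power H₀ s)).closure)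
    {f : E} {g : Lp E 2 (volume : Measure ℝ)} (hg : (f, g) ∈ orbitGraph U Z)
    {a b : ℝ} (hab : a ≤ b) :
    (U₀ (-b) (U b f) - U₀ (-a) (U a f),
      -(Complex.I • ContinuousLinearMap.adjoint 𝒯 (cut (Set.Ioc a b) g))) ∈
      (power H₀ s).graph := by
  have hB := isResolvent_resolventOne hH₀ hpos
  set B := resolventOne H₀ with hBdef
  set P := powerOp H₀ s with hP
  set Q := powerOp H₀ (-s) with hQ
  have hBsa := (ContinuousLinearMap.isSelfAdjoint_iff_isSymmetric.1 (hB.isSelfAdjoint hH₀))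
  have hPsa := (ContinuousLinearMap.isSelfAdjoint_iff_isSymmetric.1
    (cfc_predicate (powerFun s) B : IsSelfAdjoint P))
  have hQsa := (ContinuousLinearMap.isSelfAdjoint_iff_isSymmetric.1
    (cfc_predicate (powerFun (-s)) B : IsSelfAdjoint Q))
  have hQB : ∀ z, Q (B z) = B (Q z) := fun z => congrArg (fun T : E →L[ℂ] E => T z)
    (commute_powerOp hH₀ hB (Commute.refl B) (-s)).eq
  have hPU : ∀ t z, P (U₀ t z) = U₀ t (P z) := fun t z => congrArg (fun T : E →L[ℂ] E => T z)
    (commute_powerOp hH₀ hB (hU₀.commute_resolvent hB t) s).eq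
  have hQU : ∀ t z, Q (U₀ t z) = U₀ t (Q z) := fun t z => congrArg (fun T : E →L[ℂ] E => T z)
    (commute_powerOp hH₀ hB (hU₀.commute_resolvent hB t) (-s)).eq
  -- Test vectors: P B w₀ is mapped by H₀^s to Q B w₀, and the factor B puts Q B w₀ in D(H₀), hence
  -- in D(Y). So Y U₀ t Q B w₀ = 𝒯(P B w₀)(t) and Duhamel's formula applies.
  have key : ∀ w₀, inner ℂ (U₀ (-b) (U b f) - U₀ (-a) (U a f)) (Q (B w₀)) =
      inner ℂ (-(Complex.I • ContinuousLinearMap.adjoint 𝒯 (cut (Set.Ioc a b) g)))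
        (P (B w₀)) := by
    intro w₀
    have hw : Q (B w₀) ∈ H₀.domain := by
      rw [hQB]
      exact LinearPMap.mem_domain_of_mem_graph (hB.1 _)
    have hk : (Q (B w₀), 𝒯 (P (B w₀))) ∈ orbitGraph U₀ Y := by
      rw [mem_orbitGraph]
      filter_upwards [h𝒯 (P (B w₀))] with t ht
      obtain ⟨w', hw'⟩ := LinearPMap.mem_domain_iff.1 hw
      have h1 : U₀ t (Q (B w₀)) ∈ Y.domain :=
        hdom (LinearPMap.mem_domain_of_mem_graph (hU₀.map_mem_graph t hw'))
      obtain ⟨y, hy⟩ := LinearPMap.mem_domain_iff.1 h1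
      have h2 : (U₀ t (P (B w₀)), U₀ t (Q (B w₀))) ∈ (power H₀ s).graph := by
        rw [mem_power_graph_iff hH₀ hpos hker]
        exact ⟨U₀ t (B w₀), hPU _ _, hQU _ _⟩
      have h3 := LinearPMap.le_graph_of_le (LinearPMap.le_closure _) (mem_graph_product h2 hy)
      rwa [snd_eq_of_mem_graph ht h3]
    have h1 := duhamel hform hU hU₀ hZ hw hg hk hab
    rw [inner_sub_left, hU₀.inner_neg_map, hU₀.inner_neg_map, h1, inner_neg_left,
      inner_smul_left, ContinuousLinearMap.adjoint_inner_left, Complex.conj_I]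
    ring
  refine mem_power_graph_of_eq hH₀ hpos hker ?_
  have h1 : ∀ z, B z = 0 → z = 0 := by
    intro u hu
    have := hB.1 u
    rw [hu, sub_zero] at this
    exact LinearPMap.graph_fst_eq_zero_snd H₀ this rfl
  rw [← sub_eq_zero]
  -- B is self-adjoint and injective, so the extra factor B in the test vectors can be removed.
  refine h1 _ (ext_inner_right ℂ fun w₀ => ?_)
  rw [inner_zero_left]
  have h2 := key w₀
  rw [← sub_eq_zero] at h2
  rw [← h2]
  refine (hBsa _ _).trans ?_
  rw [inner_sub_left]
  congr 1
  · exact hQsa _ _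
  · exact hPsa _ _

end Duhamel

end

end OrthStrichartz

namespace OrthStrichartz

noncomputable section

/-! ### Bounded weights testing an L^p norm -/

section DualWeight

variable {X : Type*} [MeasurableSpace X] {μ : Measure X} {p : ℝ≥0∞}

/-- `V` is a bounded nonnegative function in the unit ball of the dual of `L^p`. -/
structure IsDualWeight (p : ℝ≥0∞) (μ : Measure X) (V : X → ℝ≥0) : Prop where
  measurable : Measurable V
  bounded : ∃ K : ℝ≥0, ∀ x, V x ≤ K
  lintegral_le : ∀ h : X → ℝ≥0∞, Measurable h → ∫⁻ x, V x * h x ∂μ ≤ eLpNorm h p μ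

/-- The weight is a normalised indicator of a set of finite positive measure on which N exceeds an
intermediate level c'. -/
theorem exists_isDualWeight_top [SigmaFinite μ] {N : X → ℝ≥0∞} (hN : Measurable N) {c : ℝ≥0∞}
    (hc : c < eLpNorm N ∞ μ) : ∃ V, IsDualWeight ∞ μ V ∧ c < ∫⁻ x, V x * N x ∂μ := by
  rw [eLpNorm_exponent_top] at hc
  obtain ⟨c', hc', hcN⟩ := exists_between hc
  have hA : 0 < μ {x | c' < N x} := by
    rw [pos_iff_ne_zero]
    intro h0
    refine not_le.2 hcN (essSup_le_of_ae_le c' ?_)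
    have : {x | c' < N x} = {x | ¬ N x ≤ c'} := by ext; simp
    rw [this] at h0
    exact h0
  obtain ⟨s, hs, hsA, hs0, hs1⟩ :=
    Measure.exists_subset_measure_lt_top (measurableSet_lt measurable_const hN) hA
  have hK : (((μ s)⁻¹).toNNReal : ℝ≥0∞) = (μ s)⁻¹ :=
    ENNReal.coe_toNNReal (ENNReal.inv_ne_top.2 hs0.ne')
  have hint : ∀ h : X → ℝ≥0∞,
      ∫⁻ x, ((s.indicator (fun _ => ((μ s)⁻¹).toNNReal) x : ℝ≥0) : ℝ≥0∞) * h x ∂μ =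
        (μ s)⁻¹ * ∫⁻ x in s, h x ∂μ := by
    intro h
    rw [← lintegral_const_mul' _ _ (ENNReal.inv_ne_top.2 hs0.ne'), ← lintegral_indicator hs]
    refine lintegral_congr fun x => ?_
    by_cases hx : x ∈ s
    · simp only [Set.indicator_of_mem hx, hK]
    · simp [hx]
  refine ⟨s.indicator fun _ => ((μ s)⁻¹).toNNReal, ⟨measurable_const.indicator hs,
    ⟨((μ s)⁻¹).toNNReal, fun x => Set.indicator_le_self' (fun _ _ => zero_le) x⟩, ?_⟩, ?_⟩
  · intro h hh
    rw [hint, eLpNorm_exponent_top]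
    calc (μ s)⁻¹ * ∫⁻ x in s, h x ∂μ ≤ (μ s)⁻¹ * ∫⁻ _ in s, eLpNormEssSup h μ ∂μ := by
          gcongr 1
          exact lintegral_mono_ae (ae_restrict_of_ae (ae_le_eLpNormEssSup (f := h)))
      _ = eLpNormEssSup h μ := by
          rw [setLIntegral_const, mul_comm, mul_assoc, ENNReal.mul_inv_cancel hs0.ne' hs1.ne,
            mul_one]
  · rw [hint]
    refine hc'.trans_le ?_
    calc c' = (μ s)⁻¹ * ∫⁻ _ in s, c' ∂μ := by
          rw [setLIntegral_const, mul_comm, mul_assoc, ENNReal.mul_inv_cancel hs0.ne' hs1.ne,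
            mul_one]
      _ ≤ _ := by
          gcongr 1
          exact setLIntegral_mono hN fun x hx => (hsA hx).le

theorem exists_isDualWeight_of_lt_top [SigmaFinite μ] (hp1 : 1 ≤ p) (hp : p ≠ ∞) {N : X → ℝ≥0∞}
    (hN : Measurable N) {c : ℝ≥0∞} (hc : c < eLpNorm N p μ) :
    ∃ V, IsDualWeight p μ V ∧ c < ∫⁻ x, V x * N x ∂μ := by
  have hp0 : p ≠ 0 := (zero_lt_one.trans_le hp1).ne'
  set a := p.toReal with ha
  have ha1 : 1 ≤ a := by simpa using ENNReal.toReal_mono hp hp1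
  have ha0 : 0 < a := by linarith
  have hnorm : ∀ h : X → ℝ≥0∞, eLpNorm h p μ = (∫⁻ x, h x ^ a ∂μ) ^ (1 / a) := fun h => by
    rw [eLpNorm_eq_lintegral_rpow_enorm_toReal hp0 hp]
    rfl
  -- Truncating in height and to a set of finite measure makes the extremal weight bounded and its
  -- normalisation finite; monotone convergence keeps the norm above c.
  let g : ℕ → X → ℝ≥0∞ := fun k => (spanningSets μ k).indicator fun x => min (N x) k
  have hgm : ∀ k, Measurable (g k) := fun k =>
    (hN.min measurable_const).indicator (measurableSet_spanningSets μ k)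
  have hmono : Monotone g := by
    intro k l hkl x
    refine Set.indicator_le_indicator_of_subset (monotone_spanningSets μ hkl)
      (fun _ => zero_le) x |>.trans ?_
    exact Set.indicator_le_indicator (min_le_min le_rfl (by exact_mod_cast hkl))
  have hgN : ∀ k x, g k x ≤ N x := fun k x =>
    (Set.indicator_le_self' (fun _ _ => zero_le) x).trans (min_le_left _ _)
  have hgk : ∀ k x, g k x ≤ k := fun k x =>
    (Set.indicator_le_self' (fun _ _ => zero_le) x).trans (min_le_right _ _)
  have hsup : ∀ x, ⨆ k, g k x = N x := by
    intro x
    refine le_antisymm (iSup_le fun k => hgN k x) (le_of_forall_lt fun b hb => ?_)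
    obtain ⟨k, hk⟩ := ENNReal.exists_nat_gt (hb.trans_le le_top).ne
    have hx : x ∈ ⋃ k, spanningSets μ k := by rw [iUnion_spanningSets]; trivial
    obtain ⟨l, hl⟩ := Set.mem_iUnion.1 hx
    refine lt_iSup_iff.2 ⟨max k l, ?_⟩
    simp only [g]
    rw [Set.indicator_of_mem (monotone_spanningSets μ (le_max_right k l) hl)]
    exact lt_min hb (hk.trans_le (by exact_mod_cast le_max_left k l))
  have hsup' : ⨆ k, eLpNorm (g k) p μ = eLpNorm N p μ := by
    simp only [hnorm]
    refine ((ENNReal.orderIsoRpow (1 / a) (by positivity)).map_iSup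
      fun k => ∫⁻ x, g k x ^ a ∂μ).symm.trans ?_
    rw [ENNReal.orderIsoRpow_apply, ← lintegral_iSup (fun k => (hgm k).pow_const a)
      fun k l hkl x => ENNReal.rpow_le_rpow (hmono hkl x) ha0.le]
    congr 1
    refine lintegral_congr fun x => ?_
    rw [← hsup x]
    exact ((ENNReal.orderIsoRpow a ha0).map_iSup fun k => g k x).symm
  rw [← hsup'] at hc
  obtain ⟨k, hk⟩ := lt_iSup_iff.1 hc
  set I := ∫⁻ x, g k x ^ a ∂μ with hI
  have hI0 : I ≠ 0 := by
    intro h0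
    rw [hnorm, ← hI, h0, ENNReal.zero_rpow_of_pos (by positivity)] at hk
    exact not_lt_zero hk
  have hItop : I ≠ ∞ := by
    refine ne_top_of_le_ne_top (b := (k : ℝ≥0∞) ^ a * μ (spanningSets μ k)) ?_ ?_
    · exact ENNReal.mul_ne_top (ENNReal.rpow_ne_top_of_nonneg ha0.le (ENNReal.natCast_ne_top k))
        (measure_spanningSets_lt_top μ k).ne
    · rw [← lintegral_indicator_const (measurableSet_spanningSets μ k)]
      refine lintegral_mono fun x => ?_
      by_cases hx : x ∈ spanningSets μ k
      · rw [Set.indicator_of_mem hx]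
        exact ENNReal.rpow_le_rpow (hgk k x) ha0.le
      · simp [g, hx, ENNReal.zero_rpow_of_pos ha0]
  -- β is the L^p norm of g k; the weight (g k / β)^(a-1) attains it by equality in Hölder, and for
  -- a = 1 it is the constant 1.
  set β := I ^ (1 / a) with hβ
  have hβ0 : β ≠ 0 := by simp [hβ, ENNReal.rpow_eq_zero_iff, hI0, hItop]
  have hβtop : β ≠ ∞ := ENNReal.rpow_ne_top_of_nonneg (by positivity) hItop
  have hβa : β ^ a = I := by
    rw [hβ, ← ENNReal.rpow_mul, one_div_mul_cancel ha0.ne', ENNReal.rpow_one]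
  have hdiv : ∀ x, (g k x / β) ^ (a - 1) ≠ ∞ := fun x =>
    ENNReal.rpow_ne_top_of_nonneg (by linarith)
      (ENNReal.div_ne_top (ne_top_of_le_ne_top (ENNReal.natCast_ne_top k) (hgk k x)) hβ0)
  have hV : ∀ x, ((((g k x / β) ^ (a - 1)).toNNReal : ℝ≥0) : ℝ≥0∞) = (g k x / β) ^ (a - 1) :=
    fun x => ENNReal.coe_toNNReal (hdiv x)
  have hVm : Measurable fun x => (g k x / β) ^ (a - 1) :=
    ((hgm k).div_const β).pow_const (a - 1)
  refine ⟨fun x => ((g k x / β) ^ (a - 1)).toNNReal, ⟨hVm.ennreal_toNNReal,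
    ⟨(((k : ℝ≥0∞) / β) ^ (a - 1)).toNNReal, fun x => ?_⟩, fun h hh => ?_⟩, ?_⟩
  · refine ENNReal.toNNReal_mono (ENNReal.rpow_ne_top_of_nonneg (by linarith)
      (ENNReal.div_ne_top (ENNReal.natCast_ne_top k) hβ0)) ?_
    exact ENNReal.rpow_le_rpow (ENNReal.div_le_div_right (hgk k x) _) (by linarith)
  · simp only [hV]
    rcases ha1.eq_or_lt with h1 | h1
    · rw [hnorm, ← h1]
      simp
    · have hconj := (Real.HolderConjugate.conjExponent h1).symm
      have h2 := ENNReal.lintegral_mul_le_Lp_mul_Lq μ hconj hVm.aemeasurable hh.aemeasurable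
      simp only [Pi.mul_apply] at h2
      rw [hnorm]
      refine h2.trans ?_
      have h3 : ∫⁻ x, ((g k x / β) ^ (a - 1)) ^ a.conjExponent ∂μ = 1 := by
        have h4 : (a - 1) * a.conjExponent = a := by
          rw [Real.conjExponent]
          have : a - 1 ≠ 0 := by linarith
          field_simp
        simp only [← ENNReal.rpow_mul, h4]
        simp only [ENNReal.div_rpow_of_nonneg _ _ ha0.le, hβa]
        simp only [div_eq_mul_inv]
        rw [lintegral_mul_const _ ((hgm k).pow_const a), ← hI, ENNReal.mul_inv_cancel hI0 hItop]
      rw [h3, ENNReal.one_rpow, one_mul]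
  · simp only [hV]
    rw [hnorm, ← hI, ← hβ] at hk
    refine hk.trans_le ?_
    calc β = ∫⁻ x, (g k x / β) ^ (a - 1) * g k x ∂μ := by
          have h5 : ∀ x, (g k x / β) ^ (a - 1) * g k x = β * (g k x ^ a / I) := by
            intro x
            have h6 : g k x = β * (g k x / β) := (ENNReal.mul_div_cancel hβ0 hβtop).symm
            conv_lhs => rw [mul_comm]; enter [1]; rw [h6]
            rw [mul_assoc]
            congr 1
            rw [← hβa, ← ENNReal.div_rpow_of_nonneg _ _ ha0.le]
            conv_rhs => rw [show a = 1 + (a - 1) by ring]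
            rw [ENNReal.rpow_add_of_nonneg _ _ zero_le_one (by linarith), ENNReal.rpow_one]
          simp only [h5]
          simp only [div_eq_mul_inv]
          rw [lintegral_const_mul _ (((hgm k).pow_const a).mul_const _),
            lintegral_mul_const _ ((hgm k).pow_const a), ← hI, ENNReal.mul_inv_cancel hI0 hItop,
            mul_one]
      _ ≤ _ := by
          refine lintegral_mono fun x => ?_
          gcongr
          exact hgN k x

/-- The `L^p` norm, `1 ≤ p ≤ ∞`, is the supremum of the integrals against dual weights. -/
theorem exists_isDualWeight [SigmaFinite μ] (hp1 : 1 ≤ p) {N : X → ℝ≥0∞} (hN : Measurable N)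
    {c : ℝ≥0∞} (hc : c < eLpNorm N p μ) :
    ∃ V, IsDualWeight p μ V ∧ c < ∫⁻ x, V x * N x ∂μ := by
  rcases eq_or_ne p ∞ with rfl | hp
  · exact exists_isDualWeight_top hN hc
  · exact exists_isDualWeight_of_lt_top hp1 hp hN hc

theorem ae_lt_top_of_eLpNorm_lt_top (hp0 : p ≠ 0) {N : X → ℝ≥0∞} (hN : Measurable N)
    (h : eLpNorm N p μ < ∞) : ∀ᵐ x ∂μ, N x < ∞ := by
  rcases eq_or_ne p ∞ with rfl | hp
  · rw [eLpNorm_exponent_top] at h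
    filter_upwards [ae_le_eLpNormEssSup (f := N) (μ := μ)] with x hx
    exact hx.trans_lt h
  · have ha : 0 < p.toReal := ENNReal.toReal_pos hp0 hp
    have h1 := lintegral_rpow_enorm_lt_top_of_eLpNorm_lt_top hp0 hp h
    filter_upwards [ae_lt_top (hN.pow_const p.toReal) h1.ne] with x hx
    exact (ENNReal.rpow_lt_top_iff_of_pos ha).1 hx

end DualWeight

end

end OrthStrichartz

namespace OrthStrichartz

noncomputable section

/-! ### The estimate for a partition of time -/

section Discrete

variable {E F : Type*} [NormedAddCommGroup E] [InnerProductSpace ℂ E]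
  [NormedAddCommGroup F] [InnerProductSpace ℂ F]

theorem IsBessel.add {n : Type*} [Fintype n] {c c' : ℝ} (hc : 0 ≤ c) (hc' : 0 ≤ c') {v w : n → E}
    (hv : IsBessel c v) (hw : IsBessel c' w) : IsBessel (c + c') fun j => v j + w j := by
  intro z
  set S := ∑ j, ‖z j‖ ^ 2 with hS
  have hS0 : 0 ≤ S := by positivity
  have key : ∀ {c : ℝ} {v : n → E}, 0 ≤ c → IsBessel c v → ‖∑ j, z j • v j‖ ≤ c * √S := by
    intro c v hc hv
    refine abs_le_of_sq_le_sq' ?_ (by positivity) |>.2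
    rw [mul_pow, Real.sq_sqrt hS0]
    exact hv z
  have h1 : ∑ j, z j • (v j + w j) = ∑ j, z j • v j + ∑ j, z j • w j := by
    simp only [smul_add, Finset.sum_add_distrib]
  calc ‖∑ j, z j • (v j + w j)‖ ^ 2 ≤ ((c + c') * √S) ^ 2 := by
        refine pow_le_pow_left₀ (norm_nonneg _) ?_ 2
        rw [h1, add_mul]
        exact (norm_add_le _ _).trans (add_le_add (key hc hv) (key hc' hw))
    _ = _ := by rw [mul_pow, Real.sq_sqrt hS0]

theorem IsBessel.subtype {n : Type*} [Fintype n] {c : ℝ} {W : Submodule ℂ E} {v : n → W}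
    (hv : IsBessel c fun j => (v j : E)) : IsBessel c v := by
  intro z
  refine le_of_eq_of_le ?_ (hv z)
  rw [Submodule.coe_norm]
  simp

theorem sum_cut_Ioc {t : ℕ → ℝ} (ht : Monotone t) (g : Lp E 2 (volume : Measure ℝ)) (k : ℕ) :
    ∑ i ∈ Finset.range k, cut (Set.Ioc (t i) (t (i + 1))) g = cut (Set.Ioc (t 0) (t k)) g := by
  induction k with
  | zero => simp [cut_empty]
  | succ k ih =>
    rw [Finset.sum_range_succ, ih, ← cut_union measurableSet_Ioc measurableSet_Ioc
      (Set.Ioc_disjoint_Ioc_of_le le_rfl),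
      Set.Ioc_union_Ioc_eq_Ioc (ht (Nat.zero_le k)) (ht (Nat.le_succ k))]

theorem sum_filter_lt_eq_sum_range {M : Type*} [AddCommMonoid M] {N : ℕ} (k : Fin N) (G : ℕ → M) :
    ∑ i : Fin N with i < k, G i = ∑ i ∈ Finset.range k, G i := by
  rw [Finset.sum_filter]
  simp only [Fin.lt_def]
  rw [Fin.sum_univ_eq_sum_range (fun i => if i < (k : ℕ) then G i else 0) N, ← Finset.sum_filter]
  refine Finset.sum_congr ?_ fun _ _ => rfl
  ext i
  simp only [Finset.mem_filter, Finset.mem_range]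
  have := k.2
  omega

/-- In the application Λ = H₀^{-θ} and τ = -i𝒯*. Write d(t k) as d(t 0) plus an increment. The first
is Λ of a Bessel family; the second is Λτ of a sum of time slices of g with index below k, to which
the time-ordered bound applies. -/
theorem exists_sum_mul_norm_sq_le {a s : ℝ} (has : a.HolderConjugate s) {cT cS : ℝ}
    (hcT : 0 < cT) (hcS : 0 < cS) : ∃ C : ℝ, 0 ≤ C ∧
    ∀ (Λ : E →ₗ.[ℂ] E) (τ : Lp E 2 (volume : Measure ℝ) →ₗ[ℂ] E), (∀ x, ‖τ x‖ ≤ cT * ‖x‖) →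
    ∀ (J : Type) [Fintype J] (h : J → E) (g : J → Lp E 2 (volume : Measure ℝ)) (d : J → ℝ → E),
    IsBessel 1 h → IsBessel cS g → (∀ j, (h j, d j 0) ∈ Λ.graph) →
    (∀ j x y, x ≤ y → (τ (cut (Set.Ioc x y) (g j)), d j y - d j x) ∈ Λ.graph) →
    ∀ (N : ℕ) (t : ℕ → ℝ), Monotone t → t 0 ≤ 0 → ∀ (B : Fin N → E →ₗ[ℂ] F) (D : ℝ), 0 ≤ D →
    SchattenBound (fun k => B k ∘ₗ Λ.toFun) a D → ∀ w : J → ℝ, (∀ j, 0 ≤ w j) →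
    ∑ j, w j * ∑ k, ‖B k (d j (t k))‖ ^ 2 ≤ C * D * (∑ j, w j ^ a) ^ (1 / a) := by
  obtain ⟨C, hC, hCbound⟩ := exists_timeOrdered_bound has
  refine ⟨2 * (1 + cT * cS) ^ 2 + 2 * (cS ^ 2 * (C * cT ^ 2)), by positivity, ?_⟩
  intro Λ τ hτ J _ h g d hh hg hd0 hd N t ht ht0 B D hD hB w hw
  have hcutτ : ∀ (S : Set ℝ), MeasurableSet S → ∀ x, ‖τ (cut S x)‖ ≤ cT * ‖x‖ := fun S hS x =>
    (hτ _).trans (mul_le_mul_of_nonneg_left (norm_cut_le hS x) hcT.le)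
  -- the value at the initial time
  have hx : ∀ j, (h j - τ (cut (Set.Ioc (t 0) 0) (g j)), d j (t 0)) ∈ Λ.graph := fun j => by
    have := Λ.graph.sub_mem (hd0 j) (hd j (t 0) 0 ht0)
    rwa [Prod.mk_sub_mk, sub_sub_cancel] at this
  choose x hx1 hx2 using fun j => (LinearPMap.mem_graph_iff Λ).1 (hx j)
  simp only at hx1 hx2
  have hxB : IsBessel (1 + cT * cS) x := by
    refine IsBessel.subtype ?_
    have h1 := hg.map (-(τ ∘ₗ cut (Set.Ioc (t 0) 0))) (M := cT) fun y => by
      rw [LinearMap.neg_apply, norm_neg]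
      exact hcutτ _ measurableSet_Ioc y
    have h2 := hh.add zero_le_one (by positivity) h1
    convert h2 using 2 with j
    rw [hx1, sub_eq_add_neg]
    rfl
  have bound1 := hB.comp has hD (by positivity) x hxB w hw
  -- the increments
  let W : Submodule ℂ (Lp E 2 (volume : Measure ℝ)) := Λ.domain.comap τ
  let τ' : W →ₗ[ℂ] Λ.domain := (τ ∘ₗ W.subtype).codRestrict Λ.domain fun y => y.2
  -- Λ may be unbounded, so the form is composed with τ only on the subspace W that τ maps into
  -- D(Λ); no continuity of the forms is needed.
  have hB' : SchattenBound (fun k => (B k ∘ₗ Λ.toFun) ∘ₗ τ') a (cT ^ 2 * D) := by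
    intro J _ u hu w hw
    have h1 : IsBessel (cT * 1) fun j => τ' (u j) := hu.isBessel.map τ' fun y => hτ y
    rw [mul_one] at h1
    exact hB.comp has hD hcT _ h1 w hw
  have hcutW : ∀ j x y, x ≤ y → cut (Set.Ioc x y) (g j) ∈ W := fun j x y hxy =>
    LinearPMap.mem_domain_of_mem_graph (hd j x y hxy)
  -- Slices over disjoint intervals are orthogonal in L²; below they are divided by cS so that their
  -- sum is Bessel with constant 1.
  let v : ℕ → J → W := fun i j =>
    ⟨cut (Set.Ioc (t i) (t (i + 1))) (g j), hcutW j _ _ (ht (Nat.le_succ i))⟩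
  have hv : ∀ (i i' : Fin N) j j', i ≠ i' →
      inner ℂ ((((cS⁻¹ : ℝ) : ℂ)) • v i j) ((((cS⁻¹ : ℝ) : ℂ)) • v i' j') = 0 := by
    intro i i' j j' hii
    have h1 : inner ℂ (v i j : Lp E 2 (volume : Measure ℝ)) (v i' j') = 0 := by
      refine inner_cut_cut measurableSet_Ioc measurableSet_Ioc ?_ _ _
      rcases lt_or_gt_of_ne (Fin.val_ne_of_ne hii) with h1 | h1
      · exact Set.Ioc_disjoint_Ioc_of_le (ht h1)
      · exact (Set.Ioc_disjoint_Ioc_of_le (ht h1)).symm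
    rw [Submodule.coe_inner, Submodule.coe_smul, Submodule.coe_smul, inner_smul_left,
      inner_smul_right, h1, mul_zero, mul_zero]
  have hvsum : ∀ k j, ((∑ i ∈ Finset.range k, v i j : W) : Lp E 2 (volume : Measure ℝ)) =
      cut (Set.Ioc (t 0) (t k)) (g j) := fun k j => by
    rw [← sum_cut_Ioc ht, Submodule.coe_sum]
  have hvB : IsBessel 1 fun j => ∑ i : Fin N, (((cS⁻¹ : ℝ) : ℂ)) • v i j := by
    refine IsBessel.subtype ?_
    have h1 := (hg.map (cut (Set.Ioc (t 0) (t N))) (M := 1) fun y => by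
      rw [one_mul]; exact norm_cut_le measurableSet_Ioc y).smul cS⁻¹
    rw [one_mul, inv_mul_cancel₀ hcS.ne'] at h1
    convert h1 using 2 with j
    rw [← Finset.smul_sum, Fin.sum_univ_eq_sum_range (fun i => v i j) N, Submodule.coe_smul, hvsum]
  have bound2 := hCbound _ _ N _ _ (by positivity) hB' J
    (fun i j => (((cS⁻¹ : ℝ) : ℂ)) • v i j) hv hvB w hw
  have hterm : ∀ (k : Fin N) j, ((B k ∘ₗ Λ.toFun) ∘ₗ τ')
      (∑ i with i < k, (((cS⁻¹ : ℝ) : ℂ)) • v i j) =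
      ((cS⁻¹ : ℝ) : ℂ) • B k (d j (t k) - d j (t 0)) := by
    intro k j
    rw [← Finset.smul_sum, sum_filter_lt_eq_sum_range k fun i => v i j, map_smul]
    congr 1
    change B k (Λ _) = _
    congr 1
    obtain ⟨y, hy1, hy2⟩ := (LinearPMap.mem_graph_iff Λ).1 (hd j (t 0) (t k) (ht (Nat.zero_le _)))
    simp only at hy1 hy2
    rw [← hy2]
    congr 1
    refine Subtype.ext ?_
    rw [hy1, ← hvsum]
    rfl
  simp only [hterm] at bound2
  have hcS2 : ∀ y : F, ‖((cS⁻¹ : ℝ) : ℂ) • y‖ ^ 2 = (cS ^ 2)⁻¹ * ‖y‖ ^ 2 := fun y => by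
    rw [norm_smul, mul_pow, Complex.norm_real, Real.norm_eq_abs, sq_abs, inv_pow]
  simp only [hcS2] at bound2
  have bound3 : ∑ j, w j * ∑ k : Fin N, ‖B k (d j (t k) - d j (t 0))‖ ^ 2 ≤
      cS ^ 2 * (C * (cT ^ 2 * D) * (∑ j, w j ^ a) ^ (1 / a)) := by
    have h1 : ∑ j, w j * ∑ k : Fin N, (cS ^ 2)⁻¹ * ‖B k (d j (t k) - d j (t 0))‖ ^ 2 =
        (cS ^ 2)⁻¹ * ∑ j, w j * ∑ k : Fin N, ‖B k (d j (t k) - d j (t 0))‖ ^ 2 := by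
      rw [Finset.mul_sum]
      refine Finset.sum_congr rfl fun j _ => ?_
      rw [← Finset.mul_sum]
      ring
    rw [h1, inv_mul_le_iff₀ (by positivity)] at bound2
    exact bound2
  calc ∑ j, w j * ∑ k : Fin N, ‖B k (d j (t k))‖ ^ 2
      ≤ ∑ j, w j * ∑ k : Fin N, (2 * ‖(B k ∘ₗ Λ.toFun) (x j)‖ ^ 2 +
          2 * ‖B k (d j (t k) - d j (t 0))‖ ^ 2) := by
        refine Finset.sum_le_sum fun j _ => mul_le_mul_of_nonneg_left
          (Finset.sum_le_sum fun k _ => ?_) (hw j)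
        have h1 : (B k ∘ₗ Λ.toFun) (x j) = B k (d j (t 0)) := by
          change B k (Λ (x j)) = _
          rw [hx2]
        have h2 : B k (d j (t k)) = B k (d j (t 0)) + B k (d j (t k) - d j (t 0)) := by
          rw [← map_add, add_sub_cancel]
        rw [h1, h2]
        have h3 := norm_add_le (B k (d j (t 0))) (B k (d j (t k) - d j (t 0)))
        have h4 := pow_le_pow_left₀ (norm_nonneg _) h3 2
        nlinarith [sq_nonneg (‖B k (d j (t 0))‖ - ‖B k (d j (t k) - d j (t 0))‖)]
    _ = 2 * ∑ j, w j * ∑ k, ‖(B k ∘ₗ Λ.toFun) (x j)‖ ^ 2 +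
        2 * ∑ j, w j * ∑ k : Fin N, ‖B k (d j (t k) - d j (t 0))‖ ^ 2 := by
        rw [Finset.mul_sum, Finset.mul_sum, ← Finset.sum_add_distrib]
        refine Finset.sum_congr rfl fun j _ => ?_
        rw [Finset.sum_add_distrib, ← Finset.mul_sum, ← Finset.mul_sum]
        ring
    _ ≤ 2 * ((1 + cT * cS) ^ 2 * D * (∑ j, w j ^ a) ^ (1 / a)) +
        2 * (cS ^ 2 * (C * (cT ^ 2 * D) * (∑ j, w j ^ a) ^ (1 / a))) := by gcongr
    _ = _ := by ring

end Discrete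

end

end OrthStrichartz

namespace OrthStrichartz

noncomputable section

/-! ### Time integrals over one interval as operator norms -/

section StepOperator

variable {E : Type*} [NormedAddCommGroup E] [InnerProductSpace ℂ E]

theorem exists_stepOperator {V : ℝ → E →ₗ[ℂ] E} (hVc : ∀ u, Continuous fun t => V t u) {L : ℝ}
    (hVL : ∀ t u, ‖V t u‖ ≤ L * ‖u‖) {ω : ℝ → ℝ≥0} (hω : Measurable ω) {K : ℝ≥0}
    (hK : ∀ t, ω t ≤ K) (x y : ℝ) :
    ∃ B : E →ₗ[ℂ] Lp E 2 (volume : Measure ℝ), ∀ u,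
      ENNReal.ofReal (‖B u‖ ^ 2) = ∫⁻ t in Set.Ioc x y, ω t * ENNReal.ofReal (‖V t u‖ ^ 2) := by
  let G : E → ℝ → E := fun u =>
    (Set.Ioc x y).indicator fun t => ((√(ω t) : ℝ) : ℂ) • V t u
  have hsm : ∀ u, StronglyMeasurable fun t => ((√(ω t) : ℝ) : ℂ) • V t u := fun u => by
    refine StronglyMeasurable.smul (Measurable.stronglyMeasurable ?_) (hVc u).stronglyMeasurable
    fun_prop
  have hG : ∀ u, MemLp (G u) 2 volume := fun u => by
    rw [memLp_indicator_iff_restrict measurableSet_Ioc]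
    refine MemLp.of_bound (hsm u).aestronglyMeasurable (√K * (L * ‖u‖))
      (Filter.Eventually.of_forall fun t => ?_)
    rw [norm_smul, Complex.norm_real, Real.norm_of_nonneg (Real.sqrt_nonneg _)]
    have h1 : (ω t : ℝ) ≤ K := by exact_mod_cast hK t
    exact mul_le_mul (Real.sqrt_le_sqrt h1) (hVL t u) (norm_nonneg _) (Real.sqrt_nonneg _)
  refine ⟨⟨⟨fun u => (hG u).toLp (G u), fun u v => ?_⟩, fun c u => ?_⟩, fun u => ?_⟩
  · rw [← MemLp.toLp_add]
    congr 1
    rw [← Set.indicator_add']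
    simp only [G]
    congr 1
    funext t
    rw [map_add, smul_add]
    rfl
  · rw [RingHom.id_apply, ← MemLp.toLp_const_smul]
    refine MemLp.toLp_congr (hG _) ((hG u).const_smul c) (Filter.Eventually.of_forall fun t => ?_)
    by_cases ht : t ∈ Set.Ioc x y
    · simp only [G, Pi.smul_apply, Set.indicator_of_mem ht]
      rw [map_smul, smul_comm]
    · simp [G, ht]
  · have h1 : ∀ z : Lp E 2 (volume : Measure ℝ), ENNReal.ofReal (‖z‖ ^ 2) = ‖z‖ₑ ^ 2 := fun z => by
      rw [ENNReal.ofReal_pow (norm_nonneg _), ofReal_norm]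
    change ENNReal.ofReal (‖(hG u).toLp (G u)‖ ^ 2) = _
    rw [h1, Lp.enorm_toLp]
    have h2 := eLpNorm_nnreal_pow_eq_lintegral (f := G u) (μ := (volume : Measure ℝ))
      (p := 2) two_ne_zero
    simp only [NNReal.coe_ofNat, ENNReal.rpow_ofNat, ENNReal.coe_ofNat] at h2
    rw [h2, ← lintegral_indicator measurableSet_Ioc]
    refine lintegral_congr fun t => ?_
    by_cases ht : t ∈ Set.Ioc x y
    · simp only [G, Set.indicator_of_mem ht]
      rw [enorm_smul, mul_pow, ENNReal.ofReal_pow (norm_nonneg _), ofReal_norm]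
      congr 1
      rw [← ofReal_norm, Complex.norm_real, Real.norm_of_nonneg (Real.sqrt_nonneg _),
        ← ENNReal.ofReal_pow (Real.sqrt_nonneg _), Real.sq_sqrt (NNReal.coe_nonneg _),
        ENNReal.ofReal_coe_nnreal]
    · simp [G, ht]

end StepOperator

/-! ### Freezing one time variable on a partition -/

section RiemannSum

theorem sum_lintegral_Ioc {t : ℕ → ℝ} (ht : Monotone t) (f : ℝ → ℝ≥0∞) (N : ℕ) :
    ∑ k ∈ Finset.range N, ∫⁻ x in Set.Ioc (t k) (t (k + 1)), f x =
      ∫⁻ x in Set.Ioc (t 0) (t N), f x := by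
  induction N with
  | zero => simp
  | succ N ih =>
    rw [Finset.sum_range_succ, ih, ← lintegral_union measurableSet_Ioc
      (Set.Ioc_disjoint_Ioc_of_le le_rfl),
      Set.Ioc_union_Ioc_eq_Ioc (ht (Nat.zero_le N)) (ht (Nat.le_succ N))]

/-- The integral of `ω t * max_i Θ_i (t, t)` is controlled by its Riemann-type sums with the
second time and the index frozen on each interval of a partition. -/
theorem lintegral_le_of_riemannSum_le {m : ℕ} (Θ : Fin (m + 1) → ℝ × ℝ → ℝ)
    (hΘ : ∀ i, Continuous (Θ i)) {ω : ℝ → ℝ≥0} {K : ℝ≥0}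
    (hK : ∀ t, ω t ≤ K) {R : ℝ} (hR : 0 < R) {L : ℝ≥0∞}
    (hL : ∀ (N : ℕ) (t : ℕ → ℝ), Monotone t → t 0 ≤ 0 → ∀ i : ℕ → Fin (m + 1),
      ∑ k ∈ Finset.range N, ∫⁻ x in Set.Ioc (t k) (t (k + 1)),
        ω x * ENNReal.ofReal (Θ (i k) (x, t k)) ≤ L) :
    ∫⁻ x in Set.Ioc (-R) R, ω x * ⨆ i, ENNReal.ofReal (Θ i (x, x)) ≤ L := by
  refine ENNReal.le_of_forall_pos_le_add fun ε hε _ => ?_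
  set δ : ℝ := ε / (K * (2 * R) + 1) with hδ
  have hKR : 0 ≤ K * (2 * R) := by positivity
  have hδ0 : 0 < δ := div_pos hε (by positivity)
  -- Uniform continuity of the map into functions of i treats all Θ i at once.
  have huc := ((isCompact_Icc (a := -R) (b := R)).prod (isCompact_Icc (a := -R) (b := R))).uniformContinuousOn_of_continuous
    (f := fun z i => Θ i z) (continuous_pi hΘ).continuousOn
  obtain ⟨η, hη, hunif⟩ := Metric.uniformContinuousOn_iff.1 huc (δ / 2) (by positivity)
  obtain ⟨N, hN⟩ := exists_nat_gt (2 * R / η)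
  have hN0 : 0 < (N : ℝ) := (by positivity : 0 < 2 * R / η).trans hN
  set t : ℕ → ℝ := fun k => -R + k * (2 * R / N) with ht
  have hstep : 0 < 2 * R / N := by positivity
  have htm : Monotone t := fun k l hkl => by
    have : (k : ℝ) ≤ l := by exact_mod_cast hkl
    simp only [ht]
    gcongr
  have ht0 : t 0 = -R := by simp [ht]
  have htN : t N = R := by
    simp only [ht]
    field_simp
    ring
  -- i k is the maximiser at (t k, t k). Both (x, x) and (x, t k) are compared with this corner,
  -- each at the cost of δ/2.
  choose i hi using fun k => Finite.exists_max fun i => Θ i (t k, t k)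
  rw [← ht0, ← htN, ← sum_lintegral_Ioc htm]
  have key : ∀ k ∈ Finset.range N, ∀ x ∈ Set.Ioc (t k) (t (k + 1)),
      ω x * ⨆ i, ENNReal.ofReal (Θ i (x, x)) ≤
        ω x * ENNReal.ofReal (Θ (i k) (x, t k)) + K * ENNReal.ofReal δ := by
    intro k hk x hx
    have hkN : k + 1 ≤ N := Finset.mem_range.1 hk
    have h1 : t k ∈ Set.Icc (-R) R :=
      ⟨ht0 ▸ htm (Nat.zero_le k), htN ▸ htm (by omega)⟩
    have h2 : x ∈ Set.Icc (-R) R := ⟨h1.1.trans hx.1.le, hx.2.trans (htN ▸ htm hkN)⟩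
    have h3 : dist x (t k) < η := by
      rw [Real.dist_eq, abs_of_pos (sub_pos.2 hx.1)]
      have h4 : t (k + 1) - t k = 2 * R / N := by simp only [ht]; push_cast; ring
      have h5 : 2 * R / N < η := by
        rw [div_lt_iff₀ hη] at hN
        rw [div_lt_iff₀ hN0]
        linarith
      linarith [hx.2]
    have h4 := hunif (x, x) ⟨h2, h2⟩ (t k, t k) ⟨h1, h1⟩ (by simpa [Prod.dist_eq] using h3)
    have h5 := hunif (x, t k) ⟨h2, h1⟩ (t k, t k) ⟨h1, h1⟩
      (by simpa [Prod.dist_eq, hη] using h3)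
    have h6 : ⨆ i, ENNReal.ofReal (Θ i (x, x)) ≤
        ENNReal.ofReal (Θ (i k) (x, t k)) + ENNReal.ofReal δ := by
      refine iSup_le fun j => ?_
      refine le_trans (ENNReal.ofReal_le_ofReal ?_) ENNReal.ofReal_add_le
      have h7 := (abs_lt.1 ((Real.dist_eq _ _) ▸ (dist_le_pi_dist _ _ j).trans_lt h4)).2
      have h8 := (abs_lt.1 ((Real.dist_eq _ _) ▸ (dist_le_pi_dist _ _ (i k)).trans_lt h5)).1
      have h9 := hi k j
      linarith
    calc _ ≤ (ω x : ℝ≥0∞) * (ENNReal.ofReal (Θ (i k) (x, t k)) + ENNReal.ofReal δ) := by gcongr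
      _ ≤ _ := by
        rw [mul_add]
        gcongr
        exact hK x
  calc _ ≤ ∑ k ∈ Finset.range N, ∫⁻ x in Set.Ioc (t k) (t (k + 1)),
        (ω x * ENNReal.ofReal (Θ (i k) (x, t k)) + K * ENNReal.ofReal δ) :=
        Finset.sum_le_sum fun k hk => setLIntegral_mono' measurableSet_Ioc (key k hk)
    _ = (∑ k ∈ Finset.range N, ∫⁻ x in Set.Ioc (t k) (t (k + 1)),
          ω x * ENNReal.ofReal (Θ (i k) (x, t k))) +
        ∑ k ∈ Finset.range N, ∫⁻ _ in Set.Ioc (t k) (t (k + 1)), K * ENNReal.ofReal δ := by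
        rw [← Finset.sum_add_distrib]
        refine Finset.sum_congr rfl fun k _ => lintegral_add_right _ measurable_const
    _ ≤ L + ε := by
        refine add_le_add (hL N t htm (by rw [ht0]; linarith) i) ?_
        rw [sum_lintegral_Ioc htm (fun _ => K * ENNReal.ofReal δ), ht0, htN, setLIntegral_const,
          Real.volume_Ioc, ← ENNReal.ofReal_coe_nnreal, ← ENNReal.ofReal_mul (NNReal.coe_nonneg _),
          ← ENNReal.ofReal_mul (by positivity), ← ENNReal.ofReal_coe_nnreal]
        refine ENNReal.ofReal_le_ofReal ?_
        rw [hδ, sub_neg_eq_add, ← two_mul]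
        rw [show (K : ℝ) * (ε / (K * (2 * R) + 1)) * (2 * R) =
          ε * (K * (2 * R)) / (K * (2 * R) + 1) by ring, div_le_iff₀ (by positivity)]
        nlinarith [NNReal.coe_nonneg ε]

end RiemannSum

/-! ### Passage to continuous time -/

section ContinuousTime

variable {E : Type*} [NormedAddCommGroup E] [InnerProductSpace ℂ E] [CompleteSpace E]

/-- In M i (U₀ x (d j y)) the free time x is integrated over each interval and realised by a step
operator, while y and the weight i are frozen at its left end. The sums are then those of the
discrete estimate, and the free hypothesis supplies their Schatten bound, uniformly in the
partition. -/
theorem exists_lintegral_sum_le {a s : ℝ} (has : a.HolderConjugate s) {cT cS : ℝ}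
    (hcT : 0 < cT) (hcS : 0 < cS) {H₀ : E →ₗ.[ℂ] E} {U₀ : ℝ → E →L[ℂ] E}
    (hU₀ : IsUnitaryGroupOf U₀ H₀) {Λ : E →ₗ.[ℂ] E}
    {τ : Lp E 2 (volume : Measure ℝ) →ₗ[ℂ] E} (hτ : ∀ x, ‖τ x‖ ≤ cT * ‖x‖) :
    ∃ C : ℝ, 0 ≤ C ∧ ∀ (J : Type) [Fintype J] (h : J → E)
    (g : J → Lp E 2 (volume : Measure ℝ)) (d : J → ℝ → E),
    IsBessel 1 h → IsBessel cS g → (∀ j, Continuous (d j)) → (∀ j, (h j, d j 0) ∈ Λ.graph) →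
    (∀ j x y, x ≤ y → (τ (cut (Set.Ioc x y) (g j)), d j y - d j x) ∈ Λ.graph) →
    ∀ (m : ℕ) (M : Fin (m + 1) → E →L[ℂ] E) (ω : ℝ → ℝ≥0), Measurable ω →
    ∀ (K : ℝ≥0), (∀ t, ω t ≤ K) → ∀ D : ℝ, 0 ≤ D →
    (∀ (J' : Type) [Fintype J'] (u : J' → Λ.domain), Orthonormal ℂ u → ∀ w : J' → ℝ,
      (∀ j, 0 ≤ w j) →
      ∫⁻ t, ω t * ⨆ i, ENNReal.ofReal (∑ j, w j * ‖M i (U₀ t (Λ (u j)))‖ ^ 2) ≤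
        ENNReal.ofReal (D * (∑ j, w j ^ a) ^ (1 / a))) →
    ∀ R, 0 < R → ∀ w : J → ℝ, (∀ j, 0 ≤ w j) →
      ∫⁻ t in Set.Ioc (-R) R, ω t *
        ⨆ i, ENNReal.ofReal (∑ j, w j * ‖M i (U₀ t (d j t))‖ ^ 2) ≤
        ENNReal.ofReal (C * D * (∑ j, w j ^ a) ^ (1 / a)) := by
  obtain ⟨C, hC, hCb⟩ := exists_sum_mul_norm_sq_le (E := E)
    (F := Lp E 2 (volume : Measure ℝ)) has hcT hcS
  refine ⟨C, hC, ?_⟩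
  intro J _ h g d hh hg hdc hd0 hd m M ω hω K hK D hD hfree R hR w hw
  have hΘ : ∀ i, Continuous fun z : ℝ × ℝ => ∑ j, w j * ‖M i (U₀ z.1 (d j z.2))‖ ^ 2 := fun i => by
    refine continuous_finsetSum _ fun j _ => continuous_const.mul (Continuous.pow (Continuous.norm
      ((M i).continuous.comp (hU₀.continuous_apply continuous_fst ((hdc j).comp continuous_snd)))) 2)
  refine lintegral_le_of_riemannSum_le
    (fun i z => ∑ j, w j * ‖M i (U₀ z.1 (d j z.2))‖ ^ 2) hΘ hK hR ?_
  intro N t ht ht0 i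
  choose B hB using fun k : ℕ => exists_stepOperator
    (V := fun t => ((M (i k) ∘L U₀ t : E →L[ℂ] E) : E →ₗ[ℂ] E))
    (fun u => (M (i k)).continuous.comp (hU₀.continuous u)) (L := ‖M (i k)‖)
    (fun t u => by
      have := (M (i k)).le_opNorm (U₀ t u)
      rwa [hU₀.norm_map] at this) hω hK (t k) (t (k + 1))
  have hsum : ∀ (J' : Type) [Fintype J'] (w : J' → ℝ) (_ : ∀ j, 0 ≤ w j) (y : J' → ℕ → E),
      ENNReal.ofReal (∑ j, w j * ∑ k : Fin N, ‖B k (y j k)‖ ^ 2) =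
      ∑ k ∈ Finset.range N, ∫⁻ x in Set.Ioc (t k) (t (k + 1)),
        ω x * ENNReal.ofReal (∑ j, w j * ‖M (i k) (U₀ x (y j k))‖ ^ 2) := by
    intro J' _ w hw y
    have h1 : ∑ j, w j * ∑ k : Fin N, ‖B k (y j k)‖ ^ 2 =
        ∑ k : Fin N, ∑ j, w j * ‖B k (y j k)‖ ^ 2 := by
      rw [Finset.sum_comm]
      exact Finset.sum_congr rfl fun j _ => Finset.mul_sum _ _ _
    rw [h1, Fin.sum_univ_eq_sum_range (fun k => ∑ j, w j * ‖B k (y j k)‖ ^ 2) N,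
      ENNReal.ofReal_sum_of_nonneg fun k _ => Finset.sum_nonneg fun j _ =>
        mul_nonneg (hw j) (sq_nonneg _)]
    refine Finset.sum_congr rfl fun k _ => ?_
    rw [ENNReal.ofReal_sum_of_nonneg fun j _ => mul_nonneg (hw j) (sq_nonneg _)]
    have h2 : ∀ x, ω x * ENNReal.ofReal (∑ j, w j * ‖M (i k) (U₀ x (y j k))‖ ^ 2) =
        ∑ j, ENNReal.ofReal (w j) *
          (ω x * ENNReal.ofReal (‖M (i k) (U₀ x (y j k))‖ ^ 2)) := by
      intro x
      rw [ENNReal.ofReal_sum_of_nonneg fun j _ => mul_nonneg (hw j) (sq_nonneg _),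
        Finset.mul_sum]
      refine Finset.sum_congr rfl fun j _ => ?_
      rw [ENNReal.ofReal_mul (hw j), mul_left_comm]
    have hm : ∀ j, Measurable fun x => ω x * ENNReal.ofReal (‖M (i k) (U₀ x (y j k))‖ ^ 2) := by
      intro j
      refine hω.coe_nnreal_ennreal.mul (ENNReal.measurable_ofReal.comp ?_)
      exact (((M (i k)).continuous.comp (hU₀.continuous _)).norm.pow 2).measurable
    simp only [h2]
    rw [lintegral_finsetSum _ fun j _ => (hm j).const_mul _]
    refine Finset.sum_congr rfl fun j _ => ?_
    rw [lintegral_const_mul _ (hm j), ENNReal.ofReal_mul (hw j), hB]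
    rfl
  have hschatten : SchattenBound (fun k : Fin N => B k ∘ₗ Λ.toFun) a D := by
    intro J' _ u hu w hw
    have hnn : 0 ≤ D * (∑ j, w j ^ a) ^ (1 / a) := mul_nonneg hD
      (Real.rpow_nonneg (Finset.sum_nonneg fun j _ => Real.rpow_nonneg (hw j) _) _)
    rw [← ENNReal.ofReal_le_ofReal_iff hnn]
    refine le_trans ?_ (hfree J' u hu w hw)
    refine (hsum J' w hw fun j _ => Λ (u j)).trans_le ?_
    calc _ ≤ ∑ k ∈ Finset.range N, ∫⁻ x in Set.Ioc (t k) (t (k + 1)),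
          ω x * ⨆ i, ENNReal.ofReal (∑ j, w j * ‖M i (U₀ x (Λ (u j)))‖ ^ 2) := by
          refine Finset.sum_le_sum fun k _ => lintegral_mono fun x => ?_
          dsimp only
          gcongr
          exact le_iSup (fun i => ENNReal.ofReal (∑ j, w j * ‖M i (U₀ x (Λ (u j)))‖ ^ 2)) (i k)
      _ ≤ _ := by
          rw [sum_lintegral_Ioc ht]
          exact setLIntegral_le_lintegral _ _
  have hfin := hCb Λ τ hτ J h g d hh hg hd0 hd N t ht ht0 (fun k => B k) D hD hschatten w hw
  rw [← hsum J w hw fun j k => d j (t k)]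
  exact ENNReal.ofReal_le_ofReal hfin

end ContinuousTime

end

end OrthStrichartz

namespace OrthStrichartz

noncomputable section

/-! ### Densities and their norms as suprema -/

section Density

variable {X : Type*} [MeasurableSpace X] {μ : Measure X} {p : ℝ≥0∞} {ι : Type*}

theorem exists_mulSqrt {V : X → ℝ≥0} (hV : IsDualWeight p μ V) :
    ∃ M : Lp ℂ 2 μ →L[ℂ] Lp ℂ 2 μ, ∀ g,
      ENNReal.ofReal (‖M g‖ ^ 2) = ∫⁻ x, V x * ‖g x‖ₑ ^ 2 ∂μ := by
  obtain ⟨K, hK⟩ := hV.bounded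
  have hm : Measurable fun x => ((√(V x) : ℝ) : ℂ) := by
    have := hV.measurable
    fun_prop
  have hb : ∀ (g : Lp ℂ 2 μ) x, ‖((√(V x) : ℝ) : ℂ) * g x‖ ≤ √K * ‖g x‖ := fun g x => by
    rw [norm_mul, Complex.norm_real, Real.norm_of_nonneg (Real.sqrt_nonneg _)]
    have h1 : (V x : ℝ) ≤ K := by exact_mod_cast hK x
    exact mul_le_mul_of_nonneg_right (Real.sqrt_le_sqrt h1) (norm_nonneg _)
  have hG : ∀ g : Lp ℂ 2 μ, MemLp (fun x => ((√(V x) : ℝ) : ℂ) * g x) 2 μ := fun g =>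
    (Lp.memLp g).of_le_mul (hm.aestronglyMeasurable.mul (Lp.aestronglyMeasurable g))
      (Filter.Eventually.of_forall (hb g))
  let M : Lp ℂ 2 μ →ₗ[ℂ] Lp ℂ 2 μ :=
    { toFun := fun g => (hG g).toLp _
      map_add' := fun g h => by
        rw [← MemLp.toLp_add]
        refine MemLp.toLp_congr _ ((hG g).add (hG h)) ?_
        filter_upwards [Lp.coeFn_add g h] with x hx
        rw [hx, Pi.add_apply, Pi.add_apply, mul_add]
      map_smul' := fun c g => by
        rw [RingHom.id_apply, ← MemLp.toLp_const_smul]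
        refine MemLp.toLp_congr _ ((hG g).const_smul c) ?_
        filter_upwards [Lp.coeFn_smul c g] with x hx
        rw [hx, Pi.smul_apply, Pi.smul_apply, smul_eq_mul, smul_eq_mul, mul_left_comm] }
  refine ⟨M.mkContinuous √K fun g => ?_, fun g => ?_⟩
  · refine Lp.norm_le_mul_norm_of_ae_le_mul ?_
    filter_upwards [(hG g).coeFn_toLp] with x hx
    change ‖(hG g).toLp _ x‖ ≤ _
    rw [hx]
    exact hb g x
  · change ENNReal.ofReal (‖(hG g).toLp _‖ ^ 2) = _
    rw [ENNReal.ofReal_pow (norm_nonneg _), ofReal_norm, Lp.enorm_toLp]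
    have h2 := eLpNorm_nnreal_pow_eq_lintegral (f := fun x => ((√(V x) : ℝ) : ℂ) * g x) (μ := μ)
      (p := 2) two_ne_zero
    simp only [NNReal.coe_ofNat, ENNReal.rpow_ofNat, ENNReal.coe_ofNat] at h2
    rw [h2]
    refine lintegral_congr fun x => ?_
    rw [enorm_mul, mul_pow]
    congr 1
    rw [← ofReal_norm, Complex.norm_real, Real.norm_of_nonneg (Real.sqrt_nonneg _),
      ← ENNReal.ofReal_pow (Real.sqrt_nonneg _), Real.sq_sqrt (NNReal.coe_nonneg _),
      ENNReal.ofReal_coe_nnreal]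

/-- Multiplication by the square root of a dual weight. -/
def mulSqrt (V : {V : X → ℝ≥0 // IsDualWeight p μ V}) : Lp ℂ 2 μ →L[ℂ] Lp ℂ 2 μ :=
  (exists_mulSqrt V.2).choose

theorem ofReal_norm_mulSqrt_sq (V : {V : X → ℝ≥0 // IsDualWeight p μ V}) (g : Lp ℂ 2 μ) :
    ENNReal.ofReal (‖mulSqrt V g‖ ^ 2) = ∫⁻ x, V.1 x * ‖g x‖ₑ ^ 2 ∂μ :=
  (exists_mulSqrt V.2).choose_spec g

/-- The density `∑ₙ cₙ |ψₙ|²`. -/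
def density (c : ι → ℝ) (ψ : ι → Lp ℂ 2 μ) (x : X) : ℝ≥0∞ :=
  ∑' n, ENNReal.ofReal (c n) * ‖ψ n x‖ₑ ^ 2

theorem measurable_enorm_sq (g : Lp ℂ 2 μ) : Measurable fun x => ‖g x‖ₑ ^ 2 :=
  (Lp.stronglyMeasurable g).measurable.enorm.pow_const 2

theorem measurable_density [Countable ι] (c : ι → ℝ) (ψ : ι → Lp ℂ 2 μ) :
    Measurable (density c ψ) :=
  Measurable.tsum fun n => (measurable_enorm_sq (ψ n)).const_mul _

theorem lintegral_mul_density [Countable ι] {c : ι → ℝ} (hc : ∀ n, 0 ≤ c n) (ψ : ι → Lp ℂ 2 μ)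
    (V : {V : X → ℝ≥0 // IsDualWeight p μ V}) :
    ∫⁻ x, V.1 x * density c ψ x ∂μ =
      ⨆ s : Finset ι, ENNReal.ofReal (∑ n ∈ s, c n * ‖mulSqrt V (ψ n)‖ ^ 2) := by
  have hm := V.2.measurable.coe_nnreal_ennreal
  simp only [density, ← ENNReal.tsum_mul_left]
  have hm' : ∀ n, AEMeasurable (fun x => V.1 x * (ENNReal.ofReal (c n) * ‖ψ n x‖ₑ ^ 2)) μ :=
    fun n => (hm.mul ((measurable_enorm_sq (ψ n)).const_mul _)).aemeasurable
  rw [lintegral_tsum hm', ENNReal.tsum_eq_iSup_sum]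
  congr 1
  funext s
  rw [ENNReal.ofReal_sum_of_nonneg fun n _ => mul_nonneg (hc n) (sq_nonneg _)]
  refine Finset.sum_congr rfl fun n _ => ?_
  rw [ENNReal.ofReal_mul (hc n), ofReal_norm_mulSqrt_sq,
    ← lintegral_const_mul (f := fun x => V.1 x * ‖ψ n x‖ₑ ^ 2) _
      (hm.mul (measurable_enorm_sq (ψ n)))]
  refine lintegral_congr fun x => ?_
  rw [mul_left_comm]

/-- Writing the norm as a supremum of finite sums that are continuous along continuous orbits gives
lower semicontinuity, hence measurability, in time. -/
theorem eLpNorm_density [SigmaFinite μ] [Countable ι] (hp : 1 ≤ p) {c : ι → ℝ} (hc : ∀ n, 0 ≤ c n)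
    (ψ : ι → Lp ℂ 2 μ) : eLpNorm (density c ψ) p μ =
      ⨆ i : {V : X → ℝ≥0 // IsDualWeight p μ V} × Finset ι,
        ENNReal.ofReal (∑ n ∈ i.2, c n * ‖mulSqrt i.1 (ψ n)‖ ^ 2) := by
  refine le_antisymm (le_of_forall_lt fun b hb => ?_) (iSup_le fun i => ?_)
  · obtain ⟨V, hV, hbV⟩ := exists_isDualWeight hp (measurable_density c ψ) hb
    have h1 := lintegral_mul_density hc ψ ⟨V, hV⟩
    rw [h1] at hbV
    obtain ⟨s, hs⟩ := lt_iSup_iff.1 hbV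
    exact lt_iSup_iff.2 ⟨(⟨V, hV⟩, s), hs⟩
  · refine le_trans ?_ (i.1.2.lintegral_le _ (measurable_density c ψ))
    rw [lintegral_mul_density hc ψ i.1]
    exact le_iSup (fun s => ENNReal.ofReal (∑ n ∈ s, c n * ‖mulSqrt i.1 (ψ n)‖ ^ 2)) i.2

variable {ψ : ι → ℝ → Lp ℂ 2 μ}

theorem continuous_ofReal_sum (hψ : ∀ n, Continuous (ψ n)) (c : ι → ℝ)
    (i : {V : X → ℝ≥0 // IsDualWeight p μ V} × Finset ι) :
    Continuous fun t => ENNReal.ofReal (∑ n ∈ i.2, c n * ‖mulSqrt i.1 (ψ n t)‖ ^ 2) :=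
  ENNReal.continuous_ofReal.comp (continuous_finsetSum _ fun n _ =>
    continuous_const.mul (((mulSqrt i.1).continuous.comp (hψ n)).norm.pow 2))

theorem measurable_eLpNorm_density [SigmaFinite μ] [Countable ι] (hp : 1 ≤ p) {c : ι → ℝ}
    (hc : ∀ n, 0 ≤ c n) (hψ : ∀ n, Continuous (ψ n)) :
    Measurable fun t => eLpNorm (density c fun n => ψ n t) p μ := by
  simp only [eLpNorm_density hp hc]
  exact (lowerSemicontinuous_iSup fun i =>
    (continuous_ofReal_sum hψ c i).lowerSemicontinuous).measurable

/-- The integral of the norm of a density is approximated by finitely many dual weights and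
finitely many terms of the density, on a bounded time interval. -/
theorem exists_finite_lt_lintegral [SigmaFinite μ] [Countable ι] (hp : 1 ≤ p) {c : ι → ℝ}
    (hc : ∀ n, 0 ≤ c n) (hψ : ∀ n, Continuous (ψ n)) {ω : ℝ → ℝ≥0} (hω : Measurable ω)
    {b : ℝ≥0∞} (hb : b < ∫⁻ t, ω t * eLpNorm (density c fun n => ψ n t) p μ) :
    ∃ (m : ℕ) (V : Fin (m + 1) → {V : X → ℝ≥0 // IsDualWeight p μ V}) (s : Finset ι) (R : ℝ),
      0 < R ∧ b < ∫⁻ t in Set.Ioc (-R) R,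
        ω t * ⨆ i, ENNReal.ofReal (∑ n ∈ s, c n * ‖mulSqrt (V i) (ψ n t)‖ ^ 2) := by
  classical
  let φ : {V : X → ℝ≥0 // IsDualWeight p μ V} × Finset ι → ℝ → ℝ≥0∞ := fun i t =>
    ENNReal.ofReal (∑ n ∈ i.2, c n * ‖mulSqrt i.1 (ψ n t)‖ ^ 2)
  have hφ : ∀ i, Continuous (φ i) := continuous_ofReal_sum hψ c
  have hlub : IsLUB (Set.range φ) fun t => eLpNorm (density c fun n => ψ n t) p μ := by
    have h1 : (fun t => eLpNorm (density c fun n => ψ n t) p μ) = ⨆ i, φ i := by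
      funext t
      rw [eLpNorm_density hp hc, iSup_apply]
    rw [h1]
    exact isLUB_iSup
  -- The family of weights is uncountable; lower semicontinuity on ℝ reduces the supremum to a
  -- countable subfamily, so monotone convergence can be used.
  obtain ⟨S, hSsub, hScount, hSlub⟩ := exists_countable_lowerSemicontinuous_isLUB
    (by rintro _ ⟨i, rfl⟩; exact (hφ i).lowerSemicontinuous) hlub
  have hSne : S.Nonempty := by
    rw [Set.nonempty_iff_ne_empty]
    rintro rfl
    have h1 : (fun t => eLpNorm (density c fun n => ψ n t) p μ) = ⊥ := hSlub.unique isLUB_empty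
    have h2 : ∀ t, eLpNorm (density c fun n => ψ n t) p μ = 0 := fun t => congrFun h1 t
    simp [h2] at hb
  obtain ⟨F, hF⟩ := hScount.exists_eq_range hSne
  choose i hi using fun k => hSsub (hF ▸ Set.mem_range_self k : F k ∈ S)
  have hsup : ∀ t, eLpNorm (density c fun n => ψ n t) p μ = ⨆ m : ℕ, ⨆ k : Fin (m + 1), φ (i k) t := by
    intro t
    rw [hF] at hSlub
    have h1 := hSlub.unique isLUB_iSup
    rw [congrFun h1 t, iSup_apply]
    refine le_antisymm (iSup_le fun k => ?_) (iSup_le fun m => iSup_le fun k => ?_)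
    · rw [← hi k]
      exact le_iSup_of_le k (le_iSup (fun j : Fin (k + 1) => φ (i j) t) (Fin.last k))
    · rw [hi k]
      exact le_iSup (fun k => F k t) (k : ℕ)
  have hmeas : ∀ m : ℕ, Measurable fun t => ω t * ⨆ k : Fin (m + 1), φ (i k) t := fun m =>
    hω.coe_nnreal_ennreal.mul (Measurable.iSup fun k => (hφ (i k)).measurable)
  have hmono : Monotone fun (m : ℕ) t => ω t * ⨆ k : Fin (m + 1), φ (i k) t := by
    intro m m' hmm t
    dsimp only
    gcongr
    refine iSup_le fun k => ?_
    exact le_iSup (fun k : Fin (m' + 1) => φ (i k) t) ⟨k, by omega⟩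
  simp only [hsup, ENNReal.mul_iSup] at hb
  simp only [← ENNReal.mul_iSup (ι := Fin _)] at hb
  rw [lintegral_iSup hmeas hmono] at hb
  obtain ⟨m, hm⟩ := lt_iSup_iff.1 hb
  have hcov := aecover_Ioc (μ := (volume : Measure ℝ))
    (Filter.tendsto_neg_atTop_atBot (G := ℝ)) Filter.tendsto_id
  have hlim := hcov.lintegral_tendsto_of_countably_generated (hmeas m).aemeasurable
  obtain ⟨R, hR, hR0⟩ := ((hlim.eventually (lt_mem_nhds hm)).and
    (Filter.eventually_gt_atTop 0)).exists
  refine ⟨m, fun k => (i k).1, Finset.univ.biUnion fun k : Fin (m + 1) => (i k).2, R, hR0,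
    hR.trans_le (lintegral_mono fun t => ?_)⟩
  dsimp only
  gcongr with k
  refine ENNReal.ofReal_le_ofReal (Finset.sum_le_sum_of_subset_of_nonneg ?_
    fun n _ _ => mul_nonneg (hc n) (sq_nonneg _))
  exact Finset.subset_biUnion_of_mem (fun k : Fin (m + 1) => (i k).2) (Finset.mem_univ k)

theorem enorm_tsum_le_density (ν : ι → ℂ) (ψ : ι → Lp ℂ 2 μ) (x : X) :
    ‖∑' n, ν n * ((‖ψ n x‖ ^ 2 : ℝ) : ℂ)‖ₑ ≤ density (fun n => ‖ν n‖) ψ x := by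
  refine enorm_tsum_le_tsum_enorm.trans (le_of_eq (tsum_congr fun n => ?_))
  rw [enorm_mul, ofReal_norm]
  congr 1
  rw [← ofReal_norm, Complex.norm_real, norm_pow, norm_norm, ENNReal.ofReal_pow (norm_nonneg _),
    ofReal_norm]

theorem summable_of_density_lt_top {ν : ι → ℂ} {ψ : ι → Lp ℂ 2 μ} {x : X}
    (h : density (fun n => ‖ν n‖) ψ x < ∞) : Summable fun n => ν n * ((‖ψ n x‖ ^ 2 : ℝ) : ℂ) := by
  refine Summable.of_norm ?_
  have h1 : ∀ n, ‖ν n * ((‖ψ n x‖ ^ 2 : ℝ) : ℂ)‖ =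
      (ENNReal.ofReal ‖ν n‖ * ‖ψ n x‖ₑ ^ 2).toReal := fun n => by
    rw [norm_mul, Complex.norm_real, norm_pow, norm_norm, ENNReal.toReal_mul, ENNReal.toReal_pow,
      toReal_enorm, ENNReal.toReal_ofReal (norm_nonneg _)]
  simp only [h1]
  exact ENNReal.summable_toReal h.ne

theorem density_eq_enorm_tsum {J : Type*} [Fintype J] {w : J → ℝ} (hw : ∀ j, 0 ≤ w j)
    (ψ : J → Lp ℂ 2 μ) (x : X) :
    density w ψ x = ‖∑' j, (w j : ℂ) * ((‖ψ j x‖ ^ 2 : ℝ) : ℂ)‖ₑ := by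
  rw [density, tsum_fintype, tsum_fintype]
  have h1 : ∑ j, (w j : ℂ) * ((‖ψ j x‖ ^ 2 : ℝ) : ℂ) = ((∑ j, w j * ‖ψ j x‖ ^ 2 : ℝ) : ℂ) := by
    push_cast
    rfl
  have h2 : ∀ j, 0 ≤ w j * ‖ψ j x‖ ^ 2 := fun j => mul_nonneg (hw j) (sq_nonneg _)
  rw [h1, ← ofReal_norm, Complex.norm_real, Real.norm_of_nonneg (Finset.sum_nonneg fun j _ => h2 j),
    ENNReal.ofReal_sum_of_nonneg fun j _ => h2 j]
  refine Finset.sum_congr rfl fun j _ => ?_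
  rw [ENNReal.ofReal_mul (hw j), ENNReal.ofReal_pow (norm_nonneg _), ofReal_norm]

end Density

end

end OrthStrichartz

namespace OrthStrichartz

noncomputable section

/-! ### Mixed norms against dual weights -/

section Assembly

variable {X : Type*} [MeasurableSpace X] {μ : Measure X} [SigmaFinite μ]

/-- For nonnegative coefficients the density is the modulus of the sum, so testing in space and then
in time bounds the integral by the mixed norm. -/
theorem lintegral_iSup_le_mixedNorm {p ρ : ℝ≥0∞} (hρ : 1 ≤ ρ) {J : Type*} [Fintype J] {w : J → ℝ}
    (hw : ∀ j, 0 ≤ w j) {ψ : J → ℝ → Lp ℂ 2 μ} (hψ : ∀ j, Continuous (ψ j)) {ω : ℝ → ℝ≥0}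
    (hω : IsDualWeight p volume ω) {m : ℕ}
    (V : Fin (m + 1) → {V : X → ℝ≥0 // IsDualWeight ρ μ V}) :
    ∫⁻ t, ω t * ⨆ i, ENNReal.ofReal (∑ j, w j * ‖mulSqrt (V i) (ψ j t)‖ ^ 2) ≤
      mixedNorm p ρ μ fun t x => ∑' j, (w j : ℂ) * ((‖ψ j t x‖ ^ 2 : ℝ) : ℂ) := by
  have h1 : (fun t => eLpNorm (fun x => ∑' j, (w j : ℂ) * ((‖ψ j t x‖ ^ 2 : ℝ) : ℂ)) ρ μ) =
      fun t => eLpNorm (density w fun j => ψ j t) ρ μ := by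
    funext t
    refine eLpNorm_congr_enorm_ae (Filter.Eventually.of_forall fun x => ?_)
    exact (density_eq_enorm_tsum hw (fun j => ψ j t) x).symm
  rw [mixedNorm, h1]
  refine le_trans (lintegral_mono fun t => ?_)
    (hω.lintegral_le _ (measurable_eLpNorm_density hρ hw hψ))
  dsimp only
  gcongr
  refine iSup_le fun i => ?_
  rw [eLpNorm_density hρ hw]
  exact le_iSup (fun i : {V : X → ℝ≥0 // IsDualWeight ρ μ V} × Finset J =>
    ENNReal.ofReal (∑ n ∈ i.2, w n * ‖mulSqrt i.1 (ψ n t)‖ ^ 2)) (V i, Finset.univ)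

/-- The bound for the densities of all systems follows from a bound for the integrals of finite
sums against finitely many dual weights. -/
theorem strichartz_of_lintegral_le {p ρ α : ℝ≥0∞} (hp : 1 ≤ p) (hρ : 1 ≤ ρ) (hα0 : 0 < α.toReal)
    {ι : Type} [Countable ι] {ψ : ι → ℝ → Lp ℂ 2 μ} (hψ : ∀ n, Continuous (ψ n))
    (ν : lp (fun _ : ι => ℂ) α) {C : ℝ} (hC : 0 ≤ C)
    (h : ∀ ω : ℝ → ℝ≥0, IsDualWeight p volume ω → ∀ (m : ℕ)
      (V : Fin (m + 1) → {V : X → ℝ≥0 // IsDualWeight ρ μ V}) (s : Finset ι) (R : ℝ), 0 < R →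
      ∫⁻ t in Set.Ioc (-R) R,
        ω t * ⨆ i, ENNReal.ofReal (∑ n : s, ‖ν n‖ * ‖mulSqrt (V i) (ψ n t)‖ ^ 2) ≤
        ENNReal.ofReal (C * (∑ n : s, ‖ν n‖ ^ α.toReal) ^ (1 / α.toReal))) :
    (∀ᵐ t : ℝ, ∀ᵐ x ∂μ, Summable fun n => ν n * ((‖ψ n t x‖ ^ 2 : ℝ) : ℂ)) ∧
      mixedNorm p ρ μ (fun t x => ∑' n, ν n * ((‖ψ n t x‖ ^ 2 : ℝ) : ℂ)) ≤
        ENNReal.ofReal (C * ‖ν‖) := by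
  have hc : ∀ n, 0 ≤ ‖ν n‖ := fun n => norm_nonneg _
  have hmeas := measurable_eLpNorm_density hρ hc hψ
  have key : eLpNorm (fun t => eLpNorm (density (fun n => ‖ν n‖) fun n => ψ n t) ρ μ) p volume ≤
      ENNReal.ofReal (C * ‖ν‖) := by
    refine le_of_forall_lt fun b hb => ?_
    obtain ⟨ω, hω, hb1⟩ := exists_isDualWeight hp hmeas hb
    obtain ⟨m, V, s, R, hR, hb2⟩ := exists_finite_lt_lintegral hρ hc hψ hω.measurable hb1
    refine hb2.trans_le ?_
    have h1 := h ω hω m V s R hR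
    simp only [Finset.sum_coe_sort s fun n => ‖ν n‖ ^ α.toReal] at h1
    have h2 : ∀ t i, ∑ n : s, ‖ν n‖ * ‖mulSqrt (V i) (ψ n t)‖ ^ 2 =
        ∑ n ∈ s, ‖ν n‖ * ‖mulSqrt (V i) (ψ n t)‖ ^ 2 := fun t i =>
      Finset.sum_coe_sort s fun n => ‖ν n‖ * ‖mulSqrt (V i) (ψ n t)‖ ^ 2
    simp only [h2] at h1
    refine h1.trans (ENNReal.ofReal_le_ofReal (mul_le_mul_of_nonneg_left ?_ hC))
    have h3 := lp.sum_rpow_le_norm_rpow hα0 ν s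
    calc _ ≤ (‖ν‖ ^ α.toReal) ^ (1 / α.toReal) :=
          Real.rpow_le_rpow (Finset.sum_nonneg fun n _ => Real.rpow_nonneg (hc n) _) h3
            (by positivity)
      _ = ‖ν‖ := by
          rw [← Real.rpow_mul (lp.norm_nonneg' ν), mul_one_div_cancel hα0.ne', Real.rpow_one]
  have hp0 : p ≠ 0 := (zero_lt_one.trans_le hp).ne'
  have hρ0 : ρ ≠ 0 := (zero_lt_one.trans_le hρ).ne'
  refine ⟨?_, ?_⟩
  · filter_upwards [ae_lt_top_of_eLpNorm_lt_top hp0 hmeas (key.trans_lt ENNReal.ofReal_lt_top)]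
      with t ht
    filter_upwards [ae_lt_top_of_eLpNorm_lt_top hρ0 (measurable_density _ _) ht] with x hx
    exact summable_of_density_lt_top hx
  · refine le_trans ?_ key
    refine eLpNorm_mono_enorm fun t => ?_
    refine eLpNorm_mono_enorm fun x => ?_
    exact enorm_tsum_le_density (fun n => ν n) (fun n => ψ n t) x

end Assembly

end

end OrthStrichartz

/-! ### Proof of the perturbed estimate -/

theorem mainTheorem12 {X : Type*} [MeasurableSpace X] (μ : Measure X) [SigmaFinite μ]
    (H₀ H Y Z : Lp ℂ 2 μ →ₗ.[ℂ] Lp ℂ 2 μ)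
    (hH₀ : IsSelfAdjoint H₀)
    (hH₀_nonneg : ∀ u : H₀.domain, 0 ≤ (inner ℂ (H₀ u) (u : Lp ℂ 2 μ)).re)
    (hH : IsSelfAdjoint H)
    (hY_dense : Dense (Y.domain : Set (Lp ℂ 2 μ))) (hY_closed : Y.IsClosed)
    (hZ_dense : Dense (Z.domain : Set (Lp ℂ 2 μ))) (hZ_closed : Z.IsClosed)
    (hdom : (H.domain : Set (Lp ℂ 2 μ)) ∪ H₀.domain ⊆ (Y.domain : Set (Lp ℂ 2 μ)) ∩ Z.domain)
    (hform : ∀ (u : H.domain) (v : H₀.domain),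
      inner ℂ (H u) (v : Lp ℂ 2 μ) = inner ℂ (u : Lp ℂ 2 μ) (H₀ v) +
        inner ℂ (Z ⟨u, (hdom (Or.inl u.2)).2⟩) (Y ⟨v, (hdom (Or.inr v.2)).1⟩))
    (θ : ℝ)
    (hker : θ ≠ 0 → ∀ u : H₀.domain, H₀ u = 0 → (u : Lp ℂ 2 μ) = 0)
    (hY_smooth : OrthStrichartz.IsKatoSmooth (OrthStrichartz.product Y (OrthStrichartz.power H₀ θ)).closure H₀)
    (hZ_smooth : ∃ C : ℝ≥0, ∀ u : (OrthStrichartz.power H₀ (-θ)).domain,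
      OrthStrichartz.TimeL2Bound Z (fun t => OrthStrichartz.propagator H t (OrthStrichartz.power H₀ (-θ) u))
        (C * ‖(u : Lp ℂ 2 μ)‖ₑ))
    (q r α : ℝ≥0∞) (hq : 2 ≤ q) (hr : 2 ≤ r) (hα : 1 < α) (hα_top : α < ∞)
    (hfree : OrthStrichartz.OrthonormalStrichartz μ H₀ (OrthStrichartz.power H₀ θ) (q / 2) (r / 2) α) :
    OrthStrichartz.OrthonormalStrichartz μ H (OrthStrichartz.power H₀ θ) (q / 2) (r / 2) α := by
  have hU₀ := OrthStrichartz.isUnitaryGroupOf_propagator hH₀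
  have hU := OrthStrichartz.isUnitaryGroupOf_propagator hH
  have hp : 1 ≤ q / 2 := by
    rw [ENNReal.le_div_iff_mul_le (by simp) (by simp), one_mul]
    exact hq
  have hρ : 1 ≤ r / 2 := by
    rw [ENNReal.le_div_iff_mul_le (by simp) (by simp), one_mul]
    exact hr
  have hα1 : 1 < α.toReal := by
    simpa using (ENNReal.toReal_lt_toReal ENNReal.one_ne_top hα_top.ne).2 hα
  have hα0 : 0 < α.toReal := by linarith
  have has := Real.HolderConjugate.conjExponent hα1
  have hpert : OrthStrichartz.FormPerturbation H H₀ Y Z := by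
    intro u u' v v' z y hu hv hz hy
    obtain ⟨u₁, rfl, rfl⟩ := (LinearPMap.mem_graph_iff H).1 hu
    obtain ⟨v₁, rfl, rfl⟩ := (LinearPMap.mem_graph_iff H₀).1 hv
    rw [hform u₁ v₁]
    congr 2
    · exact OrthStrichartz.snd_eq_of_mem_graph (Z.mem_graph _) hz
    · exact OrthStrichartz.snd_eq_of_mem_graph (Y.mem_graph _) hy
  obtain ⟨CT, hCT⟩ := hY_smooth
  obtain ⟨CS, hCS⟩ := hZ_smooth
  obtain ⟨C₀, hC₀⟩ := hfree
  obtain ⟨𝒯, h𝒯norm, h𝒯⟩ := OrthStrichartz.exists_timeMap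
    (LinearMap.pi fun t => (OrthStrichartz.propagator H₀ t : Lp ℂ 2 μ →ₗ[ℂ] Lp ℂ 2 μ)) CT hCT
  obtain ⟨S, hSnorm, hS⟩ := OrthStrichartz.exists_timeMap
    (LinearMap.pi fun t => (OrthStrichartz.propagator H t : Lp ℂ 2 μ →ₗ[ℂ] Lp ℂ 2 μ) ∘ₗ
      (OrthStrichartz.power H₀ (-θ)).toFun) CS hCS
  have hτ : ∀ x, ‖(-(Complex.I • (ContinuousLinearMap.adjoint 𝒯 :
      Lp (Lp ℂ 2 μ) 2 (volume : Measure ℝ) →ₗ[ℂ] Lp ℂ 2 μ)) :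
      Lp (Lp ℂ 2 μ) 2 (volume : Measure ℝ) →ₗ[ℂ] Lp ℂ 2 μ) x‖ ≤ ((CT : ℝ) + 1) * ‖x‖ := by
    intro x
    rw [LinearMap.neg_apply, norm_neg, LinearMap.smul_apply, norm_smul, Complex.norm_I, one_mul]
    have h1 : ‖ContinuousLinearMap.adjoint 𝒯‖ ≤ CT := by
      rw [LinearIsometryEquiv.norm_map]
      exact 𝒯.opNorm_le_bound CT.2 h𝒯norm
    refine ((ContinuousLinearMap.adjoint 𝒯).le_of_opNorm_le h1 x).trans ?_
    exact mul_le_mul_of_nonneg_right (by linarith) (norm_nonneg _)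
  -- Adding 1 makes both operator bounds strictly positive, as needed to rescale the Bessel
  -- families.
  obtain ⟨C, hC, hCbound⟩ := OrthStrichartz.exists_lintegral_sum_le has
    (by positivity : 0 < (CT : ℝ) + 1) (by positivity : 0 < (CS : ℝ) + 1) hU₀
    (Λ := OrthStrichartz.power H₀ (-θ)) hτ
  refine ⟨(C * C₀).toNNReal, fun ι _ f hf ν => ?_⟩
  have hgraph : ∀ n, ((OrthStrichartz.power H₀ θ) (f n), (f n : Lp ℂ 2 μ)) ∈
      (OrthStrichartz.power H₀ (-θ)).graph := fun n =>
    (OrthStrichartz.mem_power_neg_graph_iff hH₀ hH₀_nonneg hker).2 (LinearPMap.mem_graph _ _)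
  -- h n is H₀^θ (f n) viewed as an element of D(H₀^{-θ}), the space on which S acts.
  choose h hh₁ hh₂ using fun n => (LinearPMap.mem_graph_iff _).1 (hgraph n)
  simp only at hh₁ hh₂
  have hdc : ∀ n, Continuous fun t => OrthStrichartz.propagator H₀ (-t)
      (OrthStrichartz.propagator H t (f n : Lp ℂ 2 μ)) := fun n =>
    hU₀.continuous_apply continuous_neg (hU.continuous _)
  have hmain := OrthStrichartz.strichartz_of_lintegral_le (μ := μ) hp hρ hα0
    (ψ := fun n t => OrthStrichartz.propagator H t (f n : Lp ℂ 2 μ))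
    (fun n => hU.continuous _) ν (C := C * C₀) (by positivity) ?_
  · refine ⟨hmain.1, hmain.2.trans (le_of_eq ?_)⟩
    rw [ENNReal.ofReal_mul (by positivity)]
    rfl
  intro ω hω m V s R hR
  obtain ⟨K, hK⟩ := hω.bounded
  have horth : Orthonormal ℂ fun n : s => (OrthStrichartz.power H₀ θ) (f n) :=
    hf.comp _ Subtype.val_injective
  have horth' : Orthonormal ℂ fun n : s => h n := by
    rw [← (OrthStrichartz.power H₀ (-θ)).domain.subtypeₗᵢ.orthonormal_comp_iff]
    exact (congrArg (Orthonormal ℂ) (funext fun n : s => hh₁ n)).mpr horth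
  -- The path is d(t) = e^{itH₀}e^{-itH}f n, so applying e^{-itH₀} to it returns e^{-itH}f n.
  have key := hCbound s (fun n => (OrthStrichartz.power H₀ θ) (f n)) (fun n => S (h n))
    (fun n t => OrthStrichartz.propagator H₀ (-t)
      (OrthStrichartz.propagator H t (f n : Lp ℂ 2 μ))) horth.isBessel ?_ (fun n => hdc n) ?_ ?_
    m (fun i => OrthStrichartz.mulSqrt (V i)) ω hω.measurable K hK C₀ C₀.2 ?_ R hR
    (fun n => ‖ν n‖) (fun n => norm_nonneg _)
  · simpa only [hU₀.apply_neg_apply] using key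
  · have h1 := horth'.isBessel.map (S : _ →ₗ[ℂ] Lp (Lp ℂ 2 μ) 2 (volume : Measure ℝ))
      (M := (CS : ℝ) + 1) fun x => (hSnorm x).trans
        (mul_le_mul_of_nonneg_right (by linarith) (norm_nonneg _))
    rwa [mul_one] at h1
  · intro n
    simp only [neg_zero, hU₀.zero_apply, hU.zero_apply]
    exact hgraph n
  · intro n x y hxy
    rw [OrthStrichartz.mem_power_neg_graph_iff hH₀ hH₀_nonneg hker]
    refine OrthStrichartz.sub_mem_graph_power hH₀ hH₀_nonneg hker hpert
      (fun v hv => (hdom (Or.inr hv)).1) hU hU₀ hZ_closed 𝒯 (fun u => h𝒯 u) ?_ hxy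
    have h1 := hS (h n)
    rw [OrthStrichartz.mem_orbitGraph]
    filter_upwards [h1] with t ht
    rw [← hh₂ n]
    exact ht
  · intro J _ u hu w hw
    -- An orthonormal family u in D(H₀^{-θ}) corresponds to the orthonormal system e = H₀^{-θ}u in
    -- D(H₀^θ), to which the free estimate applies.
    have hfree := fun j => (OrthStrichartz.mem_power_neg_graph_iff hH₀ hH₀_nonneg hker).1
      (LinearPMap.mem_graph (OrthStrichartz.power H₀ (-θ)) (u j))
    choose e he₁ he₂ using fun j => (LinearPMap.mem_graph_iff _).1 (hfree j)
    simp only at he₁ he₂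
    have horthe : Orthonormal ℂ fun j => (OrthStrichartz.power H₀ θ) (e j) := by
      simp only [he₂]
      exact hu.comp_linearIsometry (OrthStrichartz.power H₀ (-θ)).domain.subtypeₗᵢ
    let ν' : lp (fun _ : J => ℂ) α := ⟨fun j => (w j : ℂ), Memℓp.all _⟩
    have h1 := (hC₀ J e horthe ν').2
    have h2 : ‖ν'‖ = (∑ j, w j ^ α.toReal) ^ (1 / α.toReal) := by
      rw [lp.norm_eq_tsum_rpow hα0, tsum_fintype]
      congr 1
      refine Finset.sum_congr rfl fun j _ => ?_
      change ‖(w j : ℂ)‖ ^ _ = _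
      rw [Complex.norm_real, Real.norm_of_nonneg (hw j)]
    rw [h2] at h1
    refine (OrthStrichartz.lintegral_iSup_le_mixedNorm hρ hw
      (ψ := fun j t => OrthStrichartz.propagator H₀ t (OrthStrichartz.power H₀ (-θ) (u j)))
      (fun j => hU₀.continuous _) hω V).trans ?_
    rw [ENNReal.ofReal_mul (NNReal.coe_nonneg C₀), ENNReal.ofReal_coe_nnreal]
    simp only [← he₁]
    exact h1
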